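/- **Setting.** Let $H\in(0,1)$ and let $(\Omega,\mathcal F,P)$ be a probability space carrying a two-sided Brownian motion $B$ and a strictly positive random variable $A$ independent of $B$. For a probability measure $\mu$ on $(0,\infty)$ put $\mathcal L[\mu](t)=\int_0^\infty e^{-tx}\,d\mu(x)$, $t\ge 0$, and let $\mathcal L[A]$ be the Laplace transform of the law of $A$. Let $R_A\in[0,\infty]$ be the maximal radius such that $\mathcal L[A]$ extends holomorphically to the ball $\{z\in\mathbb C:|z|<R_A\}$, and assume $R_A>0$. Let $I(f)=\int f\,dB$ be the Wiener integral of $f\in L^2(\mathbb R)$. Put $K_H=\Gamma(H+\tfrac12)\left(\int_0^\infty\big((1+s)^{H-1/2}-s^{H-1/2}\big)^2ds+\tfrac1{2H}\right)^{-1/2}$. For $H>1/2$ let $$(M_-^Hf)(x)=\frac{K_H}{\Gamma(H-1/2)}\int_x^\infty f(t)(t-x)^{H-3/2}dt,\qquad (M_+^Hf)(x)=\frac{K_H}{\Gamma(H-1/2)}\int_{-\infty}^x f(t)(x-t)^{H-3/2}dt;$$ for $H<1/2$ let $$(M_\pm^Hf)(x)=\lim_{\varepsilon\downarrow0}\frac{K_H(1/2-H)}{\Gamma(1/2+H)}\int_\varepsilon^\infty\frac{f(x)-f(x\mp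 t)}{t^{3/2-H}}dt;$$ and let $M_\pm^{1/2}$ be the identity. Write $\mathbf 1_{(0,t)}$ for the indicator function of $[0,t)$. Let $L^2_A=L^2(\Omega,\sigma(B,A),P)$ and $D_A=\{\eta\in\mathcal S(\mathbb R):2\|\eta\|_2^2<R_A\}$. For $\eta\in D_A$ let $W_A(\eta)=e^{\sqrt A I(\eta)}/E[e^{\sqrt AI(\eta)}]$ and $S_A[\Theta](\eta)=E[\Theta W_A(\eta)]$. Let $X=\sqrt A\,B^H$ be the randomly scaled fractional Brownian motion, $B^H_t=I(M_-^H\mathbf 1_{(0,t)})$. For a Borel set $M$ and a process $Y:M\to L^2_A$, the fractional Itô integral $\int_MY_t\,dX_t$ is the element $\Theta\in L^2_A$ with $$S_A[\Theta](\eta)=\int_M S_A[AY_t](\eta)\,(M_+^H\eta)(t)\,dt\qquad\text{for all }\eta\in D_A,$$ where the integrand on the right is required to be in $L^1(M)$. Let $\nu:[0,\infty)\to\mathbb R$ be continuous, and constant if $H<1/2$. Let $Z_t=\int_0^t\nu(s)\,dX_s$, $t\ge0$, and suppose that the variance of $Z_t$ is a monotonically increasing (nondecreasing) function of $t\in[0,\infty)$.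 Let $$\sigma_\nu(t)=\big\|M_-^H(\nu\mathbf 1_{(0,t)})\big\|_{L^2(\mathbb R)}^{1/H},\qquad t\ge0 .$$ **Theorem.** Let $K:(0,\infty)\times(0,\infty)\times\mathbb R\to\mathbb R$, $(t,s,\xi)\mapsto K_{t,s}(\xi)$, be Borel measurable and suppose that 1. $\displaystyle\mathcal L[A](t^{2H}\xi)=1+\int_0^tK_{t,s}(\xi)\,\mathcal L[A](s^{2H}\xi)\,ds$ for all $t,\xi>0$; 2. for all $t\ge s>0$ the function $\xi\mapsto|K_{t,s}(\xi^2/2)|$ is in $\mathcal S'(\mathbb R)$, i.e. $f\mapsto\int_{\mathbb R}|K_{t,s}(\xi^2/2)|f(\xi)\,d\xi$ is a well-defined tempered distribution; 3. for all $t>0$ and $f\in\mathcal S(\mathbb R)$ the function $s\mapsto\int_{\mathbb R}|K_{t,s}(\xi^2/2)|f(\xi)\,d\xi$ is in $L^1(0,t)$. Let $K_{t,s}(-\Delta/2)$ be the pseudo-differential operator with symbol $K_{t,s}(\xi^2/2)$, $$K_{t,s}(-\Delta/2)f(x)=\frac1{2\pi}\int_{\mathbb R}\int_{\mathbb R}e^{i(x-q)\xi}K_{t,s}(\xi^2/2)f(q)\,dq\,d\xi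 .$$ Then for every $u_0\in\mathcal S(\mathbb R)$ the function $u(t,x)=E[u_0(x+Z_t)]$, $t\ge0$, $x\in\mathbb R$, solves $$u(t,x)=u_0(x)+\int_0^t\sigma_\nu'(s)\,K_{\sigma_\nu(t),\sigma_\nu(s)}(-\Delta/2)u(s,x)\,ds,\qquad t>0,\ x\in\mathbb R,$$ and $u$ is continuous in $t\in[0,\infty)$ and infinitely often differentiable in $x$. Here $\sigma_\nu$ is differentiable on $(0,\infty)$; for $0<s\le t$ with $\sigma_\nu(s)>0$ the integrals defining $K_{\sigma_\nu(t),\sigma_\nu(s)}(-\Delta/2)u(s,\cdot)$ converge, in the sense that $u(s,\cdot)$ and the product of $K_{\sigma_\nu(t),\sigma_\nu(s)}(\xi^2/2)$ with the Fourier transform of $u(s,\cdot)$ are integrable; the integrand $s\mapsto\sigma_\nu'(s)K_{\sigma_\nu(t),\sigma_\nu(s)}(-\Delta/2)u(s,x)$ is integrable over $(0,t)$ and is read as $0$ at the points $s$ with $\sigma_\nu(s)=0$ (there $\sigma_\nu'(s)=0$). -/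

import Mathlib

open MeasureTheory ProbabilityTheory Set Filter Topology
open scoped NNReal SchwartzMap

noncomputable section

namespace RSFBM

/-! ### Fractional operators -/

/-- The constant `K_H = Γ(H+1/2) (∫₀^∞ ((1+s)^{H-1/2} - s^{H-1/2})² ds + 1/(2H))^{-1/2}`. -/
def hurstConst (H : ℝ) : ℝ :=
  Real.Gamma (H + 1 / 2) *
    ((∫ s in Ioi (0 : ℝ), ((1 + s) ^ (H - 1 / 2) - s ^ (H - 1 / 2)) ^ 2) + 1 / (2 * H))
      ^ (-(1 / 2) : ℝ)

/-- The operator `M_-^H`: the right-sided fractional integral of Weyl's type for `H > 1/2`, the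
identity for `H = 1/2`, the right-sided fractional derivative of Marchaud's type (a pointwise limit
of truncated integrals) for `H < 1/2`. -/
def MMinus (H : ℝ) (f : ℝ → ℝ) (x : ℝ) : ℝ :=
  if 1 / 2 < H then
    hurstConst H / Real.Gamma (H - 1 / 2) * ∫ t in Ioi x, f t * (t - x) ^ (H - 3 / 2)
  else if H = 1 / 2 then f x
  else
    limUnder (𝓝[>] (0 : ℝ)) fun ε : ℝ =>
      hurstConst H * (1 / 2 - H) / Real.Gamma (1 / 2 + H) *
        ∫ t in Ioi ε, (f x - f (x + t)) / t ^ (3 / 2 - H)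

/-- The operator `M_+^H`: the left-sided counterpart of `MMinus`. -/
def MPlus (H : ℝ) (f : ℝ → ℝ) (x : ℝ) : ℝ :=
  if 1 / 2 < H then
    hurstConst H / Real.Gamma (H - 1 / 2) * ∫ t in Iio x, f t * (x - t) ^ (H - 3 / 2)
  else if H = 1 / 2 then f x
  else
    limUnder (𝓝[>] (0 : ℝ)) fun ε : ℝ =>
      hurstConst H * (1 / 2 - H) / Real.Gamma (1 / 2 + H) *
        ∫ t in Ioi ε, (f x - f (x - t)) / t ^ (3 / 2 - H)

/-- The signed indicator of the interval from `s` to `t`: it is `1` on `[s,t)` if `s ≤ t`,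
and `-1` on `[t,s)` if `t < s`. -/
def signedIndicator (s t x : ℝ) : ℝ :=
  if s ≤ x ∧ x < t then 1 else if t ≤ x ∧ x < s then -1 else 0

/-- The time change `σ_ν(t) = ‖M_-^H (ν 1_{(0,t)})‖_{L²(ℝ)}^{1/H}`. -/
def timeChange (H : ℝ) (ν : ℝ → ℝ) (t : ℝ) : ℝ :=
  (eLpNorm (MMinus H fun s => ν s * signedIndicator 0 t s) 2 volume).toReal ^ (1 / H)

/-! ### Laplace transforms -/

/-- The Laplace transform of a measure on `ℝ` (used for measures carried by `(0,∞)`). -/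
def laplace (μ : Measure ℝ) (t : ℝ) : ℝ := ∫ x, Real.exp (-(t * x)) ∂μ

/-- The largest radius `r ∈ [0,∞]` such that `φ`, given on `[0,∞)`, extends to a holomorphic
function on the open complex ball of radius `r` around `0`. -/
def holomorphyRadius (φ : ℝ → ℝ) : ENNReal :=
  sSup {r : ENNReal | ∃ F : ℂ → ℂ, DifferentiableOn ℂ F (Metric.eball 0 r) ∧
    ∀ x : ℝ, 0 ≤ x → ENNReal.ofReal x < r → F (x : ℂ) = (φ x : ℂ)}

/-! ### Brownian motion and the Wiener integral -/

variable {Ω : Type*} [MeasurableSpace Ω]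

/-- A two-sided Brownian motion: `(B_t)_{t ≥ 0}` and `(B_{-t})_{t ≥ 0}` are two independent
Brownian motions started at `0`. -/
structure IsTwoSidedBrownianMotion (B : ℝ → Ω → ℝ) (P : Measure Ω) : Prop where
  measurable : ∀ t, Measurable (B t)
  right : IsBrownianReal (fun (t : ℝ≥0) ω => B (t : ℝ) ω) P
  left : IsBrownianReal (fun (t : ℝ≥0) ω => B (-(t : ℝ)) ω) P
  indep : IndepFun (fun ω (t : ℝ≥0) => B (t : ℝ) ω) (fun ω (t : ℝ≥0) => B (-(t : ℝ)) ω) P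

/-- The step function `∑_t c_t 1_{(0,t)}`. -/
def stepFun (c : ℝ →₀ ℝ) (x : ℝ) : ℝ := c.sum fun t a => a * signedIndicator 0 t x

/-- The Wiener integral `∑_t c_t (B_t - B_0)` of the step function `∑_t c_t 1_{(0,t)}`. -/
def stepIntegral (B : ℝ → Ω → ℝ) (c : ℝ →₀ ℝ) (ω : Ω) : ℝ := c.sum fun t a => a * (B t ω - B 0 ω)

/-- `Y` is a version of the Wiener integral `∫ f dB`: it is the `L²`-limit of the Wiener integrals
of step functions that converge to `f` in `L²(ℝ)`. -/
def IsWienerIntegral (B : ℝ → Ω → ℝ) (P : Measure Ω) (f : ℝ → ℝ) (Y : Ω → ℝ) : Prop :=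
  MemLp Y 2 P ∧ ∃ c : ℕ → ℝ →₀ ℝ,
    Tendsto (fun n => eLpNorm (fun x => stepFun (c n) x - f x) 2 volume) atTop (𝓝 0) ∧
    Tendsto (fun n => eLpNorm (fun ω => stepIntegral B (c n) ω - Y ω) 2 P) atTop (𝓝 0)

open Classical in
/-- The Wiener integral `I(f) = ∫ f dB` of `f ∈ L²(ℝ)` (a version of it). -/
def wienerIntegral (B : ℝ → Ω → ℝ) (P : Measure Ω) (f : ℝ → ℝ) : Ω → ℝ :=
  if h : ∃ Y, IsWienerIntegral B P f Y then h.choose else 0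

/-! ### The `S_A`-transform and the fractional Itô integral -/

/-- The `σ`-algebra `σ(B, A)`. -/
abbrev sigmaBA (B : ℝ → Ω → ℝ) (A : Ω → ℝ) : MeasurableSpace Ω :=
  (⨆ t : ℝ, MeasurableSpace.comap (B t) inferInstance) ⊔ MeasurableSpace.comap A inferInstance

/-- `Θ` represents an element of `L²_A = L²(Ω, σ(B,A), P)`. -/
def MemL2A (B : ℝ → Ω → ℝ) (A : Ω → ℝ) (P : Measure Ω) (Θ : Ω → ℝ) : Prop :=
  AEStronglyMeasurable[sigmaBA B A] Θ P ∧ MemLp Θ 2 P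

/-- The set `D_A` of admissible test functions: `η ∈ 𝓢(ℝ)` with `2 ‖η‖₂² < R_A`. -/
def testFunctions (A : Ω → ℝ) (P : Measure Ω) : Set 𝓢(ℝ, ℝ) :=
  {η | 2 * eLpNorm η 2 volume ^ 2 < holomorphyRadius (laplace (P.map A))}

/-- The Wick-`A` exponential `W_A(η) = exp(√A I(η)) / E[exp(√A I(η))]`. -/
def wickExp (B : ℝ → Ω → ℝ) (A : Ω → ℝ) (P : Measure Ω) (η : ℝ → ℝ) (ω : Ω) : ℝ :=
  Real.exp (√(A ω) * wienerIntegral B P η ω) /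
    ∫ ω', Real.exp (√(A ω') * wienerIntegral B P η ω') ∂P

/-- The `S_A`-transform `S_A[Θ](η) = E[Θ W_A(η)]`. -/
def STransform (B : ℝ → Ω → ℝ) (A : Ω → ℝ) (P : Measure Ω) (Θ : Ω → ℝ) (η : ℝ → ℝ) : ℝ :=
  ∫ ω, Θ ω * wickExp B A P η ω ∂P

/-- `Θ = ∫_M Y_t dX_t`: the process `Y : M → L²_A` is fractionally integrable with respect to the
randomly scaled fractional Brownian motion `X = √A B^H`, where `B^H_t = I(M_-^H 1_{(0,t)})`, and
`Θ` is (a version of) its fractional Itô integral, which is characterized by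
`S_A[Θ](η) = ∫_M S_A[A Y_t](η) (M_+^H η)(t) dt` for all `η ∈ D_A`. -/
structure IsFracItoIntegral (H : ℝ) (B : ℝ → Ω → ℝ) (A : Ω → ℝ) (P : Measure Ω)
    (M : Set ℝ) (Y : ℝ → Ω → ℝ) (Θ : Ω → ℝ) : Prop where
  integrand_mem : ∀ t ∈ M, MemL2A B A P (Y t)
  integrable : ∀ η ∈ testFunctions A P,
    IntegrableOn (fun t => STransform B A P (fun ω => A ω * Y t ω) η * MPlus H η t) M
  mem : MemL2A B A P Θ
  eq : ∀ η ∈ testFunctions A P,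
    STransform B A P Θ η =
      ∫ t in M, STransform B A P (fun ω => A ω * Y t ω) η * MPlus H η t

/-! ### Tempered functions and pseudo-differential operators -/

/-- The function `g` belongs to `𝓢'(ℝ)`: `f ↦ ∫ g f` is a (well-defined) tempered distribution. -/
def IsTemperedFunction (g : ℝ → ℝ) : Prop :=
  ∃ T : 𝓢'(ℝ, ℂ), ∀ f : 𝓢(ℝ, ℂ),
    Integrable (fun ξ => (g ξ : ℂ) * f ξ) ∧ T f = ∫ ξ, (g ξ : ℂ) * f ξ

/-- The pseudo-differential operator with symbol `m`:
`f ↦ (1/2π) ∫ ∫ e^{i(x-q)ξ} m(ξ) f(q) dq dξ`. -/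
def psiDO (m : ℝ → ℝ) (f : ℝ → ℝ) (x : ℝ) : ℂ :=
  1 / (2 * Real.pi) *
    ∫ ξ : ℝ, ∫ q : ℝ, Complex.exp (Complex.I * ((x - q) * ξ)) * (m ξ : ℂ) * (f q : ℂ)

/-- Both integrals in the definition of `psiDO m f` converge absolutely: `f` and the product of `m`
with the Fourier transform of `f` are integrable. -/
def PsiDODefined (m : ℝ → ℝ) (f : ℝ → ℝ) : Prop :=
  Integrable f ∧
    Integrable fun ξ : ℝ => (m ξ : ℂ) * ∫ q : ℝ, Complex.exp (-(Complex.I * (q * ξ))) * (f q : ℂ)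

end RSFBM

end

namespace RSFBM

/-! ### Step functions and their Wiener integrals -/

/-! Write V(t) for the squared L²-norm of M_-^H(ν 1_{(0,t)}), so that σ_ν(t)^{2H} = V(t). The core
fact is that Z_t = √A · I(M_-^H(ν 1_{(0,t)})) almost surely. Given A, the variable Z_t is then
centered Gaussian with variance A·V(t), hence E[exp(iξZ_t)] = L[A](σ_ν(t)^{2H} ξ²/2). In Fourier
variables u(t,·) is therefore û₀(ξ) times this factor. The kernel identity at time T = σ_ν(t) and
frequency ξ²/2, multiplied by û₀(ξ) and inverted, is an integral equation over r ∈ (0, σ_ν(t)), and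
the substitution r = σ_ν(s) turns it into the stated one (`kernel_evolution`,
`integral_deriv_smul_comp_of_monotoneOn`). Fubini's theorem needs absolute integrability of
K_{T,r}(ξ²/2) û₀(ξ) in (r,ξ). The hypotheses give it against real Schwartz functions, and |û₀| lies
below one of them (`exists_schwartz_majorant`).

The formula for Z_t (`IsFracItoIntegral.ae_eq`) compares S_A-transforms. Gaussian integration by
parts computes that of the scaled Wiener integral, and fractional integration by parts
(`setIntegral_MPlus`) matches it with the defining formula. Uniqueness is totality of the variables
exp(√A I(η)), η small, in L²(σ(B,A)) (`ae_eq_zero_of_forall_integral_mul_exp`): analytic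
continuation passes from exponentials to characteristic functions, these determine measures on the
path space of √A(B - B_0), and this path determines A by its quadratic variation, hence also B. All
of this uses exponential moments of A, which follow from holomorphy of L[A] near 0 by Cauchy
estimates.

It remains to see that σ_ν = V^{1/(2H)} is differentiable (`differentiableAt_timeChange`). For H <
1/2 it is linear. For H ≥ 1/2 the function V is a primitive of a continuous function, and only zeros
of V are delicate when H > 1/2. There monotonicity forces V, and then ν, to vanish on all of [0,t],
so that V(s) = o((s - t)^{2H}) as s decreases to t. -/

lemma signedIndicator_of_nonneg {t : ℝ} (ht : 0 ≤ t) :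
    signedIndicator 0 t = (Ico 0 t).indicator fun _ => (1 : ℝ) := by
  ext x
  simp only [signedIndicator, indicator, mem_Ico]
  split_ifs <;> first | rfl | (exfalso; grind)

lemma signedIndicator_of_nonpos {t : ℝ} (ht : t ≤ 0) :
    signedIndicator 0 t = (Ico t 0).indicator fun _ => (-1 : ℝ) := by
  ext x
  simp only [signedIndicator, indicator, mem_Ico]
  split_ifs <;> first | rfl | (exfalso; grind)

lemma memLp_signedIndicator (t : ℝ) (p : ENNReal) : MemLp (signedIndicator 0 t) p volume := by
  rcases le_total 0 t with h | h
  · rw [signedIndicator_of_nonneg h]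
    exact memLp_indicator_const _ measurableSet_Ico _ (Or.inr (by simp))
  · rw [signedIndicator_of_nonpos h]
    exact memLp_indicator_const _ measurableSet_Ico _ (Or.inr (by simp))

lemma memLp_stepFun (c : ℝ →₀ ℝ) (p : ENNReal) : MemLp (stepFun c) p volume :=
  memLp_finsetSum _ fun t _ => (memLp_signedIndicator t p).const_mul (c t)

lemma stepFun_add (c d : ℝ →₀ ℝ) : stepFun (c + d) = stepFun c + stepFun d := by
  ext x
  exact Finsupp.sum_add_index' (by simp) (by intros; ring)

lemma stepFun_smul (a : ℝ) (c : ℝ →₀ ℝ) : stepFun (a • c) = a • stepFun c := by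
  ext x
  simp only [stepFun, Pi.smul_apply, smul_eq_mul]
  rw [Finsupp.sum_smul_index (by simp), Finsupp.mul_sum]
  simp [mul_assoc]

lemma stepIntegral_add {Ω : Type*} {B : ℝ → Ω → ℝ} (c d : ℝ →₀ ℝ) :
    stepIntegral B (c + d) = stepIntegral B c + stepIntegral B d := by
  ext x
  exact Finsupp.sum_add_index' (by simp) (by intros; ring)

lemma stepIntegral_smul {Ω : Type*} {B : ℝ → Ω → ℝ} (a : ℝ) (c : ℝ →₀ ℝ) :
    stepIntegral B (a • c) = a • stepIntegral B c := by
  ext x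
  simp only [stepIntegral, Pi.smul_apply, smul_eq_mul]
  rw [Finsupp.sum_smul_index (by simp), Finsupp.mul_sum]
  simp [mul_assoc]

lemma stepFun_sub (c d : ℝ →₀ ℝ) : stepFun (c - d) = stepFun c - stepFun d := by
  rw [sub_eq_add_neg, ← neg_one_smul ℝ d, stepFun_add, stepFun_smul, neg_one_smul, sub_eq_add_neg]

lemma stepIntegral_sub {Ω : Type*} {B : ℝ → Ω → ℝ} (c d : ℝ →₀ ℝ) :
    stepIntegral B (c - d) = stepIntegral B c - stepIntegral B d := by
  rw [sub_eq_add_neg, ← neg_one_smul ℝ d, stepIntegral_add, stepIntegral_smul, neg_one_smul,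
    sub_eq_add_neg]

/-- The right side is the covariance of a two-sided Brownian motion: times of opposite sign
contribute nothing. This is the Itô isometry on the generating indicators. -/
lemma integral_signedIndicator_mul (s t : ℝ) :
    ∫ x, signedIndicator 0 s x * signedIndicator 0 t x =
      min (s.toNNReal : ℝ) (t.toNNReal : ℝ) + min ((-s).toNNReal : ℝ) ((-t).toNNReal : ℝ) := by
  have key : ∀ a b c d e : ℝ, ∫ x, (Ico a b).indicator (fun _ => e) x *
      (Ico c d).indicator (fun _ => (1 : ℝ)) x = max (min b d - max a c) 0 * e := by
    intro a b c d e
    have : (fun x => (Ico a b).indicator (fun _ => e) x *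
      (Ico c d).indicator (fun _ => (1 : ℝ)) x) =
      (Ico (max a c) (min b d)).indicator fun _ => e := by
      rw [← Ico_inter_Ico]
      ext x
      simp only [indicator, mem_inter_iff]
      split_ifs <;> simp_all
    rw [this, integral_indicator measurableSet_Ico]
    simp [Measure.real, ENNReal.toReal_ofReal']
  have hneg : ∀ a b x : ℝ, (Ico a b).indicator (fun _ => (-1 : ℝ)) x =
      -(Ico a b).indicator (fun _ => (1 : ℝ)) x := by
    intro a b x; simp only [indicator]; split_ifs <;> simp
  simp only [Real.coe_toNNReal']
  rcases le_total 0 s with hs | hs <;> rcases le_total 0 t with ht | ht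
  · rw [signedIndicator_of_nonneg hs, signedIndicator_of_nonneg ht, key]
    simp [hs, ht]
  · rw [signedIndicator_of_nonneg hs, signedIndicator_of_nonpos ht]
    simp only [hneg, mul_neg, integral_neg, key]
    simp [hs, ht]
  · rw [signedIndicator_of_nonpos hs, signedIndicator_of_nonneg ht]
    simp only [hneg, neg_mul, integral_neg, key]
    simp [hs, ht]
  · rw [signedIndicator_of_nonpos hs, signedIndicator_of_nonpos ht]
    simp only [hneg, neg_mul, mul_neg, neg_neg, key]
    simp only [max_eq_right hs, max_eq_right ht, max_eq_left (neg_nonneg.2 hs),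
      max_eq_left (neg_nonneg.2 ht)]
    grind

variable {Ω : Type*} [MeasurableSpace Ω] {P : Measure Ω} {B : ℝ → Ω → ℝ}

/-! ### Gaussian laws of linear combinations of Brownian values -/

namespace IsTwoSidedBrownianMotion

lemma isProbabilityMeasure (hB : IsTwoSidedBrownianMotion B P) : IsProbabilityMeasure P :=
  hB.right.isGaussianProcess.isProbabilityMeasure

lemma eval_zero (hB : IsTwoSidedBrownianMotion B P) : ∀ᵐ ω ∂P, B 0 ω = 0 := by
  simpa using hB.right.eval_zero_ae_eq_zero

lemma memLp (hB : IsTwoSidedBrownianMotion B P) (t : ℝ) : MemLp (B t) 2 P := by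
  rcases le_total 0 t with h | h
  · simpa [h] using (hB.right.isGaussianProcess.hasGaussianLaw_eval t.toNNReal).memLp_two
  · simpa [h] using (hB.left.isGaussianProcess.hasGaussianLaw_eval (-t).toNNReal).memLp_two

lemma integral_eval (hB : IsTwoSidedBrownianMotion B P) (t : ℝ) : ∫ ω, B t ω ∂P = 0 := by
  rcases le_total 0 t with h | h
  · simpa [h] using hB.right.integral_eval t.toNNReal
  · simpa [h] using hB.left.integral_eval (-t).toNNReal

lemma covariance_eval (hB : IsTwoSidedBrownianMotion B P) (s t : ℝ) :
    cov[B s, B t; P] = ∫ x, signedIndicator 0 s x * signedIndicator 0 t x := by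
  rw [integral_signedIndicator_mul]
  have hi : ∀ s t, 0 ≤ s → t ≤ 0 → cov[B s, B t; P] = 0 := by
    intro s t hs ht
    refine IndepFun.covariance_eq_zero ?_ (hB.memLp s) (hB.memLp t)
    have hm : ∀ r : ℝ≥0, Measurable fun x : ℝ≥0 → ℝ => x r := fun r => measurable_pi_apply r
    have := hB.indep.comp (hm s.toNNReal) (hm (-t).toNNReal)
    simpa [Function.comp_def, hs, ht] using this
  rcases le_total 0 s with hs | hs <;> rcases le_total 0 t with ht | ht
  · have := hB.right.covariance_eval s.toNNReal t.toNNReal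
    simp only [Real.coe_toNNReal', max_eq_left hs, max_eq_left ht] at this
    rw [show cov[B s, B t; P] = _ from this]
    simp [hs, ht]
  · rw [hi s t hs ht]; simp [hs, ht]
  · rw [covariance_comm, hi t s ht hs]; simp [hs, ht]
  · have := hB.left.covariance_eval (-s).toNNReal (-t).toNNReal
    have h1 := neg_nonneg.2 hs
    have h2 := neg_nonneg.2 ht
    simp only [Real.coe_toNNReal', max_eq_left h1, max_eq_left h2, neg_neg] at this
    rw [show cov[B s, B t; P] = _ from this]
    simp [hs, ht]

/-- Splitting the sum at time 0 gives one combination for each of the two one-sided Brownian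
motions. Both are Gaussian, and they are independent. -/
lemma hasGaussianLaw_sum (hB : IsTwoSidedBrownianMotion B P) (c : ℝ → ℝ) (S : Finset ℝ) :
    HasGaussianLaw (fun ω => ∑ t ∈ S, c t * B t ω) P := by
  classical
  have h1 : HasGaussianLaw
      (fun ω => ∑ t ∈ S with 0 ≤ t, c t * B ((t.toNNReal : ℝ≥0) : ℝ) ω) P :=
    ((hB.right.isGaussianProcess.comp_right Real.toNNReal).smul c).hasGaussianLaw_fun_sum
  have h2 : HasGaussianLaw
      (fun ω => ∑ t ∈ S with ¬ 0 ≤ t, c t * B (-((-t).toNNReal : ℝ≥0)) ω) P :=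
    ((hB.left.isGaussianProcess.comp_right fun t => (-t).toNNReal).smul c).hasGaussianLaw_fun_sum
  have h3 := hB.indep.comp
    (φ := fun x : ℝ≥0 → ℝ => ∑ t ∈ S with 0 ≤ t, c t * x t.toNNReal)
    (ψ := fun x : ℝ≥0 → ℝ => ∑ t ∈ S with ¬ 0 ≤ t, c t * x (-t).toNNReal)
    (by fun_prop) (by fun_prop)
  refine (iIndepFun.hasGaussianLaw_fun_add h1 h2 (by simpa [Function.comp_def] using h3)).congr
    (ae_of_all _ fun ω => ?_)
  beta_reduce
  rw [← Finset.sum_filter_add_sum_filter_not S (fun t => 0 ≤ t) (fun t => c t * B t ω)]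
  congr 1 <;> refine Finset.sum_congr rfl fun t ht => ?_
  · rw [Real.coe_toNNReal _ (Finset.mem_filter.1 ht).2]
  · rw [Real.coe_toNNReal _ (by linarith [not_le.1 (Finset.mem_filter.1 ht).2]), neg_neg]

lemma stepIntegral_ae_eq (hB : IsTwoSidedBrownianMotion B P) (c : ℝ →₀ ℝ) :
    (fun ω => ∑ t ∈ c.support, c t * B t ω) =ᵐ[P] stepIntegral B c := by
  filter_upwards [hB.eval_zero] with ω hω
  simp [stepIntegral, Finsupp.sum, hω]

/-- The Wiener integral of a step function is centered Gaussian, with the variance given by the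
`L²`-norm of the step function. -/
lemma hasLaw_stepIntegral (hB : IsTwoSidedBrownianMotion B P) (c : ℝ →₀ ℝ) :
    HasLaw (stepIntegral B c) (gaussianReal 0 (∫ x, stepFun c x ^ 2).toNNReal) P := by
  have := hB.isProbabilityMeasure
  have h := hB.hasGaussianLaw_sum c c.support
  refine HasLaw.congr ⟨h.aemeasurable, ?_⟩ (hB.stepIntegral_ae_eq c).symm
  rw [h.map_eq_gaussianReal]
  congr 2
  · rw [integral_finsetSum _ fun t _ => ((hB.memLp t).integrable one_le_two).const_mul _]
    simp [integral_const_mul, hB.integral_eval]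
  · rw [variance_fun_sum' fun t _ => (hB.memLp t).const_mul _]
    have h2 : ∀ s t : ℝ, Integrable fun x => signedIndicator 0 s x * signedIndicator 0 t x :=
      fun s t => (memLp_signedIndicator s 2).integrable_mul (memLp_signedIndicator t 2)
    have : ∀ x, stepFun c x ^ 2 = ∑ s ∈ c.support, ∑ t ∈ c.support,
        (c s * c t) * (signedIndicator 0 s x * signedIndicator 0 t x) := by
      intro x
      rw [stepFun, Finsupp.sum, sq, Finset.sum_mul_sum]
      exact Finset.sum_congr rfl fun s _ => Finset.sum_congr rfl fun t _ => by ring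
    simp_rw [this]
    rw [integral_finsetSum _ fun s _ => integrable_finsetSum _ fun t _ => (h2 s t).const_mul _]
    refine Finset.sum_congr rfl fun s _ => ?_
    rw [integral_finsetSum _ fun t _ => (h2 s t).const_mul _]
    refine Finset.sum_congr rfl fun t _ => ?_
    rw [covariance_const_mul_left, covariance_const_mul_right, hB.covariance_eval,
      integral_const_mul, mul_assoc]

end IsTwoSidedBrownianMotion

/-! ### The Itô isometry and the density of step functions -/

lemma eLpNorm_two_eq {α : Type*} [MeasurableSpace α] {μ : Measure α} {f : α → ℝ}
    (hf : MemLp f 2 μ) : eLpNorm f 2 μ = ENNReal.ofReal (√(∫ x, f x ^ 2 ∂μ)) := by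
  rw [hf.eLpNorm_eq_integral_rpow_norm two_ne_zero ENNReal.ofNat_ne_top, Real.sqrt_eq_rpow]
  simp

lemma hasLaw_gaussianReal_memLp_two {Y : Ω → ℝ} {v : ℝ≥0} (h : HasLaw Y (gaussianReal 0 v) P) :
    MemLp Y 2 P :=
  h.hasGaussianLaw.memLp_two

lemma integral_sq_of_hasLaw_gaussianReal {Y : Ω → ℝ} {v : ℝ≥0}
    (h : HasLaw Y (gaussianReal 0 v) P) : ∫ ω, Y ω ^ 2 ∂P = v := by
  have h1 := h.variance_eq
  rw [variance_of_integral_eq_zero h.aemeasurable] at h1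
  · simpa using h1
  · rw [h.integral_eq, integral_id_gaussianReal]

lemma IsTwoSidedBrownianMotion.eLpNorm_stepIntegral (hB : IsTwoSidedBrownianMotion B P)
    (c : ℝ →₀ ℝ) : eLpNorm (stepIntegral B c) 2 P = eLpNorm (stepFun c) 2 volume := by
  have h := hB.hasLaw_stepIntegral c
  rw [eLpNorm_two_eq (hasLaw_gaussianReal_memLp_two h), eLpNorm_two_eq (memLp_stepFun c 2),
    integral_sq_of_hasLaw_gaussianReal h, Real.coe_toNNReal _ (by positivity)]

lemma ae_eq_zero_of_forall_intervalIntegral_eq_zero {f : ℝ → ℝ} (hf : LocallyIntegrable f volume)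
    (h : ∀ t, ∫ x in (0 : ℝ)..t, f x = 0) : f =ᵐ[volume] 0 := by
  filter_upwards [LocallyIntegrable.ae_hasDerivAt_integral hf] with x hx
  have := hx 0
  simp only [h] at this
  exact this.unique (hasDerivAt_const x 0)

/-- A function orthogonal to all signed indicators has vanishing primitive, so it is zero by
Lebesgue differentiation. The span of the indicators is therefore dense. -/
lemma exists_tendsto_stepFun {f : ℝ → ℝ} (hf : MemLp f 2 volume) :
    ∃ c : ℕ → ℝ →₀ ℝ,
      Tendsto (fun n => eLpNorm (fun x => stepFun (c n) x - f x) 2 volume) atTop (𝓝 0) := by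
  let v : ℝ → Lp ℝ 2 (volume : Measure ℝ) := fun t => (memLp_signedIndicator t 2).toLp _
  let K := Submodule.span ℝ (range v)
  have hK : K.topologicalClosure = ⊤ := by
    rw [Submodule.topologicalClosure_eq_top_iff, Submodule.eq_bot_iff]
    intro g hg
    have hgL : LocallyIntegrable g volume := (Lp.memLp g).locallyIntegrable one_le_two
    have hg0 : ∀ t, ∫ x, signedIndicator 0 t x * g x = 0 := by
      intro t
      have := (Submodule.mem_orthogonal K g).1 hg (v t) (Submodule.subset_span ⟨t, rfl⟩)
      rw [L2.inner_def] at this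
      refine Eq.trans (integral_congr_ae ?_) this
      filter_upwards [(memLp_signedIndicator t 2).coeFn_toLp] with x hx
      simp [v, hx, mul_comm]
    refine (Lp.eq_zero_iff_ae_eq_zero).2 (ae_eq_zero_of_forall_intervalIntegral_eq_zero hgL ?_)
    intro t
    have h := hg0 t
    rcases le_total 0 t with ht | ht
    · rw [intervalIntegral.integral_of_le ht, ← integral_Ico_eq_integral_Ioc,
        ← integral_indicator measurableSet_Ico]
      refine Eq.trans (integral_congr_ae (ae_of_all _ fun x => ?_)) h
      simp [signedIndicator_of_nonneg ht, indicator]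
    · rw [intervalIntegral.integral_of_ge ht, ← integral_Ico_eq_integral_Ioc,
        ← integral_indicator measurableSet_Ico, ← integral_neg]
      refine Eq.trans (integral_congr_ae (ae_of_all _ fun x => ?_)) h
      simp only [signedIndicator_of_nonpos ht, indicator]
      split_ifs <;> simp
  have hmem : hf.toLp f ∈ closure (K : Set (Lp ℝ 2 (volume : Measure ℝ))) := by
    rw [← Submodule.topologicalClosure_coe, hK]; trivial
  obtain ⟨k, hk, hlim⟩ := mem_closure_iff_seq_limit.1 hmem
  choose c hc using fun n => Finsupp.mem_span_range_iff_exists_finsupp.1 (hk n)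
  refine ⟨c, ?_⟩
  have hkc : ∀ c : ℝ →₀ ℝ, Finsupp.linearCombination ℝ v c = (memLp_stepFun c 2).toLp _ := by
    intro c
    induction c using Finsupp.induction_linear with
    | zero =>
      rw [map_zero, ← MemLp.toLp_zero (MemLp.zero : MemLp (0 : ℝ → ℝ) 2 volume)]
      exact (MemLp.toLp_eq_toLp_iff _ _).2 (ae_of_all _ fun x => by simp [stepFun])
    | add c d hc hd =>
      rw [map_add, hc, hd, ← MemLp.toLp_add]
      exact (MemLp.toLp_eq_toLp_iff _ _).2 (by rw [stepFun_add])
    | single t a =>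
      rw [Finsupp.linearCombination_single]
      simp only [v]
      rw [← MemLp.toLp_const_smul]
      exact (MemLp.toLp_eq_toLp_iff _ _).2 (ae_of_all _ fun x => by simp [stepFun])
  have hk' : k = fun n => (memLp_stepFun (c n) 2).toLp _ :=
    funext fun n => by rw [← hkc, ← hc n]; rfl
  rw [hk'] at hlim
  exact (Lp.tendsto_Lp_iff_tendsto_eLpNorm'' _ _ _ hf).1 hlim

/-! ### Existence and properties of the Wiener integral -/

lemma IsTwoSidedBrownianMotion.memLp_stepIntegral (hB : IsTwoSidedBrownianMotion B P)
    (c : ℝ →₀ ℝ) : MemLp (stepIntegral B c) 2 P :=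
  hasLaw_gaussianReal_memLp_two (hB.hasLaw_stepIntegral c)

/-- The isometry carries the Cauchy sequence of approximating step functions to a Cauchy sequence in
L²(P), which is complete. -/
lemma IsTwoSidedBrownianMotion.exists_isWienerIntegral (hB : IsTwoSidedBrownianMotion B P)
    {f : ℝ → ℝ} (hf : MemLp f 2 volume) : ∃ Y, IsWienerIntegral B P f Y := by
  obtain ⟨c, hc⟩ := exists_tendsto_stepFun hf
  have h1 := (Lp.tendsto_Lp_iff_tendsto_eLpNorm'' _ (fun n => memLp_stepFun (c n) 2) _ hf).2 hc
  have h2 : CauchySeq fun n => (hB.memLp_stepIntegral (c n)).toLp _ := by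
    have h3 := h1.cauchySeq
    rw [Metric.cauchySeq_iff] at h3 ⊢
    intro ε hε
    obtain ⟨N, hN⟩ := h3 ε hε
    refine ⟨N, fun m hm n hn => ?_⟩
    have := hN m hm n hn
    rw [dist_eq_norm, ← MemLp.toLp_sub, Lp.norm_toLp, ← stepFun_sub] at this
    rwa [dist_eq_norm, ← MemLp.toLp_sub, Lp.norm_toLp, ← stepIntegral_sub,
      hB.eLpNorm_stepIntegral]
  obtain ⟨Y, hY⟩ := cauchySeq_tendsto_of_complete h2
  refine ⟨Y, Lp.memLp Y, c, hc, ?_⟩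
  refine (Lp.tendsto_Lp_iff_tendsto_eLpNorm'' _ (fun n => hB.memLp_stepIntegral (c n)) _
    (Lp.memLp Y)).1 ?_
  simpa using hY

lemma IsTwoSidedBrownianMotion.isWienerIntegral (hB : IsTwoSidedBrownianMotion B P)
    {f : ℝ → ℝ} (hf : MemLp f 2 volume) : IsWienerIntegral B P f (wienerIntegral B P f) := by
  have h := hB.exists_isWienerIntegral hf
  rw [wienerIntegral, dif_pos h]
  exact h.choose_spec

lemma norm_cexp_mul_I_sub_le (a b : ℝ) :
    ‖Complex.exp (a * Complex.I) - Complex.exp (b * Complex.I)‖ ≤ |a - b| := by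
  have := Real.norm_exp_I_mul_ofReal_sub_one_le (x := a - b)
  have h3 : Complex.exp (a * Complex.I) - Complex.exp (b * Complex.I) =
      Complex.exp (b * Complex.I) * (Complex.exp (Complex.I * ((a - b : ℝ) : ℂ)) - 1) := by
    rw [mul_sub, mul_one, ← Complex.exp_add]
    push_cast
    ring_nf
  rw [h3, norm_mul, Complex.norm_exp_ofReal_mul_I, one_mul]
  simpa using this

lemma integrable_mul_cexp {α : Type*} [MeasurableSpace α] {μ : Measure α} {Θ : α → ℝ}
    (hΘ : Integrable Θ μ) {Z : α → ℝ} (hZ : AEStronglyMeasurable Z μ) :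
    Integrable (fun ω => (Θ ω : ℂ) * Complex.exp (Z ω * Complex.I)) μ := by
  refine hΘ.ofReal.mul_bdd (c := 1) ?_
    (ae_of_all _ fun ω => by simp [Complex.norm_exp_ofReal_mul_I])
  have hc : Continuous fun x : ℝ => Complex.exp (x * Complex.I) := by fun_prop
  exact hc.comp_aestronglyMeasurable hZ

/-- The map x ↦ exp(ix) is 1-Lipschitz, so Cauchy–Schwarz bounds the difference of the integrals by
‖Θ‖₂ ‖X_n - Y‖₂. With Θ = 1 this is convergence of characteristic functions. -/
lemma tendsto_integral_mul_cexp {α : Type*} [MeasurableSpace α] {μ : Measure α} {Θ : α → ℝ}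
    (hΘ : MemLp Θ 2 μ) {X : ℕ → α → ℝ} {Y : α → ℝ} (hX : ∀ n, MemLp (X n) 2 μ)
    (hY : MemLp Y 2 μ)
    (h : Tendsto (fun n => eLpNorm (fun ω => X n ω - Y ω) 2 μ) atTop (𝓝 0))
    (hΘ1 : Integrable Θ μ) :
    Tendsto (fun n => ∫ ω, (Θ ω : ℂ) * Complex.exp (X n ω * Complex.I) ∂μ) atTop
      (𝓝 (∫ ω, (Θ ω : ℂ) * Complex.exp (Y ω * Complex.I) ∂μ)) := by
  refine tendsto_integral_of_L1' _ (integrable_mul_cexp hΘ1 hY.1).1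
    (.of_forall fun n => integrable_mul_cexp hΘ1 (hX n).1) ?_
  have hz : Tendsto (fun n => eLpNorm Θ 2 μ * eLpNorm (fun ω => X n ω - Y ω) 2 μ) atTop
      (𝓝 0) := by
    simpa using ENNReal.Tendsto.const_mul h (Or.inr hΘ.2.ne)
  refine tendsto_of_tendsto_of_tendsto_of_le_of_le tendsto_const_nhds hz (fun n => bot_le)
    fun n => ?_
  refine le_trans (eLpNorm_mono (g := Θ • fun ω => (X n ω - Y ω)) fun ω => ?_)
    (eLpNorm_smul_le_mul_eLpNorm (p := 2) (q := 2) (r := 1) ((hX n).1.sub hY.1) hΘ.1)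
  simp only [Pi.sub_apply, Pi.smul_apply', smul_eq_mul]
  rw [← mul_sub, norm_mul, norm_mul, Complex.norm_real]
  exact mul_le_mul_of_nonneg_left (norm_cexp_mul_I_sub_le _ _) (norm_nonneg _)

lemma exists_measurable_ae_eq_of_tendsto {m : MeasurableSpace Ω} {X : ℕ → Ω → ℝ} {Y : Ω → ℝ}
    (hX : ∀ n, Measurable[m] (X n))
    (h : ∀ᵐ ω ∂P, Tendsto (fun n => X n ω) atTop (𝓝 (Y ω))) :
    ∃ Y', Measurable[m] Y' ∧ Y =ᵐ[P] Y' := by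
  -- The upper limit is `m`-measurable everywhere, so `m` need not contain the null sets of `P`.
  refine ⟨fun ω => limsup (fun n => X n ω) atTop, Measurable.limsup hX, ?_⟩
  filter_upwards [h] with ω hω
  exact hω.limsup_eq.symm

namespace IsWienerIntegral

variable {f g : ℝ → ℝ} {Y Z : Ω → ℝ}

lemma add (hf : IsWienerIntegral B P f Y) (hg : IsWienerIntegral B P g Z)
    (hB : IsTwoSidedBrownianMotion B P)
    (hfm : MemLp f 2 volume) (hgm : MemLp g 2 volume) :
    IsWienerIntegral B P (f + g) (Y + Z) := by
  obtain ⟨hY, c, hc1, hc2⟩ := hf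
  obtain ⟨hZ, d, hd1, hd2⟩ := hg
  refine ⟨hY.add hZ, fun n => c n + d n, ?_, ?_⟩
  · refine tendsto_of_tendsto_of_tendsto_of_le_of_le tendsto_const_nhds
      (by simpa using hc1.add hd1) (fun n => bot_le) fun n => ?_
    refine le_trans (le_of_eq ?_) (eLpNorm_add_le ((memLp_stepFun (c n) 2).1.sub hfm.1)
      ((memLp_stepFun (d n) 2).1.sub hgm.1) one_le_two)
    congr 1
    ext x
    simp only [stepFun_add, Pi.add_apply]
    ring
  · refine tendsto_of_tendsto_of_tendsto_of_le_of_le tendsto_const_nhds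
      (by simpa using hc2.add hd2) (fun n => bot_le) fun n => ?_
    refine le_trans (le_of_eq ?_) (eLpNorm_add_le ((hB.memLp_stepIntegral (c n)).1.sub hY.1)
      ((hB.memLp_stepIntegral (d n)).1.sub hZ.1) one_le_two)
    congr 1
    ext x
    simp only [stepIntegral_add, Pi.add_apply]
    ring

lemma smul (hf : IsWienerIntegral B P f Y) (a : ℝ) : IsWienerIntegral B P (a • f) (a • Y) := by
  obtain ⟨hY, c, hc1, hc2⟩ := hf
  refine ⟨hY.const_smul a, fun n => a • c n, ?_, ?_⟩
  · have : ∀ n, (fun x => stepFun (a • c n) x - (a • f) x) = a • fun x => stepFun (c n) x - f x := by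
      intro n; ext x; simp [stepFun_smul, mul_sub]
    simp_rw [this, eLpNorm_const_smul]
    simpa using ENNReal.Tendsto.const_mul hc1 (Or.inr enorm_ne_top)
  · have : ∀ n, (fun x => stepIntegral B (a • c n) x - (a • Y) x) =
        a • fun x => stepIntegral B (c n) x - Y x := by
      intro n; ext x; simp [stepIntegral_smul, mul_sub]
    simp_rw [this, eLpNorm_const_smul]
    simpa using ENNReal.Tendsto.const_mul hc2 (Or.inr enorm_ne_top)

lemma stepFun (hB : IsTwoSidedBrownianMotion B P) (c : ℝ →₀ ℝ) :
    IsWienerIntegral B P (stepFun c) (stepIntegral B c) :=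
  ⟨hB.memLp_stepIntegral c, fun _ => c, by simp, by simp⟩

/-- The characteristic functions of the approximating step integrals converge to that of `Y`, and
their variances converge to ‖f‖₂². -/
lemma hasLaw (h : IsWienerIntegral B P f Y) (hB : IsTwoSidedBrownianMotion B P)
    (hf : MemLp f 2 volume) :
    HasLaw Y (gaussianReal 0 (∫ x, f x ^ 2).toNNReal) P := by
  have := hB.isProbabilityMeasure
  obtain ⟨hY, c, hc1, hc2⟩ := h
  have hsq : Tendsto (fun n => ∫ x, RSFBM.stepFun (c n) x ^ 2) atTop (𝓝 (∫ x, f x ^ 2)) := by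
    have h1 := (Lp.tendsto_Lp_iff_tendsto_eLpNorm'' _ (fun n => memLp_stepFun (c n) 2) _ hf).2 hc1
    have h2 := h1.norm.pow 2
    have h3 : ∀ (g : ℝ → ℝ) (hg : MemLp g 2 volume), ‖hg.toLp g‖ ^ 2 = ∫ x, g x ^ 2 := by
      intro g hg
      rw [Lp.norm_toLp, eLpNorm_two_eq hg, ENNReal.toReal_ofReal (by positivity),
        Real.sq_sqrt (by positivity)]
    simpa only [h3] using h2
  refine ⟨hY.aestronglyMeasurable.aemeasurable, ?_⟩
  have := Measure.isProbabilityMeasure_map (μ := P) hY.aestronglyMeasurable.aemeasurable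
  refine Measure.ext_of_charFun (funext fun t => ?_)
  have key : ∀ Z : Ω → ℝ, AEMeasurable Z P → charFun (P.map Z) t =
      ∫ ω, ((1 : ℝ) : ℂ) * Complex.exp ((t * Z ω : ℝ) * Complex.I) ∂P := by
    intro Z hZ
    rw [charFun_apply_real, integral_map hZ (by fun_prop)]
    simp
  have hl := tendsto_integral_mul_cexp (memLp_const (1 : ℝ) : MemLp (fun _ => (1 : ℝ)) 2 P)
    (X := fun n ω => t * stepIntegral B (c n) ω) (Y := fun ω => t * Y ω)
    (fun n => (hB.memLp_stepIntegral (c n)).const_mul t) (hY.const_mul t) ?_ (integrable_const 1)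
  · rw [← key Y hY.aestronglyMeasurable.aemeasurable] at hl
    simp_rw [← fun n => key (stepIntegral B (c n))
      (hB.memLp_stepIntegral (c n)).aestronglyMeasurable.aemeasurable,
      fun n => (hB.hasLaw_stepIntegral (c n)).map_eq] at hl
    refine tendsto_nhds_unique hl ?_
    simp only [charFun_gaussianReal]
    refine (Complex.continuous_exp.tendsto _).comp ?_
    refine tendsto_const_nhds.sub ?_
    refine Tendsto.div_const (Tendsto.mul_const _ ?_) _
    have hc : Continuous fun x : ℝ => (((x.toNNReal : ℝ≥0) : ℝ) : ℂ) := by fun_prop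
    exact (hc.tendsto _).comp hsq
  · have := ENNReal.Tendsto.const_mul hc2 (Or.inr (enorm_ne_top (x := t)))
    rw [mul_zero] at this
    refine this.congr fun n => ?_
    rw [← eLpNorm_const_smul]
    congr 1
    ext x
    simp [mul_sub]

/-- The difference of two versions is a Wiener integral of 0, whose law is the Dirac mass at 0. The
arbitrary choice made in `wienerIntegral` is thus immaterial. -/
lemma ae_eq (hB : IsTwoSidedBrownianMotion B P) (hf : MemLp f 2 volume)
    (hY : IsWienerIntegral B P f Y) (hZ : IsWienerIntegral B P f Z) : Y =ᵐ[P] Z := by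
  have h := (hY.add (hZ.smul (-1)) hB hf (hf.const_smul _)).hasLaw hB (hf.add (hf.const_smul _))
  have h0 : ∫ x, (f + (-1 : ℝ) • f) x ^ 2 = 0 := by simp
  rw [h0, Real.toNNReal_zero, gaussianReal_zero_var] at h
  filter_upwards [h.ae_eq_of_dirac] with ω hω
  simp only [Pi.add_apply, Pi.smul_apply, smul_eq_mul] at hω
  linarith

/-- A Wiener integral is measurable with respect to the Brownian motion, up to a null set. -/
lemma exists_measurable_iSup (h : IsWienerIntegral B P f Y)
    (hB : IsTwoSidedBrownianMotion B P) :
    ∃ Y', Measurable[⨆ t, MeasurableSpace.comap (B t) inferInstance] Y' ∧ Y =ᵐ[P] Y' := by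
  obtain ⟨hY, c, hc1, hc2⟩ := h
  obtain ⟨ns, -, hns⟩ := (tendstoInMeasure_of_tendsto_eLpNorm two_ne_zero
    (fun n => (hB.memLp_stepIntegral (c n)).1) hY.1 hc2).exists_seq_tendsto_ae
  refine exists_measurable_ae_eq_of_tendsto (fun n => ?_) hns
  refine Finset.measurable_fun_sum _ fun t _ => ?_
  have hm : ∀ t, Measurable[⨆ t, MeasurableSpace.comap (B t) inferInstance] (B t) := fun t =>
    (comap_measurable (B t)).mono (le_iSup (fun t => MeasurableSpace.comap (B t) inferInstance) t)
      le_rfl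
  exact ((hm t).sub (hm 0)).const_mul _

end IsWienerIntegral

lemma comap_pi_eq_iSup {Ω : Type*} (B : ℝ → Ω → ℝ) :
    MeasurableSpace.comap (fun ω t => B t ω) MeasurableSpace.pi =
      ⨆ t, MeasurableSpace.comap (B t) inferInstance := by
  simp only [MeasurableSpace.pi, MeasurableSpace.comap_iSup, MeasurableSpace.comap_comp]
  rfl

lemma indepFun_of_aestronglyMeasurable_iSup {A : Ω → ℝ}
    (hAB : IndepFun A (fun ω t => B t ω) P) {E : Type*} [MeasurableSpace E] {Y : Ω → E}
    (hY : ∃ Y', Measurable[⨆ t, MeasurableSpace.comap (B t) inferInstance] Y' ∧ Y =ᵐ[P] Y') :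
    IndepFun A Y P := by
  obtain ⟨Y', hm, he⟩ := hY
  refine IndepFun.congr (f := A) (g := Y') ?_ .rfl he.symm
  rw [IndepFun_iff_Indep] at hAB ⊢
  rw [comap_pi_eq_iSup] at hAB
  exact indep_of_indep_of_le_right hAB hm.comap_le

end RSFBM

namespace RSFBM

/-! ### Exponential moments from a holomorphic Laplace transform -/

lemma integrable_exp_neg_mul {μ : Measure ℝ} [IsFiniteMeasure μ] (hμ : ∀ᵐ x ∂μ, 0 < x)
    {t : ℝ} (ht : 0 ≤ t) : Integrable (fun x => Real.exp (-(t * x))) μ := by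
  refine Integrable.mono' (integrable_const 1) (by fun_prop) ?_
  filter_upwards [hμ] with x hx
  rw [Real.norm_eq_abs, abs_of_pos (Real.exp_pos _)]
  exact Real.exp_le_one_iff.2 (neg_nonpos.2 (by positivity))

lemma pos_subset_interior_integrableExpSet {μ : Measure ℝ} [IsFiniteMeasure μ]
    (hμ : ∀ᵐ x ∂μ, 0 < x) : Ioi (0 : ℝ) ⊆ interior (integrableExpSet (fun x => -x) μ) := by
  refine interior_maximal (fun t ht => ?_) isOpen_Ioi
  simpa [integrableExpSet] using integrable_exp_neg_mul hμ (le_of_lt ht)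

lemma complexMGF_neg_eq_laplace {μ : Measure ℝ} (t : ℝ) :
    complexMGF (fun x => -x) μ t = laplace μ t := by
  rw [complexMGF_ofReal, laplace, mgf]
  simp

/-- Expand exp(sx) in its power series and integrate term by term against exp(-tx). All terms are
nonnegative, so this is legitimate without prior integrability, and a geometric series bounds the
result. -/
lemma integrable_exp_of_moment_bound {μ : Measure ℝ} (hμ : ∀ᵐ x ∂μ, 0 < x) {t s C q : ℝ}
    (hs : 0 < s) (hq0 : 0 ≤ q) (hq1 : q < 1)
    (hint : ∀ n : ℕ, Integrable (fun x => x ^ n * Real.exp (-(t * x))) μ)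
    (hb : ∀ n : ℕ, s ^ n / n.factorial * ∫ x, x ^ n * Real.exp (-(t * x)) ∂μ ≤ C * q ^ n) :
    Integrable (fun x => Real.exp ((s - t) * x)) μ := by
  refine ⟨by fun_prop, ?_⟩
  rw [hasFiniteIntegral_iff_ofReal (ae_of_all _ fun x => (Real.exp_pos _).le)]
  have h1 : ∀ᵐ x ∂μ, ENNReal.ofReal (Real.exp ((s - t) * x)) =
      ∑' n : ℕ, ENNReal.ofReal (s ^ n / n.factorial * (x ^ n * Real.exp (-(t * x)))) := by
    filter_upwards [hμ] with x hx
    have hsum : HasSum (fun n : ℕ => s ^ n / n.factorial * (x ^ n * Real.exp (-(t * x))))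
        (Real.exp ((s - t) * x)) := by
      have := (NormedSpace.expSeries_div_hasSum_exp (s * x)).mul_right (Real.exp (-(t * x)))
      rw [← Real.exp_eq_exp_ℝ, ← Real.exp_add] at this
      rw [show s * x + -(t * x) = (s - t) * x by ring] at this
      have he : (fun n : ℕ => s ^ n / n.factorial * (x ^ n * Real.exp (-(t * x)))) =
          fun n : ℕ => (s * x) ^ n / n.factorial * Real.exp (-(t * x)) := by
        ext n; rw [mul_pow]; ring
      rwa [he]
    rw [← hsum.tsum_eq, ENNReal.ofReal_tsum_of_nonneg (fun n => by positivity) hsum.summable]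
  rw [lintegral_congr_ae h1, lintegral_tsum fun n => by fun_prop]
  have hle : ∀ n : ℕ,
      ∫⁻ x, ENNReal.ofReal (s ^ n / n.factorial * (x ^ n * Real.exp (-(t * x)))) ∂μ ≤
        ENNReal.ofReal (C * q ^ n) := by
    intro n
    rw [← ofReal_integral_eq_lintegral_ofReal ((hint n).const_mul _)
      (by filter_upwards [hμ] with x hx; simp only [Pi.zero_apply]; positivity),
      integral_const_mul]
    exact ENNReal.ofReal_le_ofReal (hb n)
  have hC : 0 ≤ C := by
    have h0 := hb 0
    have : 0 ≤ ∫ x, x ^ 0 * Real.exp (-(t * x)) ∂μ := integral_nonneg fun x => by positivity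
    simp only [pow_zero, Nat.factorial_zero, Nat.cast_one, div_one, one_mul, mul_one] at h0 this
    linarith
  refine (ENNReal.tsum_le_tsum hle).trans_lt ?_
  rw [← ENNReal.ofReal_tsum_of_nonneg (fun n => by positivity)
    ((summable_geometric_of_lt_one hq0 hq1).mul_left C)]
  exact ENNReal.ofReal_lt_top

/-- If the Laplace transform of a probability measure on `(0,∞)` extends holomorphically to a
neighbourhood of the origin, then the measure has some exponential moments. -/
lemma exists_integrable_exp_of_holomorphyRadius_pos {μ : Measure ℝ} [IsProbabilityMeasure μ]
    (hμ : ∀ᵐ x ∂μ, 0 < x) (h : 0 < holomorphyRadius (laplace μ)) :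
    ∃ c > 0, Integrable (fun x => Real.exp (c * x)) μ := by
  obtain ⟨r, ⟨F, hF, hFL⟩, hr⟩ := lt_sSup_iff.1 h
  obtain ⟨ρ, hρ0, hρr⟩ : ∃ ρ : ℝ, 0 < ρ ∧ ENNReal.ofReal ρ ≤ r := by
    refine ⟨(min r 1).toReal, ENNReal.toReal_pos (by simp [hr.ne']) (by simp), ?_⟩
    rw [ENNReal.ofReal_toReal (by simp)]
    exact min_le_left _ _
  have hsub : Metric.ball (0 : ℂ) ρ ⊆ Metric.eball 0 r := by
    rw [← Metric.eball_ofReal]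
    exact Metric.eball_subset_eball hρr
  have hFd : DifferentiableOn ℂ F (Metric.ball 0 ρ) := hF.mono hsub
  -- Cauchy estimates are used on the disc of radius ρ/2 about t = ρ/4, which stays inside the ball
  -- of radius ρ. The Taylor series at t converges at s = 3ρ/8 with ratio s/(ρ/2) = 3/4, and s
  -- exceeds t by ρ/8, which is the exponential moment obtained.
  set t : ℝ := ρ / 4 with ht
  have ht0 : 0 < t := by positivity
  have hballs : Metric.closedBall (t : ℂ) (ρ / 2) ⊆ Metric.ball 0 ρ := by
    refine Metric.closedBall_subset_ball' ?_
    rw [dist_zero_right, Complex.norm_real, Real.norm_eq_abs, abs_of_pos ht0]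
    linarith
  have hint := pos_subset_interior_integrableExpSet hμ
  have hG : AnalyticAt ℂ (complexMGF (fun x : ℝ => -x) μ) (t : ℂ) :=
    analyticAt_complexMGF (hint (by simpa using ht0))
  have hFa : AnalyticAt ℂ F (t : ℂ) := hFd.analyticAt
    (Metric.isOpen_ball.mem_nhds (hballs (Metric.mem_closedBall_self (by positivity))))
  -- Identity theorem: the extension and the complex Laplace transform agree at real points
  -- accumulating at t.
  have heq : F =ᶠ[𝓝 (t : ℂ)] complexMGF (fun x : ℝ => -x) μ := by
    refine (hFa.frequently_eq_iff_eventually_eq hG).1 ?_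
    have h1 : ∃ᶠ x : ℝ in 𝓝[≠] t, F x = complexMGF (fun x : ℝ => -x) μ x := by
      refine Eventually.frequently (Filter.Eventually.filter_mono nhdsWithin_le_nhds ?_)
      filter_upwards [Ioo_mem_nhds ht0 (show t < ρ by linarith)] with x hx
      rw [complexMGF_neg_eq_laplace, hFL x hx.1.le]
      exact ((ENNReal.ofReal_lt_ofReal_iff hρ0).2 hx.2).trans_le hρr
    refine Tendsto.frequently (f := fun x : ℝ => (x : ℂ)) ?_ h1
    refine tendsto_nhdsWithin_of_tendsto_nhds_of_eventually_within _
      (Complex.continuous_ofReal.continuousWithinAt) ?_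
    filter_upwards [self_mem_nhdsWithin] with x hx
    simpa using hx
  obtain ⟨C, hC⟩ : ∃ C, ∀ z ∈ Metric.sphere (t : ℂ) (ρ / 2), ‖F z‖ ≤ C :=
    (isCompact_sphere _ _).exists_bound_of_continuousOn
      (hFd.continuousOn.mono (Metric.sphere_subset_closedBall.trans hballs))
  have hcauchy := fun n : ℕ => Complex.norm_iteratedDeriv_le_of_forall_mem_sphere_norm_le n
    (show 0 < ρ / 2 by positivity) (hFd.diffContOnCl_ball hballs) hC
  -- Positivity of the mass turns derivatives into moments up to sign, so Cauchy's bounds become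
  -- moment bounds.
  have hmom : ∀ n : ℕ, ‖iteratedDeriv n F t‖ = ∫ x, x ^ n * Real.exp (-(t * x)) ∂μ := by
    intro n
    rw [heq.iteratedDeriv_eq, iteratedDeriv_complexMGF (hint (by simpa using ht0))]
    have : ∀ x : ℝ, (((-x : ℝ) : ℂ)) ^ n * Complex.exp (t * ((-x : ℝ) : ℂ)) =
        (-1) ^ n * ((x ^ n * Real.exp (-(t * x)) : ℝ) : ℂ) := by
      intro x
      push_cast
      rw [neg_pow, mul_assoc, mul_neg]
    simp_rw [this]
    rw [integral_const_mul, integral_complex_ofReal, norm_mul, norm_pow, norm_neg, norm_one,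
      one_pow, one_mul, Complex.norm_real, Real.norm_of_nonneg]
    refine integral_nonneg_of_ae ?_
    filter_upwards [hμ] with x hx
    simp only [Pi.zero_apply]
    positivity
  have hI : ∀ n : ℕ, Integrable (fun x => x ^ n * Real.exp (-(t * x))) μ := by
    intro n
    have := integrable_pow_mul_exp_of_mem_interior_integrableExpSet (hint ht0) n
    refine (this.const_mul ((-1) ^ n)).congr (ae_of_all _ fun x => ?_)
    simp only
    rw [neg_pow x, ← mul_assoc, ← mul_assoc, ← mul_pow, mul_neg]
    simp
  refine ⟨3 * ρ / 8 - t, by rw [ht]; linarith, integrable_exp_of_moment_bound hμ (C := C)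
    (q := 3 / 4) (by positivity) (by norm_num) (by norm_num) hI fun n => ?_⟩
  rw [← hmom n]
  have hn := hcauchy n
  calc (3 * ρ / 8) ^ n / n.factorial * ‖iteratedDeriv n F t‖
      ≤ (3 * ρ / 8) ^ n / n.factorial * (n.factorial * C / (ρ / 2) ^ n) := by gcongr
    _ = C * (3 / 4) ^ n := by
      have h1 : (n.factorial : ℝ) ≠ 0 := by positivity
      have h2 : (ρ / 2) ^ n ≠ 0 := by positivity
      rw [show 3 * ρ / 8 = 3 / 4 * (ρ / 2) by ring, mul_pow]
      generalize (ρ / 2) ^ n = b at *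
      generalize (3 / 4 : ℝ) ^ n = a
      field_simp

end RSFBM

namespace RSFBM

variable {Ω : Type*} [MeasurableSpace Ω] {P : Measure Ω} {B : ℝ → Ω → ℝ}

/-! ### Gaussian scale mixtures -/

lemma IsWienerIntegral.hasLaw_comb {f g : ℝ → ℝ} {Y Z : Ω → ℝ}
    (hB : IsTwoSidedBrownianMotion B P) (hf : MemLp f 2 volume) (hg : MemLp g 2 volume)
    (hY : IsWienerIntegral B P f Y) (hZ : IsWienerIntegral B P g Z)
    (hfg : ∫ x, f x * g x = 0) (a b : ℝ) :
    HasLaw (fun ω => a * Y ω + b * Z ω)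
      (gaussianReal 0 (a ^ 2 * (∫ x, f x ^ 2) + b ^ 2 * ∫ x, g x ^ 2).toNNReal) P := by
  have h := ((hY.smul a).add (hZ.smul b) hB (hf.const_smul a) (hg.const_smul b)).hasLaw hB
    ((hf.const_smul a).add (hg.const_smul b))
  have : ∫ x, (a • f + b • g) x ^ 2 = a ^ 2 * (∫ x, f x ^ 2) + b ^ 2 * ∫ x, g x ^ 2 := by
    have h1 : ∀ x, (a • f + b • g) x ^ 2 =
        a ^ 2 * f x ^ 2 + b ^ 2 * g x ^ 2 + 2 * a * b * (f x * g x) := by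
      intro x; simp only [Pi.add_apply, Pi.smul_apply, smul_eq_mul]; ring
    simp_rw [h1]
    have i1 : Integrable fun x => a ^ 2 * f x ^ 2 := hf.integrable_sq.const_mul _
    have i2 : Integrable fun x => b ^ 2 * g x ^ 2 := hg.integrable_sq.const_mul _
    have i3 : Integrable fun x => 2 * a * b * (f x * g x) := (hf.integrable_mul hg).const_mul _
    rw [integral_add (f := fun x => a ^ 2 * f x ^ 2 + b ^ 2 * g x ^ 2) (i1.add i2) i3, integral_add i1 i2]
    simp only [integral_const_mul, hfg]
    simp
  rw [this] at h
  exact h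

lemma charFun_map_of_hasLaw {Y : Ω → ℝ} {v : ℝ≥0} (h : HasLaw Y (gaussianReal 0 v) P) (t : ℝ) :
    charFun (P.map Y) t = Complex.exp (-(v * t ^ 2 / 2)) := by
  rw [h.map_eq, charFun_gaussianReal]
  simp

/-- Wiener integrals of orthogonal functions are independent. -/
lemma IsWienerIntegral.indepFun_of_orthogonal {f g : ℝ → ℝ} {Y Z : Ω → ℝ}
    (hB : IsTwoSidedBrownianMotion B P) (hf : MemLp f 2 volume) (hg : MemLp g 2 volume)
    (hY : IsWienerIntegral B P f Y) (hZ : IsWienerIntegral B P g Z)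
    (hfg : ∫ x, f x * g x = 0) : IndepFun Y Z P := by
  have := hB.isProbabilityMeasure
  have hYl := hY.hasLaw hB hf
  have hZl := hZ.hasLaw hB hg
  have hYm := hYl.aemeasurable
  have hZm := hZl.aemeasurable
  rw [indepFun_iff_charFun_prod hYm hZm]
  intro t
  have h1 : charFun (P.map (fun ω => WithLp.toLp 2 (Y ω, Z ω))) t =
      charFun (P.map fun ω => t.ofLp.1 * Y ω + t.ofLp.2 * Z ω) 1 := by
    rw [charFun_apply, charFun_apply_real, integral_map (by fun_prop) (by fun_prop),
      integral_map (by fun_prop) (by fun_prop)]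
    refine integral_congr_ae (ae_of_all _ fun ω => ?_)
    simp [WithLp.prod_inner_apply]
  rw [h1, charFun_map_of_hasLaw (IsWienerIntegral.hasLaw_comb hB hf hg hY hZ hfg _ _),
    charFun_map_of_hasLaw hYl, charFun_map_of_hasLaw hZl, ← Complex.exp_add,
    Real.coe_toNNReal _ (by positivity), Real.coe_toNNReal _ (by positivity),
    Real.coe_toNNReal _ (by positivity)]
  congr 1
  push_cast
  ring

variable {A : Ω → ℝ} {c : ℝ} {Y W : Ω → ℝ} {v : ℝ≥0}

lemma HasLaw.map_prodMk_eq [IsProbabilityMeasure P] (hA : Measurable A)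
    (hY : HasLaw Y (gaussianReal 0 v) P) (hAY : IndepFun A Y P) :
    P.map (fun ω => (A ω, Y ω)) = (P.map A).prod (gaussianReal 0 v) := by
  rw [(indepFun_iff_map_prod_eq_prod_map_map hA.aemeasurable hY.aemeasurable).1 hAY, hY.map_eq]

/-- Given A = a, the expectation is exp(v s² a / 2), which is at most exp(c a). -/
lemma integrable_exp_mul_sqrt [IsProbabilityMeasure P] (hA : Measurable A)
    (hpos : ∀ᵐ ω ∂P, 0 < A ω) (hcA : Integrable (fun ω => Real.exp (c * A ω)) P)
    (hY : HasLaw Y (gaussianReal 0 v) P) (hAY : IndepFun A Y P) {s : ℝ}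
    (hs : s ^ 2 * v ≤ 2 * c) :
    Integrable (fun ω => Real.exp (s * (√(A ω) * Y ω))) P := by
  have hYm := hY.aemeasurable
  have := Measure.isProbabilityMeasure_map (μ := P) hA.aemeasurable
  have key : Integrable (fun p : ℝ × ℝ => Real.exp (s * (√p.1 * p.2)))
      (P.map fun ω => (A ω, Y ω)) := by
    rw [HasLaw.map_prodMk_eq hA hY hAY, integrable_prod_iff (by fun_prop)]
    have he : ∀ a : ℝ, (fun y : ℝ => Real.exp (s * (√a * y))) =
        fun y => Real.exp ((s * √a) * y) := fun a => by simp only [mul_assoc]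
    refine ⟨ae_of_all _ fun a => ?_, ?_⟩
    · simpa only [he] using integrable_exp_mul_gaussianReal (μ := 0) (v := v) (s * √a)
    · have hn : ∀ a : ℝ, ∫ y, ‖Real.exp (s * (√a * y))‖ ∂(gaussianReal 0 v) =
          Real.exp (v * (s * √a) ^ 2 / 2) := by
        intro a
        have := congrFun (mgf_id_gaussianReal (μ := 0) (v := v)) (s * √a)
        simp only [mgf, id_eq, zero_mul, zero_add] at this
        rw [← this]
        simp [mul_assoc]
      simp only [hn]
      have h1 : Integrable (fun a => Real.exp (c * a)) (P.map A) := by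
        rw [integrable_map_measure (by fun_prop) hA.aemeasurable]
        exact hcA
      refine h1.mono' (by fun_prop) ?_
      rw [ae_map_iff hA.aemeasurable (measurableSet_le (by fun_prop) (by fun_prop))]
      filter_upwards [hpos] with ω hω
      rw [Real.norm_of_nonneg (Real.exp_pos _).le]
      refine Real.exp_le_exp.2 ?_
      rw [mul_pow, Real.sq_sqrt hω.le]
      nlinarith
  exact (integrable_map_measure (g := fun p : ℝ × ℝ => Real.exp (s * (√p.1 * p.2)))
    (by fun_prop) (by fun_prop)).1 key

/-- Squaring doubles `s`. For `s = 1` the condition reads 2‖η‖₂² ≤ c, the same form as in the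
definition of D_A. -/
lemma memLp_exp_mul_sqrt [IsProbabilityMeasure P] (hA : Measurable A)
    (hpos : ∀ᵐ ω ∂P, 0 < A ω) (hcA : Integrable (fun ω => Real.exp (c * A ω)) P)
    (hY : HasLaw Y (gaussianReal 0 v) P) (hAY : IndepFun A Y P) {s : ℝ}
    (hs : 2 * s ^ 2 * v ≤ c) :
    MemLp (fun ω => Real.exp (s * (√(A ω) * Y ω))) 2 P := by
  have hYm := hY.aemeasurable
  rw [memLp_two_iff_integrable_sq (by fun_prop)]
  refine (integrable_exp_mul_sqrt hA hpos hcA hY hAY (s := 2 * s) (by linarith)).congr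
    (ae_of_all _ fun ω => ?_)
  simp only
  rw [← Real.exp_nat_mul]
  congr 1
  push_cast
  ring

lemma memLp_two_of_integrable_exp [IsProbabilityMeasure P] (hA : Measurable A)
    (hpos : ∀ᵐ ω ∂P, 0 < A ω) (hc : 0 < c)
    (hcA : Integrable (fun ω => Real.exp (c * A ω)) P) : MemLp A 2 P := by
  rw [memLp_two_iff_integrable_sq hA.aestronglyMeasurable]
  refine (hcA.const_mul (2 / c ^ 2)).mono' (by fun_prop) ?_
  filter_upwards [hpos] with ω hω
  rw [Real.norm_of_nonneg (by positivity)]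
  have := Real.quadratic_le_exp_of_nonneg (x := c * A ω) (by positivity)
  have h2 : (c * A ω) ^ 2 / 2 ≤ Real.exp (c * A ω) := by
    have : 0 < c * A ω := by positivity
    linarith
  calc A ω ^ 2 = 2 / c ^ 2 * ((c * A ω) ^ 2 / 2) := by field_simp
    _ ≤ _ := by gcongr

lemma memLp_sqrt_mul [IsProbabilityMeasure P] (hA : Measurable A)
    (hpos : ∀ᵐ ω ∂P, 0 < A ω) (hA1 : Integrable A P)
    (hY : HasLaw Y (gaussianReal 0 v) P) (hAY : IndepFun A Y P) :
    MemLp (fun ω => √(A ω) * Y ω) 2 P := by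
  have hYm := hY.aemeasurable
  rw [memLp_two_iff_integrable_sq (by fun_prop)]
  have h1 : IndepFun A (fun ω => Y ω ^ 2) P :=
    hAY.comp measurable_id (show Measurable fun x : ℝ => x ^ 2 by fun_prop)
  refine (h1.integrable_mul hA1 (hasLaw_gaussianReal_memLp_two hY).integrable_sq).congr ?_
  filter_upwards [hpos] with ω hω
  simp [mul_pow, Real.sq_sqrt hω.le]

lemma integral_sq_sqrt_mul (hpos : ∀ᵐ ω ∂P, 0 < A ω)
    (hA : Measurable A)
    (hY : HasLaw Y (gaussianReal 0 v) P) (hAY : IndepFun A Y P) :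
    ∫ ω, (√(A ω) * Y ω) ^ 2 ∂P = (∫ ω, A ω ∂P) * v := by
  have hYm := hY.aemeasurable
  have h1 : IndepFun A (fun ω => Y ω ^ 2) P :=
    hAY.comp measurable_id (show Measurable fun x : ℝ => x ^ 2 by fun_prop)
  rw [← integral_sq_of_hasLaw_gaussianReal hY,
    ← h1.integral_fun_mul_eq_mul_integral hA.aestronglyMeasurable (by fun_prop)]
  refine integral_congr_ae ?_
  filter_upwards [hpos] with ω hω
  simp [mul_pow, Real.sq_sqrt hω.le]

lemma integral_sqrt_mul_eq_zero
    (hA : Measurable A)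
    (hY : HasLaw Y (gaussianReal 0 v) P) (hAY : IndepFun A Y P) :
    ∫ ω, √(A ω) * Y ω ∂P = 0 := by
  have hYm := hY.aemeasurable
  have h1 : IndepFun (fun ω => √(A ω)) Y P :=
    hAY.comp (show Measurable fun x : ℝ => √x by fun_prop) measurable_id
  rw [h1.integral_fun_mul_eq_mul_integral (by fun_prop) (by fun_prop), hY.integral_eq,
    integral_id_gaussianReal, mul_zero]

/-- Gaussian integration by parts, conditionally on the scale. -/
lemma integral_sqrt_mul_exp [IsProbabilityMeasure P] (hA : Measurable A)
    (hpos : ∀ᵐ ω ∂P, 0 < A ω)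
    (hY : HasLaw Y (gaussianReal 0 v) P) (hAY : IndepFun A Y P)
    (h1 : Integrable (fun ω => √(A ω) * Y ω * Real.exp (√(A ω) * Y ω)) P)
    (h2 : Integrable (fun ω => A ω * Real.exp (√(A ω) * Y ω)) P) :
    ∫ ω, √(A ω) * Y ω * Real.exp (√(A ω) * Y ω) ∂P =
      v * ∫ ω, A ω * Real.exp (√(A ω) * Y ω) ∂P := by
  have hYm := hY.aemeasurable
  have := Measure.isProbabilityMeasure_map (μ := P) hA.aemeasurable
  have hm := HasLaw.map_prodMk_eq hA hY hAY
  have e1 : ∀ F : ℝ × ℝ → ℝ, Measurable F → Integrable (fun ω => F (A ω, Y ω)) P →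
      ∫ ω, F (A ω, Y ω) ∂P = ∫ a, ∫ y, F (a, y) ∂(gaussianReal 0 v) ∂(P.map A) := by
    intro F hF hi
    have hi' : Integrable F (P.map fun ω => (A ω, Y ω)) :=
      (integrable_map_measure (hF.aestronglyMeasurable) (by fun_prop)).2 hi
    rw [← integral_prod _ (hm ▸ hi'), ← hm, integral_map (by fun_prop) hF.aestronglyMeasurable]
  rw [e1 (fun p => √p.1 * p.2 * Real.exp (√p.1 * p.2)) (by fun_prop) h1,
    e1 (fun p => p.1 * Real.exp (√p.1 * p.2)) (by fun_prop) h2, ← integral_const_mul]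
  refine integral_congr_ae ?_
  have hae : ∀ᵐ a ∂(P.map A), 0 < a :=
    (ae_map_iff hA.aemeasurable measurableSet_Ioi).2 hpos
  filter_upwards [hae] with a ha
  have hmgf := mgf_id_gaussianReal (μ := 0) (v := v)
  -- Stein's identity E[Y exp(√a Y)] = v √a E[exp(√a Y)] is the derivative of the moment generating
  -- function exp(v t²/2) at t = √a. The outer factor √a completes v·a.
  have hd := deriv_mgf (X := id) (μ := gaussianReal 0 v) (t := √a) (by simp)
  rw [hmgf] at hd
  simp only [zero_mul, zero_add] at hmgf hd
  have hd' : HasDerivAt (fun t : ℝ => Real.exp (v * t ^ 2 / 2))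
      (Real.exp (v * √a ^ 2 / 2) * (v * √a)) (√a) := by
    convert (((hasDerivAt_pow 2 (√a)).const_mul (v : ℝ)).div_const 2).exp using 1
    simp
    ring
  rw [hd'.deriv] at hd
  have hm' := congrFun hmgf (√a)
  simp only [mgf, id_eq] at hm' hd
  simp only [mul_assoc, integral_const_mul]
  rw [← hd, hm']
  have := Real.mul_self_sqrt ha.le
  linear_combination (v : ℝ) * Real.exp (v * √a ^ 2 / 2) * this

/-- Given A, the expectation factors and contains the vanishing mean of `W`. -/
lemma integral_sqrt_mul_exp_of_indepFun [IsProbabilityMeasure P] (hA : Measurable A)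
    {w : ℝ≥0} (hY : AEMeasurable Y P) (hW : HasLaw W (gaussianReal 0 w) P)
    (hAWY : IndepFun A (fun ω => (W ω, Y ω)) P) (hWY : IndepFun W Y P) :
    ∫ ω, √(A ω) * W ω * Real.exp (√(A ω) * Y ω) ∂P = 0 := by
  have hWm := hW.aemeasurable
  have := Measure.isProbabilityMeasure_map (μ := P) hA.aemeasurable
  have := Measure.isProbabilityMeasure_map (μ := P) hWm
  have := Measure.isProbabilityMeasure_map (μ := P) hY
  have hm : P.map (fun ω => (A ω, (W ω, Y ω))) =
      (P.map A).prod ((P.map W).prod (P.map Y)) := by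
    rw [(indepFun_iff_map_prod_eq_prod_map_map hA.aemeasurable (by fun_prop)).1 hAWY,
      (indepFun_iff_map_prod_eq_prod_map_map hWm hY).1 hWY]
  have hF : Measurable fun p : ℝ × ℝ × ℝ => √p.1 * p.2.1 * Real.exp (√p.1 * p.2.2) := by
    fun_prop
  have e1 : ∫ ω, √(A ω) * W ω * Real.exp (√(A ω) * Y ω) ∂P =
      ∫ p : ℝ × ℝ × ℝ, √p.1 * p.2.1 * Real.exp (√p.1 * p.2.2)
        ∂((P.map A).prod ((P.map W).prod (P.map Y))) := by
    rw [← hm, integral_map (by fun_prop) hF.aestronglyMeasurable]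
  rw [e1]
  by_cases hi : Integrable (fun p : ℝ × ℝ × ℝ => √p.1 * p.2.1 * Real.exp (√p.1 * p.2.2))
      ((P.map A).prod ((P.map W).prod (P.map Y)))
  · rw [integral_prod _ hi]
    refine integral_eq_zero_of_ae (ae_of_all _ fun a => ?_)
    simp only [Pi.zero_apply]
    rw [integral_prod_mul (fun x => √a * x) (fun y => Real.exp (√a * y)), integral_const_mul,
      hW.map_eq]
    have : ∫ x, x ∂(gaussianReal 0 w) = 0 := integral_id_gaussianReal
    rw [this]
    simp
  -- Without integrability the Bochner integral is 0 by convention, so the claim needs no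
  -- integrability assumption.
  · exact integral_undef hi

end RSFBM

namespace RSFBM

variable {Ω : Type*} [MeasurableSpace Ω] {P : Measure Ω} {B : ℝ → Ω → ℝ}

/-! ### Totality of the Wick exponentials -/

lemma IsWienerIntegral.indepFun {f : ℝ → ℝ} {Y : Ω → ℝ} {A : Ω → ℝ}
    (hB : IsTwoSidedBrownianMotion B P) (hAB : IndepFun A (fun ω t => B t ω) P)
    (hY : IsWienerIntegral B P f Y) : IndepFun A Y P :=
  indepFun_of_aestronglyMeasurable_iSup hAB (hY.exists_measurable_iSup hB)

lemma IsWienerIntegral.indepFun_prodMk {f g : ℝ → ℝ} {Y Z : Ω → ℝ} {A : Ω → ℝ}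
    (hB : IsTwoSidedBrownianMotion B P) (hAB : IndepFun A (fun ω t => B t ω) P)
    (hY : IsWienerIntegral B P f Y) (hZ : IsWienerIntegral B P g Z) :
    IndepFun A (fun ω => (Y ω, Z ω)) P := by
  obtain ⟨Y', hYm, hYe⟩ := hY.exists_measurable_iSup hB
  obtain ⟨Z', hZm, hZe⟩ := hZ.exists_measurable_iSup hB
  refine indepFun_of_aestronglyMeasurable_iSup hAB
    ⟨fun ω => (Y' ω, Z' ω), Measurable.prodMk hYm hZm, ?_⟩
  filter_upwards [hYe, hZe] with ω h1 h2
  rw [h1, h2]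

variable {A : Ω → ℝ} {c : ℝ}

/-- The scalar product of the scaled Wiener integral with an exponential functional. -/
lemma integral_sqrt_mul_wiener_mul_exp [IsProbabilityMeasure P]
    (hB : IsTwoSidedBrownianMotion B P)
    (hA : Measurable A) (hpos : ∀ᵐ ω ∂P, 0 < A ω) (hAB : IndepFun A (fun ω t => B t ω) P)
    (hc : 0 < c) (hcA : Integrable (fun ω => Real.exp (c * A ω)) P)
    {g η : ℝ → ℝ} (hg : MemLp g 2 volume) (hη : MemLp η 2 volume) (hηc : 2 * ∫ x, η x ^ 2 ≤ c)
    {G Y : Ω → ℝ} (hG : IsWienerIntegral B P g G) (hY : IsWienerIntegral B P η Y) :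
    ∫ ω, √(A ω) * G ω * Real.exp (√(A ω) * Y ω) ∂P =
      (∫ x, g x * η x) * ∫ ω, A ω * Real.exp (√(A ω) * Y ω) ∂P := by
  have hYl := hY.hasLaw hB hη
  have hAY := hY.indepFun hB hAB
  set v : ℝ≥0 := (∫ x, η x ^ 2).toNNReal with hv
  have hvv : (v : ℝ) = ∫ x, η x ^ 2 := Real.coe_toNNReal _ (by positivity)
  have hA2 := memLp_two_of_integrable_exp hA hpos hc hcA
  have hexp : MemLp (fun ω => Real.exp (√(A ω) * Y ω)) 2 P := by
    simpa using memLp_exp_mul_sqrt hA hpos hcA hYl hAY (s := 1) (by rw [hvv]; linarith)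
  have hYm := hYl.aemeasurable
  -- The coefficient of the orthogonal projection of `g` onto `η`. The remainder g - αη has a Wiener
  -- integral independent of that of `η` and drops out. If v = 0, then η vanishes almost everywhere
  -- and `hαv` still holds with the default value α = 0.
  set α : ℝ := (∫ x, g x * η x) / v with hα
  have hαv : α * v = ∫ x, g x * η x := by
    by_cases h0 : (v : ℝ) = 0
    · have : η =ᵐ[volume] 0 := by
        have h1 := (integral_eq_zero_iff_of_nonneg (fun x => sq_nonneg (η x))
          hη.integrable_sq).1 (hvv ▸ h0)
        filter_upwards [h1] with x hx
        simpa using hx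
      rw [h0, mul_zero, integral_eq_zero_of_ae]
      filter_upwards [this] with x hx
      simp [hx]
    · rw [hα, div_mul_cancel₀ _ h0]
  have hwL : MemLp (g + (-α) • η) 2 volume := hg.add (hη.const_smul _)
  have hW : IsWienerIntegral B P (g + (-α) • η) (G + (-α) • Y) :=
    hG.add (hY.smul _) hB hg (hη.const_smul _)
  have horth : ∫ x, (g + (-α) • η) x * η x = 0 := by
    have : ∀ x, (g + (-α) • η) x * η x = g x * η x - α * η x ^ 2 := by
      intro x; simp only [Pi.add_apply, Pi.smul_apply, smul_eq_mul]; ring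
    have i1 : Integrable fun x => g x * η x := hg.integrable_mul hη
    simp_rw [this]
    rw [integral_sub i1 (hη.integrable_sq.const_mul _), integral_const_mul, ← hvv, hαv, sub_self]
  have h0 := integral_sqrt_mul_exp_of_indepFun hA hYm (hW.hasLaw hB hwL)
    (hW.indepFun_prodMk hB hAB hY) (hW.indepFun_of_orthogonal hB hwL hη hY horth)
  have i1 : Integrable (fun ω => √(A ω) * Y ω * Real.exp (√(A ω) * Y ω)) P :=
    (memLp_sqrt_mul hA hpos (hA2.integrable one_le_two) hYl hAY).integrable_mul hexp
  have i2 : Integrable (fun ω => A ω * Real.exp (√(A ω) * Y ω)) P := hA2.integrable_mul hexp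
  have i3 : Integrable (fun ω => √(A ω) * (G + (-α) • Y) ω * Real.exp (√(A ω) * Y ω)) P :=
    (memLp_sqrt_mul hA hpos (hA2.integrable one_le_two) (hW.hasLaw hB hwL)
      (hW.indepFun hB hAB)).integrable_mul hexp
  have hst := integral_sqrt_mul_exp hA hpos hYl hAY i1 i2
  have hsplit : ∀ ω, √(A ω) * G ω * Real.exp (√(A ω) * Y ω) =
      √(A ω) * (G + (-α) • Y) ω * Real.exp (√(A ω) * Y ω) +
        α * (√(A ω) * Y ω * Real.exp (√(A ω) * Y ω)) := by
    intro ω; simp only [Pi.add_apply, Pi.smul_apply, smul_eq_mul]; ring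
  simp_rw [hsplit]
  rw [integral_add i3 (i1.const_mul _), h0, integral_const_mul, hst, ← hαv]
  ring

/-! ### Signed densities and analytic continuation -/

lemma abs_max_zero_le (a : ℝ) : |max a 0| ≤ |a| := by
  rcases le_total 0 a with h | h <;> simp [h]

/-- Since `ENNReal.ofReal` truncates at 0, the two densities are the positive and the negative part
of Θ. Results on positive measures thereby apply to integrals weighted by Θ. -/
lemma integral_withDensity_sub {Θ : Ω → ℝ} (hΘ : AEMeasurable Θ P)
    {E : Type*} [NormedAddCommGroup E] [NormedSpace ℝ E] {g : Ω → E}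
    (hg : AEStronglyMeasurable g P)
    (hi : Integrable (fun ω => Θ ω • g ω) P) :
    ∫ ω, g ω ∂(P.withDensity fun ω => ENNReal.ofReal (Θ ω)) -
      ∫ ω, g ω ∂(P.withDensity fun ω => ENNReal.ofReal (-Θ ω)) = ∫ ω, Θ ω • g ω ∂P := by
  rw [integral_withDensity_eq_integral_toReal_smul₀ (by fun_prop) (by simp),
    integral_withDensity_eq_integral_toReal_smul₀ (by fun_prop) (by simp), ← integral_sub]
  · refine integral_congr_ae (ae_of_all _ fun ω => ?_)
    simp only [ENNReal.toReal_ofReal', ← sub_smul]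
    congr 1
    rcases le_total 0 (Θ ω) with h | h <;> simp [h]
  · refine hi.mono (AEStronglyMeasurable.smul
      (by fun_prop : AEMeasurable _ P).aestronglyMeasurable hg) (ae_of_all _ fun ω => ?_)
    simp only [norm_smul, ENNReal.toReal_ofReal', Real.norm_eq_abs]
    exact mul_le_mul_of_nonneg_right (abs_max_zero_le _) (norm_nonneg _)
  · refine hi.mono (AEStronglyMeasurable.smul
      (by fun_prop : AEMeasurable _ P).aestronglyMeasurable hg) (ae_of_all _ fun ω => ?_)
    simp only [norm_smul, ENNReal.toReal_ofReal', Real.norm_eq_abs]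
    exact mul_le_mul_of_nonneg_right ((abs_max_zero_le _).trans_eq (abs_neg _)) (norm_nonneg _)

lemma integrable_withDensity_of_integrable_mul {Θ : Ω → ℝ} (hΘ : AEMeasurable Θ P)
    {g : Ω → ℝ} (hg : AEMeasurable g P) (hi : Integrable (fun ω => Θ ω * g ω) P) :
    Integrable g (P.withDensity fun ω => ENNReal.ofReal (Θ ω)) := by
  rw [integrable_withDensity_iff_integrable_smul₀' (by fun_prop) (by simp)]
  refine hi.mono (by fun_prop) (ae_of_all _ fun ω => ?_)
  simp only [norm_smul, norm_mul, ENNReal.toReal_ofReal', Real.norm_eq_abs]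
  exact mul_le_mul_of_nonneg_right (abs_max_zero_le _) (abs_nonneg _)

lemma isFiniteMeasure_withDensity_ofReal' {Θ : Ω → ℝ} (hΘ : Integrable Θ P) :
    IsFiniteMeasure (P.withDensity fun ω => ENNReal.ofReal (Θ ω)) :=
  isFiniteMeasure_withDensity_ofReal hΘ.2

/-- Analytic continuation: if all exponential moments near `0` of a random variable, weighted by
`Θ`, vanish, then the weighted characteristic function vanishes. -/
lemma integral_mul_cexp_I_eq_zero {Θ X : Ω → ℝ} (hΘ : MemLp Θ 2 P)
    (hX : AEMeasurable X P) {s₀ : ℝ} (hs₀ : 0 < s₀)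
    (hexp : ∀ s, |s| < s₀ → MemLp (fun ω => Real.exp (s * X ω)) 2 P)
    (h0 : ∀ s, |s| < s₀ → ∫ ω, Θ ω * Real.exp (s * X ω) ∂P = 0) :
    ∫ ω, (Θ ω : ℂ) * Complex.exp (X ω * Complex.I) ∂P = 0 := by
  have hΘm : AEMeasurable Θ P := hΘ.1.aemeasurable
  set μp := P.withDensity fun ω => ENNReal.ofReal (Θ ω) with hμp
  set μm := P.withDensity fun ω => ENNReal.ofReal (-Θ ω) with hμm
  have hsub : ∀ s, |s| < s₀ → s ∈ integrableExpSet X μp ∧ s ∈ integrableExpSet X μm := by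
    intro s hs
    have hi : Integrable (fun ω => Θ ω * Real.exp (s * X ω)) P := hΘ.integrable_mul (hexp s hs)
    exact ⟨integrable_withDensity_of_integrable_mul hΘm (by fun_prop) hi,
      integrable_withDensity_of_integrable_mul hΘm.neg (by fun_prop)
        (hi.neg.congr (ae_of_all _ fun ω => by simp))⟩
  -- On this vertical strip both complex moment generating functions are analytic. It contains the
  -- real interval where their difference vanishes, and also the point i, where the difference is
  -- the weighted characteristic function.
  let U : Set ℂ := {z | |z.re| < s₀}
  have hint : ∀ z ∈ U, z.re ∈ interior (integrableExpSet X μp) ∧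
      z.re ∈ interior (integrableExpSet X μm) := by
    have ho : IsOpen {s : ℝ | |s| < s₀} := isOpen_lt continuous_abs continuous_const
    exact fun z hz => ⟨interior_maximal (fun s hs => (hsub s hs).1) ho hz,
      interior_maximal (fun s hs => (hsub s hs).2) ho hz⟩
  have hU : IsPreconnected U := by
    have : U = Complex.re ⁻¹' (Ioo (-s₀) s₀) := by ext z; simp [U, abs_lt]
    rw [this]
    exact ((convex_Ioo _ _).linear_preimage Complex.reLm).isPreconnected
  have han : AnalyticOnNhd ℂ (fun z => complexMGF X μp z - complexMGF X μm z) U :=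
    fun z hz => (analyticAt_complexMGF (hint z hz).1).sub (analyticAt_complexMGF (hint z hz).2)
  have hrep : ∀ z ∈ U, complexMGF X μp z - complexMGF X μm z =
      ∫ ω, (Θ ω : ℂ) * Complex.exp (z * X ω) ∂P := by
    intro z hz
    have hi : Integrable (fun ω => Θ ω • Complex.exp (z * X ω)) P := by
      have h1 : Integrable (fun ω => Θ ω * Real.exp (z.re * X ω)) P :=
        hΘ.integrable_mul (hexp _ hz)
      refine h1.mono (by fun_prop) (ae_of_all _ fun ω => ?_)
      simp [Complex.norm_exp]
    rw [complexMGF, complexMGF, integral_withDensity_sub hΘm (by fun_prop) hi]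
    simp
  have hz0 : (0 : ℂ) ∈ U := by simpa [U] using hs₀
  have hfreq : ∃ᶠ z in 𝓝[≠] (0 : ℂ), complexMGF X μp z - complexMGF X μm z = 0 := by
    have h1 : ∃ᶠ x : ℝ in 𝓝[≠] (0 : ℝ), complexMGF X μp x - complexMGF X μm x = 0 := by
      refine Eventually.frequently (Filter.Eventually.filter_mono nhdsWithin_le_nhds ?_)
      filter_upwards [(isOpen_lt continuous_abs continuous_const).mem_nhds
        (show (0 : ℝ) ∈ {s : ℝ | |s| < s₀} by simpa using hs₀)] with x hx
      rw [hrep x (by simpa [U] using hx)]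
      have := h0 x hx
      rw [← Complex.ofReal_eq_zero, ← integral_complex_ofReal] at this
      simpa using this
    refine Tendsto.frequently (f := fun x : ℝ => (x : ℂ)) ?_ h1
    refine tendsto_nhdsWithin_of_tendsto_nhds_of_eventually_within _
      (Complex.continuous_ofReal.tendsto' 0 0 rfl |>.mono_left nhdsWithin_le_nhds) ?_
    filter_upwards [self_mem_nhdsWithin] with x hx
    simpa using hx
  have := han.eqOn_zero_of_preconnected_of_frequently_eq_zero hU hz0 hfreq
    (show Complex.I ∈ U by simpa [U] using hs₀)
  simp only [Pi.zero_apply] at this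
  rw [hrep _ (by simpa [U] using hs₀)] at this
  simpa [mul_comm] using this

end RSFBM

namespace RSFBM

variable {Ω : Type*} [MeasurableSpace Ω] {P : Measure Ω} {B : ℝ → Ω → ℝ} {A : Ω → ℝ} {c : ℝ}

/-! ### From small Schwartz functions to the law of the scaled path -/

lemma integral_mul_cexp_schwartz_eq_zero [IsProbabilityMeasure P]
    (hB : IsTwoSidedBrownianMotion B P)
    (hA : Measurable A) (hpos : ∀ᵐ ω ∂P, 0 < A ω) (hAB : IndepFun A (fun ω t => B t ω) P)
    (hcA : Integrable (fun ω => Real.exp (c * A ω)) P)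
    {Θ : Ω → ℝ} (hΘ : MemLp Θ 2 P) {δ : ℝ} (hδ : 0 < δ) (hδc : 2 * δ ≤ c)
    (h0 : ∀ (η : 𝓢(ℝ, ℝ)) (Y : Ω → ℝ), IsWienerIntegral B P η Y → ∫ x, η x ^ 2 ≤ δ →
      ∫ ω, Θ ω * Real.exp (√(A ω) * Y ω) ∂P = 0)
    (η : 𝓢(ℝ, ℝ)) {Y : Ω → ℝ} (hY : IsWienerIntegral B P η Y) :
    ∫ ω, (Θ ω : ℂ) * Complex.exp ((√(A ω) * Y ω : ℝ) * Complex.I) ∂P = 0 := by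
  have hη : MemLp η 2 volume := η.memLp 2 volume
  have hI : 0 ≤ ∫ x, η x ^ 2 := by positivity
  -- For an arbitrary η only small multiples sη are admissible; continuation in s reaches i. The
  -- summand 1 covers η = 0.
  have hs : ∀ s : ℝ, |s| < √(δ / (1 + ∫ x, η x ^ 2)) → s ^ 2 * ∫ x, η x ^ 2 ≤ δ := by
    intro s hs
    have h1 : s ^ 2 ≤ δ / (1 + ∫ x, η x ^ 2) := by
      rw [← sq_abs, ← Real.sq_sqrt (show 0 ≤ δ / (1 + ∫ x, η x ^ 2) by positivity)]
      gcongr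
    calc s ^ 2 * ∫ x, η x ^ 2 ≤ δ / (1 + ∫ x, η x ^ 2) * (1 + ∫ x, η x ^ 2) := by
          gcongr; linarith
      _ = δ := div_mul_cancel₀ _ (by positivity)
  have hYm := (hY.hasLaw hB hη).aemeasurable
  refine integral_mul_cexp_I_eq_zero hΘ (by fun_prop) (s₀ := √(δ / (1 + ∫ x, η x ^ 2)))
    (Real.sqrt_pos.2 (by positivity)) (fun s h => ?_) fun s h => ?_
  · refine memLp_exp_mul_sqrt hA hpos hcA (hY.hasLaw hB hη) (hY.indepFun hB hAB) ?_
    rw [Real.coe_toNNReal _ hI]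
    nlinarith [hs s h]
  · have := h0 (s • η) (s • Y) (hY.smul s) (by
      simp only [smul_apply, smul_eq_mul, mul_pow, integral_const_mul]
      exact hs s h)
    rw [← this]
    refine integral_congr_ae (ae_of_all _ fun ω => ?_)
    simp only [Pi.smul_apply, smul_eq_mul]
    ring_nf

lemma exists_schwartz_tendsto {f : ℝ → ℝ} (hf : MemLp f 2 volume) :
    ∃ η : ℕ → 𝓢(ℝ, ℝ), Tendsto (fun n => eLpNorm (fun x => η n x - f x) 2 volume) atTop (𝓝 0) := by
  have hd := SchwartzMap.denseRange_toLpCLM (E := ℝ) (F := ℝ) (p := 2)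
    (μ := volume) (by simp)
  obtain ⟨k, hk, hlim⟩ := mem_closure_iff_seq_limit.1 (hd (hf.toLp f))
  choose η hη using hk
  refine ⟨η, ?_⟩
  refine (Lp.tendsto_Lp_iff_tendsto_eLpNorm'' (fun n => η n) (fun n => (η n).memLp 2 volume) f
    hf).1 ?_
  rw [← funext hη] at hlim
  exact hlim

lemma eLpNorm_sqrt_mul [IsProbabilityMeasure P] (hA : Measurable A)
    (hpos : ∀ᵐ ω ∂P, 0 < A ω) (hA1 : Integrable A P)
    (hB : IsTwoSidedBrownianMotion B P) (hAB : IndepFun A (fun ω t => B t ω) P)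
    {f : ℝ → ℝ} (hf : MemLp f 2 volume) {Y : Ω → ℝ} (hY : IsWienerIntegral B P f Y) :
    eLpNorm (fun ω => √(A ω) * Y ω) 2 P =
      ENNReal.ofReal (√(∫ ω, A ω ∂P)) * eLpNorm f 2 volume := by
  rw [eLpNorm_two_eq (memLp_sqrt_mul hA hpos hA1 (hY.hasLaw hB hf) (hY.indepFun hB hAB)),
    eLpNorm_two_eq hf, integral_sq_sqrt_mul hpos hA (hY.hasLaw hB hf) (hY.indepFun hB hAB),
    Real.coe_toNNReal _ (by positivity), Real.sqrt_mul' _ (by positivity),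
    ENNReal.ofReal_mul (by positivity)]

/-- Schwartz functions are dense in L²(ℝ), and f ↦ √A I(f) multiplies norms by the constant √E[A],
so the weighted characteristic functions pass to the limit. This reaches step functions, that is,
the increments of B. -/
lemma integral_mul_cexp_eq_zero_of_schwartz [IsProbabilityMeasure P]
    (hB : IsTwoSidedBrownianMotion B P)
    (hA : Measurable A) (hpos : ∀ᵐ ω ∂P, 0 < A ω) (hAB : IndepFun A (fun ω t => B t ω) P)
    (hA1 : Integrable A P) {Θ : Ω → ℝ} (hΘ : MemLp Θ 2 P)
    (h : ∀ (η : 𝓢(ℝ, ℝ)) (Y : Ω → ℝ), IsWienerIntegral B P η Y →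
      ∫ ω, (Θ ω : ℂ) * Complex.exp ((√(A ω) * Y ω : ℝ) * Complex.I) ∂P = 0)
    {f : ℝ → ℝ} (hf : MemLp f 2 volume) {Y : Ω → ℝ} (hY : IsWienerIntegral B P f Y) :
    ∫ ω, (Θ ω : ℂ) * Complex.exp ((√(A ω) * Y ω : ℝ) * Complex.I) ∂P = 0 := by
  obtain ⟨η, hη⟩ := exists_schwartz_tendsto hf
  have hηL : ∀ n, MemLp (η n) 2 volume := fun n => (η n).memLp 2 volume
  have hW := fun n => hB.isWienerIntegral (hηL n)
  have hD : ∀ n, IsWienerIntegral B P ((η n : ℝ → ℝ) + (-1 : ℝ) • f)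
      (wienerIntegral B P (η n) + (-1 : ℝ) • Y) := fun n =>
    (hW n).add (hY.smul (-1)) hB (hηL n) (hf.const_smul (-1))
  have hlim := tendsto_integral_mul_cexp hΘ
    (X := fun n ω => √(A ω) * wienerIntegral B P (η n) ω) (Y := fun ω => √(A ω) * Y ω)
    (fun n => memLp_sqrt_mul hA hpos hA1 ((hW n).hasLaw hB (hηL n)) ((hW n).indepFun hB hAB))
    (memLp_sqrt_mul hA hpos hA1 (hY.hasLaw hB hf) (hY.indepFun hB hAB)) ?_
    (hΘ.integrable one_le_two)
  · simp only [h (η _) _ (hW _)] at hlim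
    exact (tendsto_nhds_unique hlim tendsto_const_nhds)
  · have h2 := ENNReal.Tendsto.const_mul (a := ENNReal.ofReal (√(∫ ω, A ω ∂P))) hη
      (Or.inr ENNReal.ofReal_ne_top)
    rw [mul_zero] at h2
    refine h2.congr fun n => ?_
    have h3 := eLpNorm_sqrt_mul hA hpos hA1 hB hAB ((hηL n).add (hf.const_smul (-1))) (hD n)
    convert h3.symm using 2
    · congr 1
      ext x
      simp [sub_eq_add_neg]
    · ext ω
      simp
      ring

/-- The scaled increments `√A (B_t - B_0)`. -/
noncomputable def scaledPath (B : ℝ → Ω → ℝ) (A : Ω → ℝ) (ω : Ω) (t : ℝ) : ℝ := √(A ω) * (B t ω - B 0 ω)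

lemma measurable_scaledPath (hB : IsTwoSidedBrownianMotion B P) (hA : Measurable A) :
    Measurable (scaledPath B A) := by
  refine measurable_pi_lambda _ fun t => ?_
  have := hB.measurable
  unfold scaledPath
  fun_prop

/-- The positive and negative parts of Θ·P have the same image on path space: a functional of
finitely many path values is √A times a step integral, so the hypothesis equates the characteristic
functions of all finite-dimensional projections, and these determine the measure. -/
lemma setIntegral_eq_zero_of_forall_step [IsProbabilityMeasure P]
    (hB : IsTwoSidedBrownianMotion B P) (hA : Measurable A)
    {Θ : Ω → ℝ} (hΘ : Integrable Θ P)
    (h : ∀ c : ℝ →₀ ℝ,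
      ∫ ω, (Θ ω : ℂ) * Complex.exp ((√(A ω) * stepIntegral B c ω : ℝ) * Complex.I) ∂P = 0)
    {S : Set (ℝ → ℝ)} (hS : MeasurableSet S) :
    ∫ ω in scaledPath B A ⁻¹' S, Θ ω ∂P = 0 := by
  have hΘm := hΘ.aemeasurable
  have hm := measurable_scaledPath hB hA
  have := isFiniteMeasure_withDensity_ofReal' hΘ
  have := isFiniteMeasure_withDensity_ofReal' hΘ.neg
  simp only [Pi.neg_apply] at this
  set μp := P.withDensity fun ω => ENNReal.ofReal (Θ ω) with hμp
  set μm := P.withDensity fun ω => ENNReal.ofReal (-Θ ω) with hμm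
  have hmap : μp.map (scaledPath B A) = μm.map (scaledPath B A) := by
    refine IsProjectiveLimit.unique
      (P := fun I : Finset ℝ => (μp.map (scaledPath B A)).map I.restrict) (fun I => rfl) fun I => ?_
    have hr : Measurable (I.restrict (π := fun _ : ℝ => ℝ)) := by fun_prop
    simp only
    rw [Measure.map_map hr hm, Measure.map_map hr hm]
    refine Measure.ext_of_charFunDual (funext fun L => ?_)
    have hL : Measurable fun ω => L (I.restrict (scaledPath B A ω)) :=
      L.continuous.measurable.comp (hr.comp hm)
    have hc : Measurable fun ω =>
        Complex.exp ((L (I.restrict (scaledPath B A ω)) : ℝ) * Complex.I) := by fun_prop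
    rw [charFunDual_apply, charFunDual_apply,
      integral_map (hr.comp hm).aemeasurable (by fun_prop),
      integral_map (hr.comp hm).aemeasurable (by fun_prop), eq_comm, ← sub_eq_zero]
    refine (integral_withDensity_sub hΘm hc.aestronglyMeasurable
      ((integrable_mul_cexp hΘ hL.aestronglyMeasurable).congr
        (ae_of_all _ fun ω => by simp))).trans ?_
    classical
    -- The step function whose coefficients are the values of `L` on the coordinate vectors.
    let d : ℝ →₀ ℝ := Finsupp.onFinset I
      (fun t => if ht : t ∈ I then L (Pi.single ⟨t, ht⟩ 1) else 0) fun t ht => by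
        by_contra h; simp [h] at ht
    rw [← h d]
    refine integral_congr_ae (ae_of_all _ fun ω => ?_)
    simp only [Complex.real_smul]
    congr 4
    have h1 : stepIntegral B d ω = ∑ t ∈ I, d t * (B t ω - B 0 ω) :=
      Finsupp.sum_of_support_subset _ Finsupp.support_onFinset_subset _ (by simp)
    rw [h1, ← Finset.sum_coe_sort I, Finset.mul_sum,
      show L (I.restrict (scaledPath B A ω)) = _ from LinearMap.pi_apply_eq_sum_univ L.toLinearMap _]
    refine Finset.sum_congr rfl fun t _ => ?_
    have h2 : (fun j => if t = j then (1 : ℝ) else 0) = Pi.single t 1 := by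
      ext j; simp [Pi.single_apply, eq_comm]
    simp [d, scaledPath, h2]
    ring
  have hs : MeasurableSet (scaledPath B A ⁻¹' S) := hm hS
  have h1 : μp (scaledPath B A ⁻¹' S) = μm (scaledPath B A ⁻¹' S) := by
    rw [← Measure.map_apply hm hS, ← Measure.map_apply hm hS, hmap]
  have h2 := integral_withDensity_sub hΘm (g := (scaledPath B A ⁻¹' S).indicator fun _ => (1 : ℝ))
    ((measurable_const.indicator hs).aestronglyMeasurable) ?_
  · rw [integral_indicator_const _ hs, integral_indicator_const _ hs, Measure.real, Measure.real,
      ← hμp, ← hμm, h1, sub_self] at h2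
    rw [← integral_indicator hs, h2]
    refine integral_congr_ae (ae_of_all _ fun ω => ?_)
    simp [indicator]
  · refine (hΘ.indicator hs).congr (ae_of_all _ fun ω => ?_)
    simp [indicator]

end RSFBM

namespace RSFBM

variable {Ω : Type*} [MeasurableSpace Ω] {P : Measure Ω} {B : ℝ → Ω → ℝ} {A : Ω → ℝ} {c : ℝ}

/-! ### Recovering A and B from the scaled path -/

lemma stepFun_unit (j : ℕ) :
    stepFun (Finsupp.single ((j : ℝ) + 1) 1 - Finsupp.single (j : ℝ) 1) =
      (Ico (j : ℝ) (j + 1)).indicator fun _ => (1 : ℝ) := by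
  rw [stepFun_sub]
  ext x
  have hj : (0 : ℝ) ≤ j := j.cast_nonneg
  simp only [Pi.sub_apply, stepFun, zero_mul, Finsupp.sum_single_index, one_mul]
  rw [signedIndicator_of_nonneg hj, signedIndicator_of_nonneg (by linarith)]
  simp only [indicator, mem_Ico]
  have h1 : 0 ≤ x ∧ x < (j : ℝ) + 1 ↔ (0 ≤ x ∧ x < (j : ℝ)) ∨ ((j : ℝ) ≤ x ∧ x < j + 1) := by
    constructor
    · rintro ⟨h1, h2⟩
      rcases lt_or_ge x j with h | h <;> simp [*]
    · rintro (⟨h1, h2⟩ | ⟨h1, h2⟩) <;> constructor <;> linarith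
  by_cases h2 : 0 ≤ x ∧ x < (j : ℝ)
  · have h3 : ¬ ((j : ℝ) ≤ x ∧ x < j + 1) := fun h => absurd h2.2 (not_lt.2 h.1)
    rw [if_pos (h1.2 (Or.inl h2)), if_pos h2, if_neg h3, sub_self]
  · simp [h1, h2]

lemma integral_stepFun_unit_mul (i j : ℕ) :
    ∫ x, stepFun (Finsupp.single ((i : ℝ) + 1) 1 - Finsupp.single (i : ℝ) 1) x *
      stepFun (Finsupp.single ((j : ℝ) + 1) 1 - Finsupp.single (j : ℝ) 1) x =
        if i = j then 1 else 0 := by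
  rw [stepFun_unit, stepFun_unit]
  split_ifs with h
  · subst h
    have : ∀ x, (Ico (i : ℝ) (i + 1)).indicator (fun _ => (1 : ℝ)) x *
        (Ico (i : ℝ) (i + 1)).indicator (fun _ => (1 : ℝ)) x =
        (Ico (i : ℝ) (i + 1)).indicator (fun _ => (1 : ℝ)) x := by
      intro x; simp only [indicator]; split_ifs <;> simp
    simp_rw [this]
    rw [integral_indicator measurableSet_Ico]
    simp
  · refine integral_eq_zero_of_ae (ae_of_all _ fun x => ?_)
    simp only [indicator, mem_Ico, Pi.zero_apply]
    split_ifs with h1 h2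
    · exfalso
      apply h
      have h3 : (i : ℝ) < j + 1 := by linarith
      have h4 : (j : ℝ) < i + 1 := by linarith
      norm_cast at h3 h4
      omega
    all_goals simp

/-- The quadratic variation of a Brownian motion over unit intervals. -/
lemma IsTwoSidedBrownianMotion.ae_tendsto_quadratic (hB : IsTwoSidedBrownianMotion B P) :
    ∀ᵐ ω ∂P, Tendsto (fun n : ℕ => (∑ j ∈ Finset.range n,
      (B ((j : ℝ) + 1) ω - B j ω) ^ 2) / n) atTop (𝓝 1) := by
  let d : ℕ → ℝ →₀ ℝ := fun j => Finsupp.single ((j : ℝ) + 1) 1 - Finsupp.single (j : ℝ) 1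
  have hd : ∀ j ω, stepIntegral B (d j) ω = B ((j : ℝ) + 1) ω - B j ω := by
    intro j ω
    simp only [d, stepIntegral_sub, Pi.sub_apply]
    simp [stepIntegral]
  have hlaw : ∀ j, HasLaw (stepIntegral B (d j)) (gaussianReal 0 1) P := by
    intro j
    have := hB.hasLaw_stepIntegral (d j)
    have h1 := integral_stepFun_unit_mul j j
    simp only [← sq, if_true] at h1
    rw [h1] at this
    simpa using this
  have hind : ∀ i j, i ≠ j → IndepFun (stepIntegral B (d i)) (stepIntegral B (d j)) P := by
    intro i j hij
    refine (IsWienerIntegral.stepFun hB (d i)).indepFun_of_orthogonal hB (memLp_stepFun _ 2)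
      (memLp_stepFun _ 2) (IsWienerIntegral.stepFun hB (d j)) ?_
    rw [integral_stepFun_unit_mul, if_neg hij]
  have hsq : Measurable fun x : ℝ => x ^ 2 := by fun_prop
  -- This strong law asks only for pairwise independence, which orthogonality of the unit steps
  -- supplies.
  have := strong_law_ae_real (μ := P) (fun j ω => stepIntegral B (d j) ω ^ 2)
    (hasLaw_gaussianReal_memLp_two (hlaw 0)).integrable_sq
    (fun i j hij => (hind i j hij).comp hsq hsq)
    (fun i => ((hlaw i).identDistrib (hlaw 0)).comp hsq)
  rw [integral_sq_of_hasLaw_gaussianReal (hlaw 0)] at this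
  simpa [hd] using this

/-- Up to null sets, `A` and `B` are functionals of the path `√A (B - B_0)`. -/
lemma exists_ae_eq_preimage_scaledPath (hB : IsTwoSidedBrownianMotion B P)
    (hpos : ∀ᵐ ω ∂P, 0 < A ω) {G : Set Ω} (hG : MeasurableSet[sigmaBA B A] G) :
    ∃ S : Set (ℝ → ℝ), MeasurableSet S ∧ G =ᵐ[P] scaledPath B A ⁻¹' S := by
  have hX : ∀ t, Measurable[MeasurableSpace.comap (scaledPath B A) MeasurableSpace.pi] fun ω => scaledPath B A ω t := fun t =>
    (measurable_pi_apply t).comp (comap_measurable (scaledPath B A))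
  -- The averaged squared unit increments of √A(B - B_0) are A times those of B, and the latter tend
  -- to 1.
  obtain ⟨A', hA'm, hA'e⟩ : ∃ A', Measurable[MeasurableSpace.comap (scaledPath B A) MeasurableSpace.pi] A' ∧ A =ᵐ[P] A' := by
    refine exists_measurable_ae_eq_of_tendsto (X := fun n ω => (∑ j ∈ Finset.range n,
      (scaledPath B A ω ((j : ℝ) + 1) - scaledPath B A ω j) ^ 2) / n) (fun n => ?_) ?_
    · exact (Finset.measurable_fun_sum _ fun j _ => ((hX _).sub (hX _)).pow_const 2).div_const _
    · filter_upwards [hB.ae_tendsto_quadratic, hpos] with ω h1 h2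
      have h3 := h1.const_mul (A ω)
      rw [mul_one] at h3
      refine h3.congr fun n => ?_
      rw [← mul_div_assoc, Finset.mul_sum]
      congr 1
      refine Finset.sum_congr rfl fun j _ => ?_
      have : scaledPath B A ω ((j : ℝ) + 1) - scaledPath B A ω j =
          √(A ω) * (B ((j : ℝ) + 1) ω - B j ω) := by simp only [scaledPath]; ring
      rw [this, mul_pow, Real.sq_sqrt h2.le]
  have hAe : EventuallyMeasurable
      (MeasurableSpace.comap (scaledPath B A) MeasurableSpace.pi) (ae P) A := hA'm.eventuallyMeasurable_of_eventuallyEq hA'e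
  have hBe : ∀ t, EventuallyMeasurable
      (MeasurableSpace.comap (scaledPath B A) MeasurableSpace.pi) (ae P) (B t) := by
    intro t
    -- Dividing the path by √A' returns B_t - B_0, and B_0 = 0 almost surely.
    refine Measurable.eventuallyMeasurable_of_eventuallyEq
      (f := fun ω => scaledPath B A ω t / √(A' ω)) ((hX t).div hA'm.sqrt) ?_
    filter_upwards [hA'e, hpos, hB.eval_zero] with ω h1 h2 h3
    have : √(A ω) ≠ 0 := (Real.sqrt_pos.2 h2).ne'
    rw [← h1, scaledPath, h3]
    field_simp
    ring
  have hle : sigmaBA B A ≤ eventuallyMeasurableSpace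
      (MeasurableSpace.comap (scaledPath B A) MeasurableSpace.pi) (ae P) :=
    sup_le (iSup_le fun t => (hBe t).comap_le) hAe.comap_le
  obtain ⟨T, hT, hGT⟩ := hle G hG
  obtain ⟨S, hS, rfl⟩ := hT
  exact ⟨S, hS, hGT⟩

/-- Totality of the Wick exponentials: an element of `L²(σ(B,A))` that is orthogonal to
`exp (√A I(η))` for all small Schwartz functions `η` vanishes. -/
lemma ae_eq_zero_of_forall_integral_mul_exp [IsProbabilityMeasure P]
    (hB : IsTwoSidedBrownianMotion B P)
    (hA : Measurable A) (hpos : ∀ᵐ ω ∂P, 0 < A ω) (hAB : IndepFun A (fun ω t => B t ω) P)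
    (hc : 0 < c) (hcA : Integrable (fun ω => Real.exp (c * A ω)) P)
    {Θ : Ω → ℝ} (hΘ : MemL2A B A P Θ) {δ : ℝ} (hδ : 0 < δ) (hδc : 2 * δ ≤ c)
    (h0 : ∀ (η : 𝓢(ℝ, ℝ)) (Y : Ω → ℝ), IsWienerIntegral B P η Y → ∫ x, η x ^ 2 ≤ δ →
      ∫ ω, Θ ω * Real.exp (√(A ω) * Y ω) ∂P = 0) : Θ =ᵐ[P] 0 := by
  obtain ⟨hΘm, hΘ2⟩ := hΘ
  have hA1 := (memLp_two_of_integrable_exp hA hpos hc hcA).integrable one_le_two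
  have hstep : ∀ d : ℝ →₀ ℝ,
      ∫ ω, (Θ ω : ℂ) * Complex.exp ((√(A ω) * stepIntegral B d ω : ℝ) * Complex.I) ∂P = 0 :=
    fun d => integral_mul_cexp_eq_zero_of_schwartz hB hA hpos hAB hA1 hΘ2
      (fun η Y hY => integral_mul_cexp_schwartz_eq_zero hB hA hpos hAB hcA hΘ2 hδ hδc h0 η hY)
      (memLp_stepFun d 2) (IsWienerIntegral.stepFun hB d)
  have hi := hΘ2.integrable one_le_two
  have hle : sigmaBA B A ≤ ‹MeasurableSpace Ω› :=
    sup_le (iSup_le fun t => (hB.measurable t).comap_le) hA.comap_le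
  refine ae_eq_of_forall_setIntegral_eq_of_sigmaFinite' hle (fun _ _ _ => hi.integrableOn)
    (fun _ _ _ => (integrable_zero _ _ _).integrableOn) (fun G hG _ => ?_) hΘm
    stronglyMeasurable_zero.aestronglyMeasurable
  obtain ⟨S, hS, hGS⟩ := exists_ae_eq_preimage_scaledPath hB hpos hG
  rw [setIntegral_congr_set hGS, setIntegral_eq_zero_of_forall_step hB hA hi hstep hS]
  simp

/-! ### Identification of the fractional Itô integral of a deterministic function -/

lemma wienerIntegral_memL2A [IsProbabilityMeasure P] (hB : IsTwoSidedBrownianMotion B P)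
    (hA : Measurable A) (hpos : ∀ᵐ ω ∂P, 0 < A ω) (hAB : IndepFun A (fun ω t => B t ω) P)
    (hA1 : Integrable A P) {g : ℝ → ℝ} (hg : MemLp g 2 volume) {G : Ω → ℝ}
    (hG : IsWienerIntegral B P g G) : MemL2A B A P fun ω => √(A ω) * G ω := by
  refine ⟨?_, memLp_sqrt_mul hA hpos hA1 (hG.hasLaw hB hg) (hG.indepFun hB hAB)⟩
  obtain ⟨G', hG'm, hG'e⟩ := hG.exists_measurable_iSup hB
  have h1 : Measurable[sigmaBA B A] A := (comap_measurable A).mono le_sup_right le_rfl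
  have h2 : Measurable[sigmaBA B A] G' := hG'm.mono le_sup_left le_rfl
  refine ⟨fun ω => √(A ω) * G' ω, (h1.sqrt.mul h2).stronglyMeasurable, ?_⟩
  filter_upwards [hG'e] with ω hω
  rw [hω]

lemma mem_testFunctions_of_small
    (hR : 0 < holomorphyRadius (laplace (P.map A))) :
    ∃ δ > 0, ∀ η : 𝓢(ℝ, ℝ), ∫ x, η x ^ 2 ≤ δ → η ∈ testFunctions A P := by
  obtain ⟨q, hq0, hqR⟩ := ENNReal.lt_iff_exists_real_btwn.1 hR
  have hq : 0 < q := by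
    by_contra h
    simp [ENNReal.ofReal_eq_zero.2 (not_lt.1 h)] at hqR
  refine ⟨q / 2, by positivity, fun η hη => ?_⟩
  refine lt_of_le_of_lt ?_ hqR.2
  rw [eLpNorm_two_eq (η.memLp 2 volume), ← ENNReal.ofReal_pow (by positivity),
    Real.sq_sqrt (by positivity), show (2 : ENNReal) = ENNReal.ofReal 2 by simp,
    ← ENNReal.ofReal_mul (by norm_num)]
  exact ENNReal.ofReal_le_ofReal (by linarith)

/-- A fractional Itô integral of a deterministic function is a scaled Wiener integral, as soon as
fractional integration by parts holds. -/
lemma IsFracItoIntegral.ae_eq [IsProbabilityMeasure P] {H : ℝ}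
    (hB : IsTwoSidedBrownianMotion B P)
    (hA : Measurable A) (hpos : ∀ᵐ ω ∂P, 0 < A ω) (hAB : IndepFun A (fun ω t => B t ω) P)
    (hR : 0 < holomorphyRadius (laplace (P.map A)))
    (hc : 0 < c) (hcA : Integrable (fun ω => Real.exp (c * A ω)) P)
    {M : Set ℝ} {ν : ℝ → ℝ} {Z : Ω → ℝ}
    (hZ : IsFracItoIntegral H B A P M (fun s _ => ν s) Z) {g : ℝ → ℝ} (hg : MemLp g 2 volume)
    (hparts : ∀ η : 𝓢(ℝ, ℝ), ∫ s in M, ν s * MPlus H η s = ∫ x, g x * η x)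
    {G : Ω → ℝ} (hG : IsWienerIntegral B P g G) :
    Z =ᵐ[P] fun ω => √(A ω) * G ω := by
  have hA2 := memLp_two_of_integrable_exp hA hpos hc hcA
  have hGm := wienerIntegral_memL2A hB hA hpos hAB (hA2.integrable one_le_two) hg hG
  obtain ⟨δ, hδ, hδt⟩ := mem_testFunctions_of_small hR
  have hΘ : MemL2A B A P (Z - fun ω => √(A ω) * G ω) :=
    ⟨hZ.mem.1.sub hGm.1, hZ.mem.2.sub hGm.2⟩
  -- The first bound keeps η in D_A. The second gives 2‖η‖₂² ≤ c, so that exp(√A I(η)) is square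
  -- integrable.
  have := ae_eq_zero_of_forall_integral_mul_exp hB hA hpos hAB hc hcA hΘ
    (δ := min δ (c / 2)) (by positivity) (by linarith [min_le_right δ (c / 2)]) ?_
  · filter_upwards [this] with ω hω
    simpa [sub_eq_zero] using hω
  intro η Y hY hη
  have hηL : MemLp η 2 volume := η.memLp 2 volume
  have hYI : IsWienerIntegral B P η (wienerIntegral B P η) := hB.isWienerIntegral hηL
  have hYe := hY.ae_eq hB hηL hYI
  have hηc : 2 * ∫ x, η x ^ 2 ≤ c := by linarith [hη.trans (min_le_right _ _)]
  have hexp : MemLp (fun ω => Real.exp (√(A ω) * wienerIntegral B P η ω)) 2 P := by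
    have h := memLp_exp_mul_sqrt hA hpos hcA (hYI.hasLaw hB hηL) (hYI.indepFun hB hAB) (s := 1)
      (by rw [Real.coe_toNNReal _ (by positivity)]; linarith)
    simpa using h
  have hD : 0 < ∫ ω, Real.exp (√(A ω) * wienerIntegral B P η ω) ∂P :=
    integral_exp_pos (hexp.integrable one_le_two)
  have hS : ∀ Φ : Ω → ℝ, STransform B A P Φ η =
      (∫ ω, Φ ω * Real.exp (√(A ω) * wienerIntegral B P η ω) ∂P) /
        ∫ ω, Real.exp (√(A ω) * wienerIntegral B P η ω) ∂P := by
    intro Φ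
    simp only [STransform, wickExp, ← mul_div_assoc]
    rw [integral_div]
  have h1 := hZ.eq η (hδt η (hη.trans (min_le_left _ _)))
  -- As ν is deterministic, S_A[A](η) factors out of the time integral. The same factor appears in
  -- the transform of √A I(g).
  have h2 : ∀ s, STransform B A P (fun ω => A ω * ν s) η * MPlus H η s =
      STransform B A P A η * (ν s * MPlus H η s) := by
    intro s
    rw [hS, hS]
    have : ∀ ω, A ω * ν s * Real.exp (√(A ω) * wienerIntegral B P η ω) =
        ν s * (A ω * Real.exp (√(A ω) * wienerIntegral B P η ω)) := fun ω => by ring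
    simp_rw [this]
    rw [integral_const_mul]
    ring
  simp_rw [h2] at h1
  rw [integral_const_mul, hparts η, hS, hS, div_mul_eq_mul_div, div_left_inj' hD.ne'] at h1
  have h3 := integral_sqrt_mul_wiener_mul_exp hB hA hpos hAB hc hcA hg hηL hηc hG hYI
  have h4 : ∫ ω, (Z - fun ω => √(A ω) * G ω) ω * Real.exp (√(A ω) * Y ω) ∂P =
      ∫ ω, (Z ω * Real.exp (√(A ω) * wienerIntegral B P η ω) -
        √(A ω) * G ω * Real.exp (√(A ω) * wienerIntegral B P η ω)) ∂P := by
    refine integral_congr_ae ?_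
    filter_upwards [hYe] with ω hω
    simp only [Pi.sub_apply, hω]
    ring
  have i1 : Integrable (fun ω => Z ω * Real.exp (√(A ω) * wienerIntegral B P η ω)) P :=
    hZ.mem.2.integrable_mul hexp
  have i2 : Integrable (fun ω => √(A ω) * G ω *
      Real.exp (√(A ω) * wienerIntegral B P η ω)) P := hGm.2.integrable_mul hexp
  rw [h4, integral_sub i1 i2, h1, h3, mul_comm, sub_self]

end RSFBM

namespace RSFBM

/-! ### Schwartz majorants of Schwartz functions -/

/-- The Weierstrass test in every Schwartz seminorm: derivatives may be taken termwise, and the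
weighted bounds add up. -/
lemma exists_schwartz_tsum {ι : Type*} (Φ : ι → 𝓢(ℝ, ℝ))
    (h : ∀ k m : ℕ, ∃ v : ι → ℝ, Summable v ∧
      ∀ i x, ‖x‖ ^ k * ‖iteratedFDeriv ℝ m (Φ i) x‖ ≤ v i) :
    ∃ g : 𝓢(ℝ, ℝ), ∀ x, HasSum (fun i => Φ i x) (g x) := by
  choose v hv hb using h
  have h1 : ∀ (k : ℕ) (i : ι) (x : ℝ), (k : ℕ∞) ≤ ⊤ →
      ‖iteratedFDeriv ℝ k (Φ i) x‖ ≤ v 0 k i := fun k i x _ => by simpa using hb 0 k i x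
  refine ⟨⟨fun x => ∑' i, Φ i x, contDiff_tsum (fun i => (Φ i).smooth ⊤) (fun k _ => hv 0 k) h1,
    fun k m => ⟨∑' i, v k m i, fun x => ?_⟩⟩, fun x =>
      (Summable.of_norm_bounded (hv 0 0) fun i => by simpa using hb 0 0 i x).hasSum⟩
  rw [iteratedFDeriv_tsum_apply (fun i => (Φ i).smooth ⊤) (fun k _ => hv 0 k) h1 le_top]
  have hs : Summable fun i => ‖iteratedFDeriv ℝ m (Φ i) x‖ :=
    Summable.of_nonneg_of_le (fun _ => norm_nonneg _) (fun i => h1 m i x le_top) (hv 0 m)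
  calc ‖x‖ ^ k * ‖∑' i, iteratedFDeriv ℝ m (Φ i) x‖
      ≤ ‖x‖ ^ k * ∑' i, ‖iteratedFDeriv ℝ m (Φ i) x‖ := by
        gcongr
        exact norm_tsum_le_tsum_norm hs
    _ = ∑' i, ‖x‖ ^ k * ‖iteratedFDeriv ℝ m (Φ i) x‖ := tsum_mul_left.symm
    _ ≤ ∑' i, v k m i := (hs.mul_left _).tsum_le_tsum (fun i => hb k m i x) (hv k m)

lemma summable_one_div_one_add_abs_sq :
    Summable fun n : ℤ => 1 / (1 + |(n : ℝ)|) ^ 2 := by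
  have h1 : Summable fun n : ℤ => 1 / (n : ℝ) ^ 2 + if n = 0 then (1 : ℝ) else 0 :=
    (Real.summable_one_div_int_pow.2 one_lt_two).add
      (summable_of_hasFiniteSupport ((finite_singleton 0).subset fun n hn => by
        by_contra h; simp_all))
  refine Summable.of_nonneg_of_le (fun n => by positivity) (fun n => ?_) h1
  by_cases hn : n = 0
  · simp [hn]
  · simp only [hn, if_false, add_zero]
    have : 0 < |(n : ℝ)| := by positivity
    rw [← sq_abs (n : ℝ)]
    gcongr
    linarith

/-- Every Schwartz function is dominated by a nonnegative Schwartz function. -/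
lemma exists_schwartz_majorant (f : 𝓢(ℝ, ℂ)) :
    ∃ g : 𝓢(ℝ, ℝ), ∀ x, ‖f x‖ ≤ g x := by
  -- The majorant is Σ_n m_n b(x - n), with m_n the maximum of ‖f‖ on [n - 1, n + 1], attained at `y
  -- n`. The bump is 1 on [-1, 1], so the term n = round x alone dominates ‖f x‖, and the other
  -- terms are nonnegative.
  let b : ContDiffBump (0 : ℝ) := ⟨1, 2, one_pos, one_lt_two⟩
  let ψ : 𝓢(ℝ, ℝ) := b.hasCompactSupport.toSchwartzMap b.contDiff
  have hψ : ∀ x, ψ x = b x := fun x => rfl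
  have hy : ∀ n : ℤ, ∃ y ∈ Icc ((n : ℝ) - 1) (n + 1), ∀ z ∈ Icc ((n : ℝ) - 1) (n + 1),
      ‖f z‖ ≤ ‖f y‖ := by
    intro n
    obtain ⟨y, hy, hm⟩ := (isCompact_Icc (a := (n : ℝ) - 1) (b := n + 1)).exists_isMaxOn
      ⟨n, by simp⟩ f.continuous.norm.continuousOn
    exact ⟨y, hy, fun z hz => hm hz⟩
  choose y hyI hymax using hy
  have hbound : ∀ (F : Type) [NormedAddCommGroup F] [NormedSpace ℝ F] (h : 𝓢(ℝ, F)) (k m : ℕ),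
      ∃ C : ℝ, 0 ≤ C ∧ ∀ x, (1 + |x|) ^ k * ‖iteratedFDeriv ℝ m h x‖ ≤ C := by
    intro F _ _ h k m
    refine ⟨2 ^ k * (Finset.Iic (k, m)).sup (fun m => SchwartzMap.seminorm ℝ m.1 m.2) h,
      by positivity, fun x => ?_⟩
    exact SchwartzMap.one_add_le_sup_seminorm_apply (𝕜 := ℝ) (m := (k, m)) le_rfl le_rfl h x
  let Φ : ℤ → 𝓢(ℝ, ℝ) := fun n => ‖f (y n)‖ • SchwartzMap.compSubConstCLM ℝ (n : ℝ) ψ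
  have hΦ : ∀ n x, Φ n x = ‖f (y n)‖ * ψ (x - n) := fun n x => rfl
  obtain ⟨g, hg⟩ := exists_schwartz_tsum Φ (by
    intro k m
    obtain ⟨C, hC0, hC⟩ := hbound ℝ ψ k m
    -- Decay of order k + 2: the power k absorbs the weight ‖x‖^k, and the remaining two make the
    -- sum over n converge.
    obtain ⟨D, hD0, hD⟩ := hbound ℂ f (k + 2) 0
    refine ⟨fun n => 2 ^ (k + 2) * D * C * (1 / (1 + |(n : ℝ)|) ^ 2),
      summable_one_div_one_add_abs_sq.mul_left _, fun n x => ?_⟩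
    have h1 : ‖iteratedFDeriv ℝ m (Φ n) x‖ = ‖f (y n)‖ * ‖iteratedFDeriv ℝ m ψ (x - n)‖ := by
      have : (Φ n : ℝ → ℝ) = ‖f (y n)‖ • fun x => ψ (x - n) := by ext x; simp [hΦ]
      rw [this, iteratedFDeriv_const_smul_apply, iteratedFDeriv_comp_sub, norm_smul, norm_norm]
      exact ((ψ.smooth m).comp (contDiff_id.sub contDiff_const)).contDiffAt
    have h2 : ‖x‖ ≤ (1 + |(n : ℝ)|) * (1 + |x - n|) := by
      have := abs_add_le (n : ℝ) (x - n)
      rw [add_sub_cancel] at this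
      rw [Real.norm_eq_abs]
      nlinarith [abs_nonneg (n : ℝ), abs_nonneg (x - n)]
    have h3 : 1 + |(n : ℝ)| ≤ 2 * (1 + |y n|) := by
      have := abs_sub_abs_le_abs_sub (n : ℝ) (y n)
      have h4 : |(n : ℝ) - y n| ≤ 1 := by
        rw [abs_le]; constructor <;> linarith [(hyI n).1, (hyI n).2]
      linarith [abs_nonneg (y n)]
    have h5 := hD (y n)
    rw [norm_iteratedFDeriv_zero] at h5
    have h6 : (1 + |(n : ℝ)|) ^ (k + 2) * ‖f (y n)‖ ≤ 2 ^ (k + 2) * D := by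
      calc (1 + |(n : ℝ)|) ^ (k + 2) * ‖f (y n)‖
          ≤ (2 * (1 + |y n|)) ^ (k + 2) * ‖f (y n)‖ := by gcongr
        _ = 2 ^ (k + 2) * ((1 + |y n|) ^ (k + 2) * ‖f (y n)‖) := by rw [mul_pow]; ring
        _ ≤ _ := by gcongr
    have h7 := hC (x - n)
    beta_reduce
    rw [h1, mul_one_div, le_div_iff₀ (by positivity)]
    calc ‖x‖ ^ k * (‖f (y n)‖ * ‖iteratedFDeriv ℝ m ψ (x - n)‖) * (1 + |(n : ℝ)|) ^ 2
        ≤ ((1 + |(n : ℝ)|) * (1 + |x - n|)) ^ k *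
          (‖f (y n)‖ * ‖iteratedFDeriv ℝ m ψ (x - n)‖) * (1 + |(n : ℝ)|) ^ 2 := by gcongr
      _ = ((1 + |(n : ℝ)|) ^ (k + 2) * ‖f (y n)‖) *
          ((1 + |x - n|) ^ k * ‖iteratedFDeriv ℝ m ψ (x - n)‖) := by rw [mul_pow]; ring
      _ ≤ 2 ^ (k + 2) * D * C := by gcongr)
  refine ⟨g, fun x => ?_⟩
  have hx := abs_sub_round x
  have h1 : x ∈ Icc ((round x : ℝ) - 1) (round x + 1) := by
    rw [abs_le] at hx
    constructor <;> linarith [hx.1, hx.2]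
  have h2 : ψ (x - round x) = 1 := by
    rw [hψ]
    refine b.one_of_mem_closedBall ?_
    rw [mem_closedBall_zero_iff, Real.norm_eq_abs]
    exact hx.trans (by norm_num [b])
  have h3 := le_hasSum (hg x) (round x) fun n _ => by
    rw [hΦ, hψ]
    exact mul_nonneg (norm_nonneg _) b.nonneg
  rw [hΦ, h2, mul_one] at h3
  exact (hymax _ x h1).trans h3

end RSFBM

namespace RSFBM

/-! ### Fourier representation of averaged translates -/

open FourierTransform in
/-- The Fourier transform of a real Schwartz function, in the normalization of `psiDO`. -/
lemma exists_schwartz_fourier (u : 𝓢(ℝ, ℝ)) :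
    ∃ U : 𝓢(ℝ, ℂ), (∀ ξ : ℝ, U ξ = ∫ q : ℝ, Complex.exp (-(Complex.I * (q * ξ))) * (u q : ℂ)) ∧
      ∀ x : ℝ, (u x : ℂ) =
        1 / (2 * Real.pi) * ∫ ξ : ℝ, Complex.exp (Complex.I * (x * ξ)) * U ξ := by
  have hπ : (2 * Real.pi)⁻¹ ≠ 0 := by positivity
  let f : 𝓢(ℝ, ℂ) := SchwartzMap.postcompCLM Complex.ofRealCLM u
  have hf : ∀ x, f x = u x := fun x => rfl
  -- The transform `𝓕` uses exp(-2πi qξ), so rescaling the frequency by 1/(2π) gives the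
  -- normalization exp(-i qξ).
  let U : 𝓢(ℝ, ℂ) := SchwartzMap.compCLMOfContinuousLinearEquiv ℝ
    (ContinuousLinearEquiv.unitsEquivAut ℝ (Units.mk0 _ hπ)) (𝓕 f)
  have hU : ∀ ξ, U ξ = 𝓕 f (ξ * (2 * Real.pi)⁻¹) := fun ξ => rfl
  refine ⟨U, fun ξ => ?_, fun x => ?_⟩
  · rw [hU, SchwartzMap.fourier_coe, Real.fourier_real_eq_integral_exp_smul]
    refine integral_congr_ae (ae_of_all _ fun q => ?_)
    simp only [hf, smul_eq_mul]
    congr 2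
    push_cast
    have : (Real.pi : ℂ) ≠ 0 := by exact_mod_cast Real.pi_ne_zero
    field_simp
  · have h1 : f x = 𝓕⁻ (𝓕 f) x := by rw [fourierInv_fourier_eq]
    rw [← hf, h1, SchwartzMap.fourierInv_coe, Real.fourierInv_eq']
    have h2 := Measure.integral_comp_mul_left
      (fun ξ : ℝ => Complex.exp (Complex.I * (x * ξ)) * U ξ) (2 * Real.pi)
    rw [abs_of_pos (by positivity)] at h2
    have h3 : (1 / (2 * Real.pi) : ℂ) = ((2 * Real.pi)⁻¹ : ℝ) := by push_cast; simp
    rw [h3, ← Complex.real_smul, ← h2]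
    refine integral_congr_ae (ae_of_all _ fun q => ?_)
    simp only [hU, smul_eq_mul]
    have h4 : 2 * Real.pi * q * (2 * Real.pi)⁻¹ = q := by field_simp
    rw [h4]
    congr 2
    simp
    ring

variable {μ : Measure ℝ} [IsProbabilityMeasure μ]

lemma integrable_schwartz_add (u : 𝓢(ℝ, ℝ)) (x : ℝ) : Integrable (fun z => u (x + z)) μ := by
  obtain ⟨C, hC⟩ := u.decay 0 0
  refine Integrable.of_bound (u.continuous.comp (continuous_const.add continuous_id)
    |>.aestronglyMeasurable) C (ae_of_all _ fun z => ?_)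
  simpa using hC.2 (x + z)

lemma integrable_prod_add (u : 𝓢(ℝ, ℝ)) :
    Integrable (fun p : ℝ × ℝ => u (p.1 + p.2)) ((volume : Measure ℝ).prod μ) := by
  have hm : AEStronglyMeasurable (fun p : ℝ × ℝ => u (p.1 + p.2)) ((volume : Measure ℝ).prod μ) :=
    (u.continuous.comp (continuous_fst.add continuous_snd)).aestronglyMeasurable
  rw [integrable_prod_iff' hm]
  refine ⟨ae_of_all _ fun z => u.integrable.comp_add_right z, ?_⟩
  have : (fun z : ℝ => ∫ x, ‖u (x + z)‖) = fun _ => ∫ x, ‖u x‖ :=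
    funext fun z => integral_add_right_eq_self (fun x => ‖u x‖) z
  simp only [this]
  exact integrable_const _

lemma integrable_integral_add (u : 𝓢(ℝ, ℝ)) : Integrable fun x => ∫ z, u (x + z) ∂μ :=
  (integrable_prod_add u).integral_prod_left

lemma norm_cexp_I_mul_ofReal_mul (x ξ : ℝ) : ‖Complex.exp (Complex.I * (x * ξ))‖ = 1 := by
  rw [mul_comm, ← Complex.ofReal_mul, Complex.norm_exp_ofReal_mul_I]

lemma norm_cexp_neg_I_mul_ofReal_mul (x ξ : ℝ) :
    ‖Complex.exp (-(Complex.I * (x * ξ)))‖ = 1 := by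
  have := norm_cexp_I_mul_ofReal_mul (-x) ξ
  rwa [Complex.ofReal_neg, neg_mul, mul_neg] at this

/-- A translate by z has Fourier transform exp(izξ) U(ξ); averaging over z produces the
characteristic function. -/
lemma integral_cexp_mul_integral_add (u : 𝓢(ℝ, ℝ)) {U : ℝ → ℂ}
    (hU : ∀ ξ : ℝ, U ξ = ∫ q : ℝ, Complex.exp (-(Complex.I * (q * ξ))) * (u q : ℂ)) (ξ : ℝ) :
    ∫ q : ℝ, Complex.exp (-(Complex.I * (q * ξ))) * ((∫ z, u (q + z) ∂μ : ℝ) : ℂ) =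
      charFun μ ξ * U ξ := by
  have h1 : ∀ q : ℝ, Complex.exp (-(Complex.I * (q * ξ))) * ((∫ z, u (q + z) ∂μ : ℝ) : ℂ) =
      ∫ z, Complex.exp (-(Complex.I * (q * ξ))) * (u (q + z) : ℂ) ∂μ := fun q => by
    rw [integral_const_mul, integral_complex_ofReal]
  simp_rw [h1]
  rw [integral_integral_swap]
  · rw [charFun_apply_real, ← integral_mul_const]
    refine integral_congr_ae (ae_of_all _ fun z => ?_)
    have h2 := integral_add_right_eq_self (μ := (volume : Measure ℝ))
      (fun q : ℝ => Complex.exp (-(Complex.I * ((q - z : ℝ) * ξ))) * (u q : ℂ)) z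
    simp only [add_sub_cancel_right] at h2
    beta_reduce
    rw [h2, hU, ← integral_const_mul]
    refine integral_congr_ae (ae_of_all _ fun q => ?_)
    beta_reduce
    rw [← mul_assoc (Complex.exp _), ← Complex.exp_add]
    congr 2
    push_cast
    ring
  · refine ((integrable_prod_add (μ := μ) u).ofReal (𝕜 := ℂ)).bdd_mul (c := 1) ?_ ?_
    · exact (by fun_prop : Continuous fun p : ℝ × ℝ =>
        Complex.exp (-(Complex.I * (p.1 * ξ)))).aestronglyMeasurable
    · exact ae_of_all _ fun p => (norm_cexp_neg_I_mul_ofReal_mul _ _).le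

lemma ofReal_integral_add_eq (u : 𝓢(ℝ, ℝ)) {U : 𝓢(ℝ, ℂ)}
    (hU : ∀ x : ℝ, (u x : ℂ) =
        1 / (2 * Real.pi) * ∫ ξ : ℝ, Complex.exp (Complex.I * (x * ξ)) * U ξ) (x : ℝ) :
    ((∫ z, u (x + z) ∂μ : ℝ) : ℂ) =
      1 / (2 * Real.pi) * ∫ ξ : ℝ, Complex.exp (Complex.I * (x * ξ)) * (charFun μ ξ * U ξ) := by
  rw [← integral_complex_ofReal]
  simp_rw [hU]
  rw [integral_const_mul, integral_integral_swap]
  · congr 1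
    refine integral_congr_ae (ae_of_all _ fun ξ => ?_)
    beta_reduce
    rw [charFun_apply_real, ← integral_mul_const, ← integral_const_mul]
    refine integral_congr_ae (ae_of_all _ fun z => ?_)
    beta_reduce
    rw [← mul_assoc (Complex.exp _), ← Complex.exp_add]
    congr 2
    push_cast
    ring
  · refine (U.integrable.comp_snd μ).bdd_mul (c := 1) ?_ ?_
    · exact (by fun_prop : Continuous fun p : ℝ × ℝ =>
        Complex.exp (Complex.I * (((x + p.1 : ℝ) : ℂ) * p.2))).aestronglyMeasurable
    · exact ae_of_all _ fun p => (norm_cexp_I_mul_ofReal_mul _ _).le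

lemma psiDO_integral_add (u : 𝓢(ℝ, ℝ)) {U : ℝ → ℂ}
    (hU : ∀ ξ : ℝ, U ξ = ∫ q : ℝ, Complex.exp (-(Complex.I * (q * ξ))) * (u q : ℂ))
    (m : ℝ → ℝ) (x : ℝ) :
    psiDO m (fun x => ∫ z, u (x + z) ∂μ) x =
      1 / (2 * Real.pi) *
        ∫ ξ : ℝ, Complex.exp (Complex.I * (x * ξ)) * ((m ξ : ℂ) * (charFun μ ξ * U ξ)) := by
  rw [psiDO]
  congr 1
  refine integral_congr_ae (ae_of_all _ fun ξ => ?_)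
  beta_reduce
  rw [← integral_cexp_mul_integral_add u hU, ← integral_const_mul, ← integral_const_mul]
  refine integral_congr_ae (ae_of_all _ fun q => ?_)
  beta_reduce
  have : Complex.exp (Complex.I * ((x - q) * ξ)) =
      Complex.exp (Complex.I * (x * ξ)) * Complex.exp (-(Complex.I * (q * ξ))) := by
    rw [← Complex.exp_add]
    congr 1
    ring
  rw [this]
  ring

lemma psiDODefined_integral_add (u : 𝓢(ℝ, ℝ)) {U : ℝ → ℂ}
    (hU : ∀ ξ : ℝ, U ξ = ∫ q : ℝ, Complex.exp (-(Complex.I * (q * ξ))) * (u q : ℂ))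
    {m : ℝ → ℝ} (hm : Integrable fun ξ => (m ξ : ℂ) * U ξ) :
    PsiDODefined m (fun x => ∫ z, u (x + z) ∂μ) := by
  refine ⟨integrable_integral_add u, ?_⟩
  simp_rw [integral_cexp_mul_integral_add u hU]
  have h1 : Integrable fun ξ => charFun μ ξ * ((m ξ : ℂ) * U ξ) :=
    hm.bdd_mul (c := 1) (stronglyMeasurable_charFun.aestronglyMeasurable)
      (ae_of_all _ fun ξ => norm_charFun_le_one _)
  exact h1.congr (ae_of_all _ fun ξ => by ring)

lemma hasDerivAt_integral_add (u : 𝓢(ℝ, ℝ)) (x : ℝ) :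
    HasDerivAt (fun x => ∫ z, u (x + z) ∂μ)
      (∫ z, SchwartzMap.derivCLM ℝ ℝ u (x + z) ∂μ) x := by
  obtain ⟨C, hC⟩ := (SchwartzMap.derivCLM ℝ ℝ u).decay 0 0
  refine (hasDerivAt_integral_of_dominated_loc_of_deriv_le (bound := fun _ => C) univ_mem
    (Eventually.of_forall fun x => (integrable_schwartz_add u x).1)
    (integrable_schwartz_add u x) (F' := fun x z => SchwartzMap.derivCLM ℝ ℝ u (x + z))
    (integrable_schwartz_add _ x).1 (ae_of_all _ fun z y _ => ?_) (integrable_const _)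
    (ae_of_all _ fun z y _ => ?_)).2
  · simpa using hC.2 (y + z)
  · rw [SchwartzMap.derivCLM_apply]
    exact (u.differentiableAt.hasDerivAt).comp_add_const y z

/-- The derivative is an average of translates of u', which is again Schwartz, so induction on the
order applies. -/
lemma contDiff_integral_add (u : 𝓢(ℝ, ℝ)) :
    ContDiff ℝ (⊤ : ℕ∞) fun x => ∫ z, u (x + z) ∂μ := by
  rw [contDiff_infty]
  intro n
  induction n generalizing u with
  | zero =>
    exact contDiff_zero.2 (continuous_iff_continuousAt.2 fun x =>
      (hasDerivAt_integral_add u x).continuousAt)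
  | succ n ih =>
    push_cast
    rw [contDiff_succ_iff_deriv]
    refine ⟨fun x => (hasDerivAt_integral_add u x).differentiableAt, by simp, ?_⟩
    rw [funext fun x => (hasDerivAt_integral_add (μ := μ) u x).deriv]
    exact ih _

end RSFBM

namespace RSFBM

/-! ### Laplace transforms of measures on the half-line -/

section laplace

variable {μ : Measure ℝ}

lemma laplace_nonneg (t : ℝ) : 0 ≤ laplace μ t := integral_nonneg fun _ => (Real.exp_pos _).le

variable [IsProbabilityMeasure μ]

lemma laplace_le_one (hμ : ∀ᵐ x ∂μ, 0 < x) {t : ℝ} (ht : 0 ≤ t) : laplace μ t ≤ 1 := by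
  have h : ∫ x, Real.exp (-(t * x)) ∂μ ≤ ∫ _, (1 : ℝ) ∂μ := by
    refine integral_mono_of_nonneg (ae_of_all _ fun x => (Real.exp_pos _).le)
      (integrable_const _) ?_
    filter_upwards [hμ] with x hx
    exact Real.exp_le_one_iff.2 (neg_nonpos.2 (mul_nonneg ht hx.le))
  simpa [laplace] using h

lemma measurable_laplace : Measurable (laplace μ) := by
  have h : StronglyMeasurable fun p : ℝ × ℝ => Real.exp (-(p.1 * p.2)) :=
    (by fun_prop : Continuous fun p : ℝ × ℝ => Real.exp (-(p.1 * p.2))).stronglyMeasurable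
  exact (h.integral_prod_right (ν := μ)).measurable

end laplace

/-! ### The evolution equation in Fourier variables -/

lemma IsTemperedFunction.integrable_mul {g : ℝ → ℝ} (h : IsTemperedFunction g) (f : 𝓢(ℝ, ℂ)) :
    Integrable fun ξ => (g ξ : ℂ) * f ξ := by
  obtain ⟨T, hT⟩ := h
  exact (hT f).1

lemma IsTemperedFunction.integrable_mul_real {g : ℝ → ℝ} (h : IsTemperedFunction g)
    (f : 𝓢(ℝ, ℝ)) : Integrable fun ξ => g ξ * f ξ := by
  have h1 := (h.integrable_mul (SchwartzMap.postcompCLM Complex.ofRealCLM f)).re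
  refine h1.congr (ae_of_all _ fun ξ => ?_)
  change ((g ξ : ℂ) * (f ξ : ℂ)).re = _
  simp

/-- The integrability in time is assumed against real Schwartz functions, while |U| need not be
smooth. A Schwartz majorant of |U| bridges the gap. -/
lemma integrable_prod_kernel {k : ℝ → ℝ → ℝ} {T : ℝ}
    (hk : AEStronglyMeasurable (fun p : ℝ × ℝ => k p.1 p.2)
      ((volume.restrict (Ioo 0 T)).prod volume))
    (htemp : ∀ r ∈ Ioo 0 T, IsTemperedFunction fun ξ => |k r ξ|)
    (hint : ∀ f : 𝓢(ℝ, ℝ), IntegrableOn (fun r => ∫ ξ, |k r ξ| * f ξ) (Ioo 0 T))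
    (U : 𝓢(ℝ, ℂ)) :
    Integrable (fun p : ℝ × ℝ => (k p.1 p.2 : ℂ) * U p.2)
      ((volume.restrict (Ioo 0 T)).prod volume) := by
  obtain ⟨g, hg⟩ := exists_schwartz_majorant U
  have hm : AEStronglyMeasurable (fun p : ℝ × ℝ => (k p.1 p.2 : ℂ) * U p.2)
      ((volume.restrict (Ioo 0 T)).prod volume) :=
    (Complex.continuous_ofReal.comp_aestronglyMeasurable hk).mul
      (U.continuous.comp continuous_snd).aestronglyMeasurable
  have hle : ∀ r ξ, ‖(k r ξ : ℂ) * U ξ‖ ≤ |k r ξ| * g ξ := fun r ξ => by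
    rw [norm_mul, Complex.norm_real, Real.norm_eq_abs]
    exact mul_le_mul_of_nonneg_left (hg ξ) (abs_nonneg _)
  have hmem : ∀ᵐ r ∂volume.restrict (Ioo 0 T), r ∈ Ioo 0 T := ae_restrict_mem measurableSet_Ioo
  rw [integrable_prod_iff hm]
  have h1 : ∀ᵐ r ∂volume.restrict (Ioo 0 T), Integrable fun ξ => (k r ξ : ℂ) * U ξ := by
    filter_upwards [hmem, hm.prodMk_left] with r hr hmr
    exact ((htemp r hr).integrable_mul_real g).mono' hmr (ae_of_all _ fun ξ => hle r ξ)
  refine ⟨h1, (hint g).mono' hm.norm.integral_prod_right' ?_⟩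
  filter_upwards [hmem, h1] with r hr h1r
  rw [Real.norm_of_nonneg (integral_nonneg fun _ => norm_nonneg _)]
  exact integral_mono h1r.norm ((htemp r hr).integrable_mul_real g) fun ξ => hle r ξ

/-- Here k(r,ξ) = K_{T,r}(ξ²/2) and φ(r,ξ) = L[A](r^{2H} ξ²/2). Since |φ| ≤ 1, Fubini exchanges the
r and ξ integrals, and the kernel identity evaluates the inner one. -/
lemma kernel_evolution {k φ : ℝ → ℝ → ℝ} {T : ℝ} (hT : 0 < T)
    (hk : AEStronglyMeasurable (fun p : ℝ × ℝ => k p.1 p.2)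
      ((volume.restrict (Ioo 0 T)).prod volume))
    (htemp : ∀ r ∈ Ioo 0 T, IsTemperedFunction fun ξ => |k r ξ|)
    (hint : ∀ f : 𝓢(ℝ, ℝ), IntegrableOn (fun r => ∫ ξ, |k r ξ| * f ξ) (Ioo 0 T))
    (hφm : Measurable fun p : ℝ × ℝ => φ p.1 p.2) (hφ : ∀ r ξ, 0 < r → |φ r ξ| ≤ 1)
    (heq : ∀ ξ ≠ 0, φ T ξ = 1 + ∫ r in Ioo 0 T, k r ξ * φ r ξ) (U : 𝓢(ℝ, ℂ)) (x : ℝ) :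
    IntegrableOn (fun r => (1 / (2 * Real.pi) : ℂ) *
        ∫ ξ : ℝ, Complex.exp (Complex.I * (x * ξ)) * ((k r ξ : ℂ) * ((φ r ξ : ℂ) * U ξ)))
      (Ioo 0 T) ∧
    ∫ r in Ioo 0 T, (1 / (2 * Real.pi) : ℂ) *
        ∫ ξ : ℝ, Complex.exp (Complex.I * (x * ξ)) * ((k r ξ : ℂ) * ((φ r ξ : ℂ) * U ξ)) =
      1 / (2 * Real.pi) * (∫ ξ : ℝ, Complex.exp (Complex.I * (x * ξ)) * ((φ T ξ : ℂ) * U ξ)) -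
      1 / (2 * Real.pi) * ∫ ξ : ℝ, Complex.exp (Complex.I * (x * ξ)) * U ξ := by
  have hmem : ∀ᵐ p ∂((volume.restrict (Ioo 0 T)).prod (volume : Measure ℝ)), p.1 ∈ Ioo 0 T :=
    Measure.quasiMeasurePreserving_fst.ae (ae_restrict_mem measurableSet_Ioo)
  have h0 : Integrable (fun p : ℝ × ℝ => Complex.exp (Complex.I * (x * p.2)) *
      ((k p.1 p.2 : ℂ) * ((φ p.1 p.2 : ℂ) * U p.2))) ((volume.restrict (Ioo 0 T)).prod volume) := by
    have h1 : Integrable (fun p : ℝ × ℝ => (Complex.exp (Complex.I * (x * p.2)) * (φ p.1 p.2 : ℂ)) *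
        ((k p.1 p.2 : ℂ) * U p.2)) ((volume.restrict (Ioo 0 T)).prod volume) := by
      refine (integrable_prod_kernel hk htemp hint U).bdd_mul (c := 1) ?_ ?_
      · exact ((by fun_prop : Continuous fun p : ℝ × ℝ =>
          Complex.exp (Complex.I * (x * p.2))).measurable.mul
          (Complex.measurable_ofReal.comp hφm)).aestronglyMeasurable
      · filter_upwards [hmem] with p hp
        rw [norm_mul, norm_cexp_I_mul_ofReal_mul, one_mul, Complex.norm_real]
        exact hφ _ _ hp.1
    exact h1.congr (ae_of_all _ fun p => by ring)
  refine ⟨h0.integral_prod_left.const_mul _, ?_⟩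
  have hUint : Integrable fun ξ : ℝ => Complex.exp (Complex.I * (x * ξ)) * U ξ :=
    U.integrable.bdd_mul (c := 1) (by fun_prop : Continuous fun ξ : ℝ =>
      Complex.exp (Complex.I * (x * ξ))).aestronglyMeasurable
      (ae_of_all _ fun ξ => (norm_cexp_I_mul_ofReal_mul _ _).le)
  have hφU : Integrable fun ξ : ℝ => Complex.exp (Complex.I * (x * ξ)) * ((φ T ξ : ℂ) * U ξ) := by
    have hm : Measurable fun ξ : ℝ => (φ T ξ : ℂ) :=
      Complex.measurable_ofReal.comp (hφm.comp (measurable_const.prodMk measurable_id))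
    have h1 : Integrable fun ξ : ℝ => (φ T ξ : ℂ) * (Complex.exp (Complex.I * (x * ξ)) * U ξ) :=
      hUint.bdd_mul (c := 1) hm.aestronglyMeasurable
        (ae_of_all _ fun ξ => by simpa using hφ T ξ hT)
    exact h1.congr (ae_of_all _ fun p => by ring)
  rw [integral_const_mul, integral_integral_swap h0, ← mul_sub, ← integral_sub hφU hUint]
  congr 1
  refine integral_congr_ae ?_
  -- The kernel identity holds for positive ξ²/2 only; ξ = 0 is a null set.
  filter_upwards [Measure.ae_ne volume (0 : ℝ)] with ξ hξ
  have h2 : ∀ r : ℝ, Complex.exp (Complex.I * (x * ξ)) * ((k r ξ : ℂ) * ((φ r ξ : ℂ) * U ξ)) =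
      (Complex.exp (Complex.I * (x * ξ)) * U ξ) * ((k r ξ * φ r ξ : ℝ) : ℂ) := fun r => by
    push_cast; ring
  simp_rw [h2]
  rw [integral_const_mul, integral_complex_ofReal, heq ξ hξ]
  push_cast
  ring

/-! ### Change of variables along a nondecreasing time change -/

/-- Injectivity is not needed: on plateaus of σ the derivative vanishes. The image of (0,t) is (0, σ
t) up to the end points, which a plateau may add. -/
lemma integral_deriv_smul_comp_of_monotoneOn {σ : ℝ → ℝ} {t : ℝ} (ht : 0 < t) (h0 : σ 0 = 0)
    (hmono : MonotoneOn σ (Icc 0 t)) (hcont : ContinuousOn σ (Icc 0 t))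
    (hdiff : ∀ s ∈ Ioo 0 t, DifferentiableAt ℝ σ s) {Ψ : ℝ → ℂ}
    (hΨ : IntegrableOn Ψ (Ioo 0 (σ t))) :
    IntegrableOn (fun s => deriv σ s • Ψ (σ s)) (Ioo 0 t) ∧
      ∫ s in Ioo 0 t, deriv σ s • Ψ (σ s) = ∫ r in Ioo 0 (σ t), Ψ r := by
  have hd : ∀ s ∈ Ioo 0 t, HasDerivWithinAt σ (deriv σ s) (Ioo 0 t) s := fun s hs =>
    (hdiff s hs).hasDerivAt.hasDerivWithinAt
  have hm : MonotoneOn σ (Ioo 0 t) := hmono.mono Ioo_subset_Icc_self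
  have h1 : Ioo 0 (σ t) ⊆ σ '' Ioo 0 t := by
    have := intermediate_value_Ioo ht.le hcont
    rwa [h0] at this
  have h2 : σ '' Ioo 0 t ⊆ Icc 0 (σ t) := by
    rintro _ ⟨s, hs, rfl⟩
    have h3 := hmono (left_mem_Icc.2 ht.le) (Ioo_subset_Icc_self hs) hs.1.le
    rw [h0] at h3
    exact ⟨h3, hmono (Ioo_subset_Icc_self hs) (right_mem_Icc.2 ht.le) hs.2.le⟩
  have h3 : (σ '' Ioo 0 t : Set ℝ) =ᵐ[volume] Ioo 0 (σ t) :=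
    (h2.eventuallyLE.trans (Ioo_ae_eq_Icc (a := (0 : ℝ)) (b := σ t)).symm.le).antisymm
      h1.eventuallyLE
  rw [← integral_image_eq_integral_deriv_smul_of_monotoneOn measurableSet_Ioo hd hm,
    ← integrableOn_image_iff_integrableOn_deriv_smul_of_monotoneOn measurableSet_Ioo hd hm]
  exact ⟨hΨ.congr_set_ae h3, setIntegral_congr_set h3⟩

end RSFBM

namespace RSFBM

/-! ### Powers of the positive part -/

/-- The power `x₊ ^ e` of the positive part of `x`. -/
noncomputable def posPow (e x : ℝ) : ℝ := max x 0 ^ e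

lemma posPow_of_pos {e x : ℝ} (hx : 0 < x) : posPow e x = x ^ e := by
  rw [posPow, max_eq_left hx.le]

lemma posPow_of_nonpos {e x : ℝ} (he : e ≠ 0) (hx : x ≤ 0) : posPow e x = 0 := by
  rw [posPow, max_eq_right hx, Real.zero_rpow he]

lemma posPow_nonneg (e x : ℝ) : 0 ≤ posPow e x := Real.rpow_nonneg (le_max_right _ _) _

@[fun_prop]
lemma measurable_posPow (e : ℝ) : Measurable (posPow e) :=
  (measurable_id.max measurable_const).pow_const e

lemma posPow_mul {c : ℝ} (hc : 0 ≤ c) (e x : ℝ) : posPow e (c * x) = c ^ e * posPow e x := by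
  rw [posPow, posPow, ← Real.mul_rpow hc (le_max_right _ _), mul_max_of_nonneg _ _ hc, mul_zero]

lemma integrableOn_rpow_Ioc {e : ℝ} (he : -1 < e) (b : ℝ) :
    IntegrableOn (fun r : ℝ => r ^ e) (Ioc 0 b) := by
  rcases le_total b 0 with hb | hb
  · rw [Ioc_eq_empty hb.not_gt]
    exact integrableOn_empty
  · exact (intervalIntegrable_iff_integrableOn_Ioc_of_le hb).1
      (intervalIntegral.intervalIntegrable_rpow' he)

lemma integrableOn_rpow_div_one_add_sq {e : ℝ} (he : -1 < e) (he0 : e < 0) :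
    IntegrableOn (fun r : ℝ => r ^ e / (1 + r) ^ 2) (Ioi 0) := by
  have hm : Measurable fun r : ℝ => r ^ e / (1 + r) ^ 2 := by fun_prop
  rw [← Ioc_union_Ioi_eq_Ioi zero_le_one]
  refine IntegrableOn.union ?_ ?_
  · refine (integrableOn_rpow_Ioc he 1).mono' hm.aestronglyMeasurable ?_
    filter_upwards [ae_restrict_mem measurableSet_Ioc] with r hr
    have h0 := Real.rpow_nonneg hr.1.le e
    rw [Real.norm_of_nonneg (by positivity)]
    exact div_le_self h0 (one_le_pow₀ (by linarith [hr.1]))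
  · refine (integrableOn_Ioi_rpow_of_lt (by norm_num : (-2 : ℝ) < -1) one_pos).mono'
      hm.aestronglyMeasurable ?_
    filter_upwards [ae_restrict_mem measurableSet_Ioi] with r hr
    have hr0 : (0 : ℝ) < r := one_pos.trans hr
    rw [Real.norm_of_nonneg (by positivity), Real.rpow_neg hr0.le, Real.rpow_two, ← one_div]
    gcongr
    · exact Real.rpow_le_one_of_one_le_of_nonpos (le_of_lt hr) he0.le
    · linarith

/-- From 1 + r ≤ (1 + |s|)(1 + |s - r|), decay in s - r becomes decay in r, locally uniformly in s.
This dominates the convolutions with r^e at infinity. -/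
lemma exists_schwartz_bound (h : 𝓢(ℝ, ℝ)) :
    ∃ C : ℝ, 0 ≤ C ∧ ∀ s r : ℝ, 0 ≤ r → |h (s - r)| ≤ C * (1 + |s|) ^ 2 / (1 + r) ^ 2 := by
  refine ⟨2 ^ 2 * (Finset.Iic (2, 0)).sup (fun m => SchwartzMap.seminorm ℝ m.1 m.2) h,
    by positivity, fun s r hr => ?_⟩
  have h1 := SchwartzMap.one_add_le_sup_seminorm_apply (𝕜 := ℝ) (m := (2, 0)) le_rfl le_rfl h
    (s - r)
  rw [norm_iteratedFDeriv_zero, Real.norm_eq_abs, Real.norm_eq_abs] at h1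
  set C := 2 ^ 2 * (Finset.Iic (2, 0)).sup (fun m => SchwartzMap.seminorm ℝ m.1 m.2) h
  have h2 : 1 + r ≤ (1 + |s|) * (1 + |s - r|) := by
    have := neg_abs_le (s - r)
    nlinarith [abs_nonneg s, abs_nonneg (s - r), le_abs_self s]
  rw [le_div_iff₀ (by positivity)]
  calc |h (s - r)| * (1 + r) ^ 2 ≤ |h (s - r)| * ((1 + |s|) * (1 + |s - r|)) ^ 2 := by gcongr
    _ = ((1 + |s - r|) ^ 2 * |h (s - r)|) * (1 + |s|) ^ 2 := by ring
    _ ≤ C * (1 + |s|) ^ 2 := by gcongr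

lemma integrableOn_schwartz_mul_rpow (h : 𝓢(ℝ, ℝ)) {e : ℝ} (he : -1 < e) (he0 : e < 0) (s : ℝ) :
    IntegrableOn (fun r => h (s - r) * r ^ e) (Ioi 0) := by
  obtain ⟨C, hC0, hC⟩ := exists_schwartz_bound h
  have hm : Measurable fun r : ℝ => h (s - r) * r ^ e :=
    (h.continuous.comp (by fun_prop : Continuous fun r : ℝ => s - r)).measurable.mul (by fun_prop)
  refine ((integrableOn_rpow_div_one_add_sq he he0).const_mul (C * (1 + |s|) ^ 2)).mono'
    hm.aestronglyMeasurable ?_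
  filter_upwards [ae_restrict_mem measurableSet_Ioi] with r hr
  have hr0 : (0 : ℝ) < r := hr
  rw [norm_mul, Real.norm_eq_abs, Real.norm_of_nonneg (Real.rpow_nonneg hr0.le e),
    mul_div_assoc', mul_div_right_comm]
  gcongr
  exact hC s r hr0.le

lemma integrable_prod_schwartz_mul_rpow (h : 𝓢(ℝ, ℝ)) {e : ℝ} (he : -1 < e) (he0 : e < 0)
    (t : ℝ) :
    Integrable (fun p : ℝ × ℝ => h (p.1 - p.2) * p.2 ^ e)
      ((volume.restrict (Ico 0 t)).prod (volume.restrict (Ioi 0))) := by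
  obtain ⟨C, hC0, hC⟩ := exists_schwartz_bound h
  have hm : Measurable fun p : ℝ × ℝ => h (p.1 - p.2) * p.2 ^ e :=
    (h.continuous.comp (by fun_prop : Continuous fun p : ℝ × ℝ => p.1 - p.2)).measurable.mul
      (by fun_prop)
  refine (((integrableOn_rpow_div_one_add_sq he he0).const_mul
    (C * (1 + |t|) ^ 2)).comp_snd (volume.restrict (Ico 0 t))).mono'
    hm.aestronglyMeasurable ?_
  rw [Measure.prod_restrict]
  filter_upwards [ae_restrict_mem (measurableSet_Ico.prod measurableSet_Ioi)] with p hp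
  have hp2 : 0 < p.2 := hp.2
  rw [norm_mul, Real.norm_eq_abs, Real.norm_of_nonneg (Real.rpow_nonneg hp2.le e),
    mul_div_assoc', mul_div_right_comm]
  gcongr
  refine (hC p.1 p.2 hp2.le).trans ?_
  gcongr ?_ * (1 + ?_) ^ 2 / _
  rw [abs_of_nonneg hp.1.1]
  exact hp.1.2.le.trans (le_abs_self t)

end RSFBM

namespace RSFBM

lemma posPow_mul_schwartz_eq_indicator (h : 𝓢(ℝ, ℝ)) {e : ℝ} (he0 : e < 0) (s : ℝ) :
    (fun x => posPow e (s - x) * h x) =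
      fun x => (Ioi 0).indicator (fun r => h (s - r) * r ^ e) (s - x) := by
  ext x
  by_cases hx : 0 < s - x
  · rw [indicator_of_mem (mem_Ioi.2 hx), posPow_of_pos hx, sub_sub_cancel, mul_comm]
  · rw [indicator_of_notMem (by simpa using hx), posPow_of_nonpos he0.ne (not_lt.1 hx), zero_mul]

lemma integrable_posPow_mul_schwartz (h : 𝓢(ℝ, ℝ)) {e : ℝ} (he : -1 < e) (he0 : e < 0) (s : ℝ) :
    Integrable fun x => posPow e (s - x) * h x := by
  rw [posPow_mul_schwartz_eq_indicator h he0]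
  exact ((integrable_indicator_iff measurableSet_Ioi).2
    (integrableOn_schwartz_mul_rpow h he he0 s)).comp_sub_left s

lemma integral_posPow_mul_schwartz (h : 𝓢(ℝ, ℝ)) {e : ℝ} (he0 : e < 0) (s : ℝ) :
    ∫ x, posPow e (s - x) * h x = ∫ r in Ioi 0, h (s - r) * r ^ e := by
  rw [posPow_mul_schwartz_eq_indicator h he0, integral_sub_left_eq_self
    ((Ioi 0).indicator fun r => h (s - r) * r ^ e), integral_indicator measurableSet_Ioi]

/-! ### The fractional derivatives of order `1/2 - H` -/

section marchaud

variable {H : ℝ}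

/-- The difference is nonzero only for x < b ≤ x + r, so a truncation at ε < b - x cuts nothing off.
The limit in Marchaud's derivative is therefore eventually constant at each point. -/
lemma integral_Iio_indicator_sub (hH : H < 1 / 2) {b x ε : ℝ} (hε : 0 < ε)
    (hb : x < b → ε < b - x) :
    IntegrableOn (fun r => (((Iio b).indicator 1 x : ℝ) - (Iio b).indicator 1 (x + r)) /
        r ^ (3 / 2 - H)) (Ioi ε) ∧
      ∫ r in Ioi ε, (((Iio b).indicator 1 x : ℝ) - (Iio b).indicator 1 (x + r)) /
        r ^ (3 / 2 - H) = posPow (H - 1 / 2) (b - x) / (1 / 2 - H) := by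
  have he : -(3 / 2 - H) < -1 := by linarith
  by_cases hx : x < b
  · have h1 : ∀ r ∈ Ioi ε, (((Iio b).indicator 1 x : ℝ) - (Iio b).indicator 1 (x + r)) /
        r ^ (3 / 2 - H) = (Ici (b - x)).indicator (fun r => r ^ (-(3 / 2 - H))) r := by
      intro r hr
      have hr0 : 0 < r := hε.trans hr
      rw [indicator_of_mem (mem_Iio.2 hx)]
      by_cases h2 : b - x ≤ r
      · rw [indicator_of_notMem (by simp; linarith), indicator_of_mem (mem_Ici.2 h2),
          Real.rpow_neg hr0.le]
        simp
      · rw [indicator_of_mem (by simp; linarith), indicator_of_notMem (by simpa using h2)]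
        simp
    have h3 : Ioi ε ∩ Ici (b - x) = Ici (b - x) := by
      rw [inter_eq_right]
      exact fun r hr => (hb hx).trans_le hr
    have hpos : 0 < b - x := sub_pos.2 hx
    rw [integrableOn_congr_fun h1 measurableSet_Ioi, setIntegral_congr_fun measurableSet_Ioi h1,
      setIntegral_indicator measurableSet_Ici, h3, integral_Ici_eq_integral_Ioi,
      integral_Ioi_rpow_of_lt he hpos, posPow_of_pos hpos]
    constructor
    · exact ((integrable_indicator_iff measurableSet_Ici).2
        ((integrableOn_Ici_iff_integrableOn_Ioi).2 (integrableOn_Ioi_rpow_of_lt he hpos))).integrableOn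
    · rw [show -(3 / 2 - H) + 1 = H - 1 / 2 by ring, neg_div, ← div_neg, neg_sub]
  · have h1 : ∀ r ∈ Ioi ε, (((Iio b).indicator 1 x : ℝ) - (Iio b).indicator 1 (x + r)) /
        r ^ (3 / 2 - H) = 0 := by
      intro r hr
      have hr0 : 0 < r := hε.trans hr
      rw [indicator_of_notMem (by simpa using hx), indicator_of_notMem (by simp; linarith)]
      simp
    rw [integrableOn_congr_fun h1 measurableSet_Ioi, setIntegral_congr_fun measurableSet_Ioi h1,
      posPow_of_nonpos (by linarith) (by linarith)]
    simp

lemma signedIndicator_zero_eq {t : ℝ} (ht : 0 ≤ t) (x : ℝ) :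
    signedIndicator 0 t x = (Iio t).indicator 1 x - (Iio 0).indicator 1 x := by
  rw [signedIndicator_of_nonneg ht]
  simp only [indicator, mem_Iio, mem_Ico, Pi.one_apply]
  split_ifs <;> grind

lemma MMinus_const_of_lt (hH : H < 1 / 2) {ν : ℝ → ℝ} {κ : ℝ} (hν : ∀ s, 0 ≤ s → ν s = κ)
    {t : ℝ} (ht : 0 ≤ t) (x : ℝ) :
    MMinus H (fun s => ν s * signedIndicator 0 t s) x =
      hurstConst H / Real.Gamma (1 / 2 + H) * κ *
        (posPow (H - 1 / 2) (t - x) - posPow (H - 1 / 2) (-x)) := by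
  have hf : (fun s => ν s * signedIndicator 0 t s) =
      fun s => κ * (((Iio t).indicator 1 s : ℝ) - (Iio 0).indicator 1 s) := by
    ext s
    rw [← signedIndicator_zero_eq ht]
    rcases lt_or_ge s 0 with hs | hs
    · rw [signedIndicator_of_nonneg ht, indicator_of_notMem (by simp [hs])]
      simp
    · rw [hν s hs]
  rw [hf, MMinus, if_neg (by linarith), if_neg hH.ne]
  refine Tendsto.limUnder_eq (tendsto_nhds_of_eventually_eq ?_)
  have h1 : ∀ b : ℝ, ∀ᶠ ε in 𝓝[>] (0 : ℝ), x < b → ε < b - x := by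
    intro b
    by_cases hx : x < b
    · filter_upwards [Ioo_mem_nhdsGT (sub_pos.2 hx)] with ε hε _ using hε.2
    · exact Eventually.of_forall fun ε h => absurd h hx
  filter_upwards [h1 t, h1 0, self_mem_nhdsWithin] with ε h2 h3 hε
  obtain ⟨i1, e1⟩ := integral_Iio_indicator_sub hH hε h2
  obtain ⟨i2, e2⟩ := integral_Iio_indicator_sub hH hε h3
  have h4 : ∀ r : ℝ, (κ * (((Iio t).indicator 1 x : ℝ) - (Iio 0).indicator 1 x) -
      κ * (((Iio t).indicator 1 (x + r) : ℝ) - (Iio 0).indicator 1 (x + r))) / r ^ (3 / 2 - H) =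
      κ * ((((Iio t).indicator 1 x : ℝ) - (Iio t).indicator 1 (x + r)) / r ^ (3 / 2 - H) -
        (((Iio 0).indicator 1 x : ℝ) - (Iio 0).indicator 1 (x + r)) / r ^ (3 / 2 - H)) := by
    intro r; ring
  simp_rw [h4]
  rw [integral_const_mul, integral_sub i1 i2, e1, e2, zero_sub]
  have : 1 / 2 - H ≠ 0 := by linarith
  generalize 1 / 2 - H = a at this ⊢
  field_simp

/-- Integration by parts on (ε, ∞) with the antiderivative r^e/e, e = H - 1/2, moves the derivative
onto η and leaves the integrable singularity r^e. The boundary term at ε vanishes in the limit. -/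
lemma MPlus_schwartz_of_lt (hH0 : 0 < H) (hH : H < 1 / 2) (η : 𝓢(ℝ, ℝ)) (s : ℝ) :
    MPlus H η s = hurstConst H / Real.Gamma (1 / 2 + H) *
      ∫ r in Ioi 0, SchwartzMap.derivCLM ℝ ℝ η (s - r) * r ^ (H - 1 / 2) := by
  have he : -(3 / 2 - H) < -1 := by linarith
  have ha : 1 / 2 - H ≠ 0 := by linarith
  set e := H - 1 / 2 with he_def
  have he1 : -1 < e := by linarith
  have he0 : e < 0 := by linarith
  have hint := integrableOn_schwartz_mul_rpow (SchwartzMap.derivCLM ℝ ℝ η) he1 he0 s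
  obtain ⟨C, hC⟩ := η.decay 0 0
  have hηb : ∀ r, |η r| ≤ C := fun r => by simpa using hC.2 r
  have hηd : ∀ r, HasDerivAt (fun r => η s - η (s - r)) (SchwartzMap.derivCLM ℝ ℝ η (s - r)) r := by
    intro r
    have := (η.differentiableAt.hasDerivAt (x := s - r)).comp_const_sub s r
    simpa using this.const_sub (η s)
  rw [MPlus, if_neg (by linarith), if_neg hH.ne]
  refine Tendsto.limUnder_eq ?_
  have hparts : ∀ ε > 0, ∫ r in Ioi ε, (η s - η (s - r)) / r ^ (3 / 2 - H) =
      ((η s - η (s - ε)) * ε ^ e + ∫ r in Ioi ε, SchwartzMap.derivCLM ℝ ℝ η (s - r) * r ^ e) /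
        (1 / 2 - H) := by
    intro ε hε
    have hcont : Continuous fun r => η s - η (s - r) :=
      continuous_const.sub (η.continuous.comp (by fun_prop))
    have hsub : Ioi ε ⊆ Ioi 0 := Ioi_subset_Ioi hε.le
    have h1 := integral_Ioi_mul_deriv_eq_deriv_mul (a := ε)
      (u := fun r => η s - η (s - r)) (u' := fun r => SchwartzMap.derivCLM ℝ ℝ η (s - r))
      (v := fun r => r ^ e / e) (v' := fun r => r ^ (-(3 / 2 - H)))
      (a' := (η s - η (s - ε)) * (ε ^ e / e)) (b' := 0)
      (fun r _ => hηd r) (fun r hr => ?_) ?_ ?_ ?_ ?_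
    · have h2 : ∫ r in Ioi ε, (η s - η (s - r)) / r ^ (3 / 2 - H) =
          ∫ r in Ioi ε, (η s - η (s - r)) * r ^ (-(3 / 2 - H)) := by
        refine setIntegral_congr_fun measurableSet_Ioi fun r hr => ?_
        have hr0 : 0 < r := hε.trans hr
        rw [Real.rpow_neg hr0.le, div_eq_mul_inv]
      have h3 : ∀ r : ℝ, SchwartzMap.derivCLM ℝ ℝ η (s - r) * (r ^ e / e) =
          SchwartzMap.derivCLM ℝ ℝ η (s - r) * r ^ e * e⁻¹ := fun r => by ring
      rw [h2, h1]
      simp_rw [h3]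
      rw [integral_mul_const, show 1 / 2 - H = -e by linarith]
      field_simp
      ring
    · have hr0 : 0 < r := hε.trans hr
      have := (Real.hasDerivAt_rpow_const (p := e) (Or.inl hr0.ne')).div_const e
      convert this using 1
      rw [mul_div_cancel_left₀ _ he0.ne]
      congr 1
      linarith
    · refine Integrable.bdd_mul (c := 2 * C) (integrableOn_Ioi_rpow_of_lt he hε)
        hcont.aestronglyMeasurable (ae_of_all _ fun r => ?_)
      rw [Real.norm_eq_abs]
      linarith [abs_sub (η s) (η (s - r)), hηb s, hηb (s - r)]
    · have := (hint.mono_set hsub).mul_const e⁻¹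
      exact this.congr (ae_of_all _ fun r => by simp only [Pi.mul_apply]; ring)
    · have : ContinuousAt (fun r => (η s - η (s - r)) * (r ^ e / e)) ε :=
        hcont.continuousAt.mul
          ((Real.continuousAt_rpow_const _ _ (Or.inl hε.ne')).div_const e)
      exact this.tendsto.mono_left nhdsWithin_le_nhds
    · have h4 : Tendsto (fun r : ℝ => r ^ e / e) atTop (𝓝 0) := by
        have := (tendsto_rpow_neg_atTop (y := -e) (by linarith)).div_const e
        simpa using this
      refine bdd_le_mul_tendsto_zero' (2 * C) (Eventually.of_forall fun r => ?_) h4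
      linarith [abs_sub (η s) (η (s - r)), hηb s, hηb (s - r)]
  -- A difference quotient, which converges, times ε^{1+e}, which tends to 0 because e > -1.
  have hlim1 : Tendsto (fun ε => (η s - η (s - ε)) * ε ^ e) (𝓝[>] 0) (𝓝 0) := by
    have h1 := (hasDerivAt_iff_tendsto_slope_zero.1 (hηd 0)).mono_left
      (nhdsWithin_mono (0 : ℝ) (fun x (hx : 0 < x) => hx.ne'))
    have h2 : Tendsto (fun ε : ℝ => ε ^ (1 + e)) (𝓝[>] 0) (𝓝 0) := by
      have := (Real.continuousAt_rpow_const 0 (1 + e) (Or.inr (by linarith))).tendsto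
      rw [Real.zero_rpow (by linarith)] at this
      exact this.mono_left nhdsWithin_le_nhds
    have h3 := h1.mul h2
    rw [mul_zero] at h3
    refine h3.congr' ?_
    filter_upwards [self_mem_nhdsWithin] with ε hε
    have hε0 : (0 : ℝ) < ε := hε
    rw [Real.rpow_add hε0, Real.rpow_one]
    simp only [zero_add, sub_zero, sub_self, smul_eq_mul]
    field_simp
  have hlim2 : Tendsto (fun ε => ∫ r in Ioi ε, SchwartzMap.derivCLM ℝ ℝ η (s - r) * r ^ e)
      (𝓝[>] 0) (𝓝 (∫ r in Ioi 0, SchwartzMap.derivCLM ℝ ℝ η (s - r) * r ^ e)) := by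
    have h1 := (aecover_Ioi_of_Ioi (μ := (volume : Measure ℝ)) (a := fun ε : ℝ => ε)
      (l := 𝓝[>] (0 : ℝ)) (A := 0) nhdsWithin_le_nhds).integral_tendsto_of_countably_generated hint
    refine h1.congr' ?_
    filter_upwards [self_mem_nhdsWithin] with ε hε
    have hε0 : (0 : ℝ) < ε := hε
    rw [Measure.restrict_restrict measurableSet_Ioi,
      inter_eq_left.2 (Ioi_subset_Ioi hε0.le)]
  have h5 := ((hlim1.add hlim2).div_const (1 / 2 - H)).const_mul
    (hurstConst H * (1 / 2 - H) / Real.Gamma (1 / 2 + H))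
  rw [zero_add] at h5
  have h6 : ∀ I : ℝ, hurstConst H * (1 / 2 - H) / Real.Gamma (1 / 2 + H) * (I / (1 / 2 - H)) =
      hurstConst H / Real.Gamma (1 / 2 + H) * I := fun I => by
    generalize 1 / 2 - H = a at ha ⊢
    field_simp
  rw [h6] at h5
  refine h5.congr' ?_
  filter_upwards [self_mem_nhdsWithin] with ε hε
  rw [hparts ε hε]

/-- After Fubini the s-integral of η'(s - r) is η(t - r) - η(-r). Reflecting r then gives the two
powers that make up M_-^H. -/
lemma setIntegral_MPlus_of_lt (hH0 : 0 < H) (hH : H < 1 / 2) {ν : ℝ → ℝ} {κ : ℝ}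
    (hν : ∀ s, 0 ≤ s → ν s = κ) {t : ℝ} (ht : 0 ≤ t) (η : 𝓢(ℝ, ℝ)) :
    ∫ s in Ico 0 t, ν s * MPlus H η s =
      ∫ x, MMinus H (fun s => ν s * signedIndicator 0 t s) x * η x := by
  have he1 : -1 < H - 1 / 2 := by linarith
  have he0 : H - 1 / 2 < 0 := by linarith
  set C := hurstConst H / Real.Gamma (1 / 2 + H) with hC
  have h1 : ∀ s ∈ Ico 0 t, ν s * MPlus H η s =
      C * κ * ∫ r in Ioi 0, SchwartzMap.derivCLM ℝ ℝ η (s - r) * r ^ (H - 1 / 2) := by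
    intro s hs
    rw [hν s hs.1, MPlus_schwartz_of_lt hH0 hH]
    ring
  have h2 : ∀ x, MMinus H (fun s => ν s * signedIndicator 0 t s) x * η x =
      C * κ * (posPow (H - 1 / 2) (t - x) * η x - posPow (H - 1 / 2) (0 - x) * η x) := by
    intro x
    rw [MMinus_const_of_lt hH hν ht, zero_sub]
    ring
  have h3 : ∀ r : ℝ, ∫ s in Ico 0 t, SchwartzMap.derivCLM ℝ ℝ η (s - r) * r ^ (H - 1 / 2) =
      η (t - r) * r ^ (H - 1 / 2) - η (0 - r) * r ^ (H - 1 / 2) := by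
    intro r
    rw [integral_mul_const, ← sub_mul, setIntegral_congr_set Ico_ae_eq_Ioc,
      ← intervalIntegral.integral_of_le ht]
    congr 1
    refine intervalIntegral.integral_eq_sub_of_hasDerivAt (f := fun s => η (s - r))
      (fun s _ => ?_) (Continuous.intervalIntegrable ?_ _ _)
    · exact (η.differentiableAt.hasDerivAt).comp_sub_const s r
    · exact (SchwartzMap.derivCLM ℝ ℝ η).continuous.comp (by fun_prop)
  rw [setIntegral_congr_fun measurableSet_Ico h1, integral_const_mul,
    integral_integral_swap (integrable_prod_schwartz_mul_rpow _ he1 he0 t)]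
  simp_rw [h2, h3]
  rw [integral_const_mul, integral_sub (integrable_posPow_mul_schwartz η he1 he0 t)
    (integrable_posPow_mul_schwartz η he1 he0 0), integral_posPow_mul_schwartz η he0,
    integral_posPow_mul_schwartz η he0, integral_sub (integrableOn_schwartz_mul_rpow η he1 he0 t)
    (integrableOn_schwartz_mul_rpow η he1 he0 0)]

/-- Bernoulli's inequality for the exponent -e ∈ (0,1). The bound t/y is crude but square integrable
at infinity. -/
lemma rpow_sub_rpow_add_le {e : ℝ} (he1 : -1 < e) (he0 : e < 0) {t y : ℝ} (ht : 0 ≤ t)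
    (hy : 1 < y) : y ^ e - (t + y) ^ e ≤ t * y⁻¹ := by
  have hy0 : 0 < y := one_pos.trans hy
  have h1 : (1 + t / y) ^ (-e) ≤ 1 + -e * (t / y) :=
    rpow_one_add_le_one_add_mul_self ((by norm_num : (-1 : ℝ) ≤ 0).trans (by positivity))
      (by linarith) (by linarith)
  have h2 : 0 < 1 + t / y := by positivity
  have h3 : (1 + t / y) ^ (-e) ≤ 1 + t / y := by
    nlinarith [div_nonneg ht hy0.le]
  have h4 : 1 - t / y ≤ (1 + t / y) ^ e := by
    have h5 : (1 + t / y) ^ e * (1 + t / y) ^ (-e) = 1 := by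
      rw [← Real.rpow_add h2, add_neg_cancel, Real.rpow_zero]
    have h6 := Real.rpow_pos_of_pos h2 e
    by_contra! h7
    nlinarith [div_nonneg ht hy0.le]
  have h8 : t + y = y * (1 + t / y) := by field_simp; ring
  rw [h8, Real.mul_rpow hy0.le h2.le, ← div_eq_mul_inv]
  have h9 : y ^ e ≤ 1 := Real.rpow_le_one_of_one_le_of_nonpos hy.le he0.le
  have h10 : 0 ≤ y ^ e := Real.rpow_nonneg hy0.le e
  nlinarith [div_nonneg ht hy0.le]

lemma integrable_posPow_sub_sq {e : ℝ} (he : -1 < 2 * e) (he0 : e < 0) {t : ℝ} (ht : 0 ≤ t) :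
    Integrable fun y => (posPow e (t + y) - posPow e y) ^ 2 := by
  have hsq : ∀ r : ℝ, 0 < r → (r ^ e) ^ 2 = r ^ (2 * e) := fun r hr => by
    rw [← Real.rpow_natCast, ← Real.rpow_mul hr.le]
    congr 1
    push_cast
    ring
  have i1 : Integrable fun y => (Ioc 0 t).indicator (fun r : ℝ => r ^ (2 * e)) (t + y) :=
    ((integrable_indicator_iff measurableSet_Ioc).2 (integrableOn_rpow_Ioc he t)).comp_add_left t
  have i2 : Integrable ((Ioc 0 1).indicator fun r : ℝ => r ^ (2 * e)) :=
    (integrable_indicator_iff measurableSet_Ioc).2 (integrableOn_rpow_Ioc he 1)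
  have i3 : Integrable ((Ioi 1).indicator fun r : ℝ => t ^ 2 * r ^ (-2 : ℝ)) :=
    (integrable_indicator_iff measurableSet_Ioi).2
      ((integrableOn_Ioi_rpow_of_lt (by norm_num) one_pos).const_mul _)
  have n1 : ∀ y, 0 ≤ (Ioc 0 t).indicator (fun r : ℝ => r ^ (2 * e)) y := fun y =>
    indicator_nonneg (fun r hr => Real.rpow_nonneg hr.1.le _) y
  have n2 : ∀ y, 0 ≤ (Ioc 0 1).indicator (fun r : ℝ => r ^ (2 * e)) y := fun y =>
    indicator_nonneg (fun r hr => Real.rpow_nonneg hr.1.le _) y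
  have n3 : ∀ y, 0 ≤ (Ioi 1).indicator (fun r : ℝ => t ^ 2 * r ^ (-2 : ℝ)) y := fun y =>
    indicator_nonneg (fun r (hr : 1 < r) =>
      mul_nonneg (sq_nonneg t) (Real.rpow_nonneg (by linarith) _)) y
  refine ((i1.add i2).add i3).mono' (by fun_prop) (ae_of_all _ fun y => ?_)
  rw [Real.norm_of_nonneg (sq_nonneg _)]
  simp only [Pi.add_apply]
  rcases le_or_gt y 0 with hy | hy
  · rw [posPow_of_nonpos he0.ne hy, sub_zero]
    rcases le_or_gt (t + y) 0 with hty | hty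
    · rw [posPow_of_nonpos he0.ne hty]
      have := add_nonneg (add_nonneg (n1 (t + y)) (n2 y)) (n3 y)
      simpa using this
    · rw [posPow_of_pos hty, hsq _ hty, indicator_of_mem (mem_Ioc.2 ⟨hty, by linarith⟩)]
      linarith [n2 y, n3 y]
  · have hty : 0 < t + y := by linarith
    rw [posPow_of_pos hy, posPow_of_pos hty]
    have h1 : (t + y) ^ e ≤ y ^ e := Real.rpow_le_rpow_of_nonpos hy (by linarith) he0.le
    have h2 := Real.rpow_nonneg hty.le e
    rcases le_or_gt y 1 with hy1 | hy1
    · rw [indicator_of_mem (mem_Ioc.2 ⟨hy, hy1⟩), ← hsq y hy]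
      have : ((t + y) ^ e - y ^ e) ^ 2 ≤ (y ^ e) ^ 2 := by nlinarith
      linarith [n1 (t + y), n3 y]
    · rw [indicator_of_mem (mem_Ioi.2 hy1), Real.rpow_neg hy.le, Real.rpow_two]
      have h3 := rpow_sub_rpow_add_le (by linarith : -1 < e) he0 ht hy1
      have : ((t + y) ^ e - y ^ e) ^ 2 ≤ (t * y⁻¹) ^ 2 := by nlinarith
      rw [mul_pow, inv_pow] at this
      linarith [n1 (t + y), n2 y]

lemma memLp_MMinus_of_lt (hH0 : 0 < H) (hH : H < 1 / 2) {ν : ℝ → ℝ} {κ : ℝ}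
    (hν : ∀ s, 0 ≤ s → ν s = κ) {t : ℝ} (ht : 0 ≤ t) :
    MemLp (MMinus H fun s => ν s * signedIndicator 0 t s) 2 volume := by
  rw [funext fun x => MMinus_const_of_lt hH hν ht x]
  refine MemLp.const_mul ((memLp_two_iff_integrable_sq (by fun_prop)).2 ?_) _
  simpa only [sub_eq_add_neg] using (integrable_posPow_sub_sq (e := H - 1 / 2) (by linarith)
    (by linarith) ht).comp_neg

/-- Self-similarity: the kernel is homogeneous of degree H - 1/2, and the substitution x = ty
contributes one more factor t, so t^{2H-1}·t. -/
lemma integral_sq_MMinus_of_lt (hH0 : 0 < H) (hH : H < 1 / 2) {ν : ℝ → ℝ} {κ : ℝ}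
    (hν : ∀ s, 0 ≤ s → ν s = κ) {t : ℝ} (ht : 0 ≤ t) :
    ∫ x, MMinus H (fun s => ν s * signedIndicator 0 t s) x ^ 2 =
      t ^ (2 * H) * ∫ x, MMinus H (fun s => ν s * signedIndicator 0 1 s) x ^ 2 := by
  have he : H - 1 / 2 ≠ 0 := by linarith
  simp_rw [MMinus_const_of_lt hH hν ht, MMinus_const_of_lt hH hν zero_le_one]
  rcases ht.eq_or_lt with rfl | ht0
  · simp [Real.zero_rpow (by linarith : 2 * H ≠ 0)]
  · set C := hurstConst H / Real.Gamma (1 / 2 + H) * κ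
    set G : ℝ → ℝ := fun y => (C * (posPow (H - 1 / 2) (1 - y) - posPow (H - 1 / 2) (-y))) ^ 2
      with hG
    have h1 : ∀ x, (C * (posPow (H - 1 / 2) (t - x) - posPow (H - 1 / 2) (-x))) ^ 2 =
        (t ^ (H - 1 / 2)) ^ 2 * G (x / t) := by
      intro x
      have h2 : t - x = t * (1 - x / t) := by field_simp
      have h3 : -x = t * -(x / t) := by field_simp
      rw [h2, h3, posPow_mul ht, posPow_mul ht, hG]
      ring
    rw [integral_congr_ae (ae_of_all _ h1), integral_const_mul, Measure.integral_comp_div, abs_of_pos ht0, smul_eq_mul, ← mul_assoc]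
    congr 1
    rw [← Real.rpow_natCast, ← Real.rpow_mul ht]
    nth_rw 2 [← Real.rpow_one t]
    rw [← Real.rpow_add ht0]
    congr 1
    push_cast
    ring

end marchaud

end RSFBM

namespace RSFBM

/-! ### Kernels of the fractional integrals of order `H - 1/2` -/

section kernel

variable {e : ℝ}

/-- The autocorrelation of `x₊ ^ e` at lag `1`. -/
noncomputable def posPowCorr (e : ℝ) : ℝ := ∫ y, posPow e y * posPow e (y + 1)

lemma posPowCorr_nonneg (e : ℝ) : 0 ≤ posPowCorr e :=
  integral_nonneg fun _ => mul_nonneg (posPow_nonneg _ _) (posPow_nonneg _ _)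

lemma integrable_posPow_mul_posPow_one (he : -1 < e) (he0 : e < -(1 / 2)) :
    Integrable fun y => posPow e y * posPow e (y + 1) := by
  have hm : Measurable fun y => posPow e y * posPow e (y + 1) := by fun_prop
  have hne : e ≠ 0 := by linarith
  have i1 : Integrable ((Ioc 0 1).indicator fun r : ℝ => r ^ e) :=
    (integrable_indicator_iff measurableSet_Ioc).2 (integrableOn_rpow_Ioc he 1)
  have i2 : Integrable ((Ioi 1).indicator fun r : ℝ => r ^ (2 * e)) :=
    (integrable_indicator_iff measurableSet_Ioi).2
      (integrableOn_Ioi_rpow_of_lt (by linarith) one_pos)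
  refine (i1.add i2).mono' hm.aestronglyMeasurable (ae_of_all _ fun y => ?_)
  rw [Real.norm_of_nonneg (mul_nonneg (posPow_nonneg _ _) (posPow_nonneg _ _))]
  simp only [Pi.add_apply]
  rcases le_or_gt y 0 with hy | hy
  · rw [posPow_of_nonpos hne hy, indicator_of_notMem (by simp [hy]),
      indicator_of_notMem (by simp; linarith)]
    simp
  · have h0 := Real.rpow_nonneg hy.le e
    rw [posPow_of_pos hy, posPow_of_pos (by linarith)]
    rcases le_or_gt y 1 with hy1 | hy1
    · rw [indicator_of_mem (mem_Ioc.2 ⟨hy, hy1⟩), indicator_of_notMem (by simpa using hy1), add_zero]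
      exact mul_le_of_le_one_right h0
        (Real.rpow_le_one_of_one_le_of_nonpos (by linarith) (by linarith))
    · rw [indicator_of_notMem (by simp [hy1]), indicator_of_mem (mem_Ioi.2 hy1), zero_add,
        two_mul, Real.rpow_add hy]
      exact mul_le_mul_of_nonneg_left
        (Real.rpow_le_rpow_of_nonpos hy (by linarith) (by linarith)) h0

lemma posPow_mul_posPow_add (d : ℝ) (hd : 0 < d) :
    (fun y => posPow e y * posPow e (y + d)) =
      fun y => d ^ (2 * e) * (fun z => posPow e z * posPow e (z + 1)) (y / d) := by
  ext y
  have h1 : y + d = d * (y / d + 1) := by field_simp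
  have h2 : posPow e y = d ^ e * posPow e (y / d) := by
    rw [← posPow_mul hd.le, mul_div_cancel₀ _ hd.ne']
  rw [h1, h2, posPow_mul hd.le, two_mul, Real.rpow_add hd]
  ring

/-- Translation and scaling reduce to lag 1. One of the two powers on the right is always 0, so
their sum is |s - r|^{2e+1}. On the diagonal the integrand x₊^{2e} is not integrable. -/
lemma integrable_posPow_sub_mul_posPow_sub (he : -1 < e) (he0 : e < -(1 / 2)) {s r : ℝ}
    (hsr : s ≠ r) :
    Integrable (fun x => posPow e (s - x) * posPow e (r - x)) ∧
      ∫ x, posPow e (s - x) * posPow e (r - x) =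
        posPowCorr e * (posPow (2 * e + 1) (s - r) + posPow (2 * e + 1) (r - s)) := by
  wlog h : s < r generalizing s r
  · have := this hsr.symm (lt_of_le_of_ne (not_lt.1 h) hsr.symm)
    rw [add_comm (posPow _ _)]
    simpa only [mul_comm (posPow e (r - _))] using this
  have hd : 0 < r - s := sub_pos.2 h
  have h1 : (fun x => posPow e (s - x) * posPow e (r - x)) =
      fun x => (fun y => posPow e y * posPow e (y + (r - s))) (s - x) := by
    ext x
    simp
  have hint : Integrable fun y => posPow e y * posPow e (y + (r - s)) := by
    rw [posPow_mul_posPow_add _ hd]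
    exact ((integrable_posPow_mul_posPow_one he he0).comp_div hd.ne').const_mul _
  rw [h1]
  refine ⟨hint.comp_sub_left s, ?_⟩
  rw [integral_sub_left_eq_self (fun y => posPow e y * posPow e (y + (r - s))),
    posPow_mul_posPow_add _ hd, integral_const_mul,
    Measure.integral_comp_div (fun z => posPow e z * posPow e (z + 1)), abs_of_pos hd,
    smul_eq_mul, posPow_of_pos hd, Real.rpow_add hd, Real.rpow_one, posPowCorr,
    posPow_of_nonpos (by linarith) (by linarith)]
  ring

lemma integrable_prod_posPow_sub (he : -1 < e) (he0 : e < 0) (t : ℝ) :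
    Integrable (fun p : ℝ × ℝ => posPow e (p.1 - p.2))
      ((volume.restrict (Ico 0 t)).prod (volume.restrict (Ico 0 t))) := by
  have i1 : Integrable ((Ioc 0 t).indicator fun r : ℝ => r ^ e) :=
    (integrable_indicator_iff measurableSet_Ioc).2 (integrableOn_rpow_Ioc he t)
  have i2 := Integrable.convolution_integrand (ContinuousLinearMap.mul ℝ ℝ)
    (ν := volume.restrict (Ico 0 t)) (integrable_const (1 : ℝ)) i1
  have i3 := i2.restrict (s := Ico 0 t ×ˢ univ)
  rw [← Measure.prod_restrict, Measure.restrict_univ] at i3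
  refine i3.congr ?_
  rw [Measure.prod_restrict]
  filter_upwards [ae_restrict_mem (measurableSet_Ico.prod measurableSet_Ico)] with p hp
  simp only [ContinuousLinearMap.mul_apply', one_mul]
  rcases le_or_gt (p.1 - p.2) 0 with h | h
  · rw [posPow_of_nonpos he0.ne h, indicator_of_notMem (by simp; intro h1; linarith)]
  · rw [posPow_of_pos h, indicator_of_mem]
    exact ⟨h, by linarith [hp.1.2, hp.2.1]⟩

lemma ae_prod_restrict_ne (S : Set ℝ) :
    ∀ᵐ p : ℝ × ℝ ∂(volume.restrict S).prod (volume.restrict S), p.1 ≠ p.2 := by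
  have hm : MeasurableSet {p : ℝ × ℝ | p.1 ≠ p.2} :=
    (measurableSet_eq_fun measurable_fst measurable_snd).compl
  refine (Measure.ae_prod_mem_iff_ae_ae_mem hm).2 (ae_of_all _ fun s => ?_)
  filter_upwards [Measure.ae_ne (volume.restrict S) s] with r hr using hr.symm

variable {ν : ℝ → ℝ}

lemma exists_forall_abs_le (hν : Continuous ν) (a b : ℝ) :
    ∃ M, 0 ≤ M ∧ ∀ s ∈ Icc a b, |ν s| ≤ M := by
  obtain ⟨M, hM⟩ := isCompact_Icc.exists_bound_of_continuousOn (hν.continuousOn (s := Icc a b))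
  exact ⟨max M 0, le_max_right _ _, fun s hs => (hM s hs).trans (le_max_left _ _)⟩

/-- The fractional integral `∫_0^t ν(s) (s - x)₊ ^ e ds`. -/
noncomputable def fracInt (e : ℝ) (ν : ℝ → ℝ) (t x : ℝ) : ℝ :=
  ∫ s in Ico 0 t, ν s * posPow e (s - x)

lemma integrable_triple_kernel (hν : Continuous ν) (he : -1 < e) (he0 : e < -(1 / 2)) (t : ℝ)
    (hE0 : 2 * e + 1 < 0) :
    Integrable (fun q : (ℝ × ℝ) × ℝ =>
        (ν q.1.1 * posPow e (q.1.1 - q.2)) * (ν q.1.2 * posPow e (q.1.2 - q.2)))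
      (((volume.restrict (Ico 0 t)).prod (volume.restrict (Ico 0 t))).prod volume) := by
  have hm : Measurable fun q : (ℝ × ℝ) × ℝ =>
      (ν q.1.1 * posPow e (q.1.1 - q.2)) * (ν q.1.2 * posPow e (q.1.2 - q.2)) := by
    have := hν.measurable
    fun_prop
  obtain ⟨M, hM0, hM⟩ := exists_forall_abs_le hν 0 t
  have hE := integrable_prod_posPow_sub (e := 2 * e + 1) (by linarith) hE0 t
  rw [integrable_prod_iff hm.aestronglyMeasurable]
  have hne := ae_prod_restrict_ne (Ico (0 : ℝ) t)
  have h1 : ∀ p : ℝ × ℝ, (fun x : ℝ =>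
      (ν p.1 * posPow e (p.1 - x)) * (ν p.2 * posPow e (p.2 - x))) =
      fun x => (ν p.1 * ν p.2) * (posPow e (p.1 - x) * posPow e (p.2 - x)) := fun p => by
    ext x; ring
  constructor
  · filter_upwards [hne] with p hp
    rw [h1]
    exact (integrable_posPow_sub_mul_posPow_sub he he0 hp).1.const_mul _
  · refine ((hE.add hE.swap).const_mul (M * M * posPowCorr e)).mono'
      hm.norm.stronglyMeasurable.integral_prod_right'.aestronglyMeasurable ?_
    have hmem : ∀ᵐ p : ℝ × ℝ ∂(volume.restrict (Ico 0 t)).prod (volume.restrict (Ico 0 t)),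
        p ∈ Ico 0 t ×ˢ Ico 0 t := by
      rw [Measure.prod_restrict]
      exact ae_restrict_mem (measurableSet_Ico.prod measurableSet_Ico)
    filter_upwards [hne, hmem] with p hp hpt
    have h2 : ∀ x : ℝ, ‖(ν p.1 * posPow e (p.1 - x)) * (ν p.2 * posPow e (p.2 - x))‖ =
        |ν p.1 * ν p.2| * (posPow e (p.1 - x) * posPow e (p.2 - x)) := fun x => by
      rw [congrFun (h1 p) x, norm_mul, Real.norm_eq_abs,
        Real.norm_of_nonneg (mul_nonneg (posPow_nonneg _ _) (posPow_nonneg _ _))]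
    rw [Real.norm_of_nonneg (integral_nonneg fun _ => norm_nonneg _)]
    simp_rw [h2]
    rw [integral_const_mul, (integrable_posPow_sub_mul_posPow_sub he he0 hp).2, abs_mul,
      ← mul_assoc]
    have h3 := posPowCorr_nonneg e
    have h4 := posPow_nonneg (2 * e + 1) (p.1 - p.2)
    have h5 := posPow_nonneg (2 * e + 1) (p.2 - p.1)
    simp only [Pi.add_apply, Function.comp_apply, Prod.fst_swap, Prod.snd_swap]
    gcongr
    · exact hM _ (Ico_subset_Icc_self hpt.1)
    · exact hM _ (Ico_subset_Icc_self hpt.2)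

lemma measurable_fracInt (hν : Continuous ν) (t : ℝ) : Measurable (fracInt e ν t) := by
  have hm : StronglyMeasurable fun p : ℝ × ℝ => ν p.2 * posPow e (p.2 - p.1) := by
    have := hν.measurable
    exact (by fun_prop : Measurable fun p : ℝ × ℝ => ν p.2 * posPow e (p.2 - p.1)).stronglyMeasurable
  exact (hm.integral_prod_right' (ν := volume.restrict (Ico 0 t))).measurable

lemma fracInt_sq (t x : ℝ) : fracInt e ν t x ^ 2 =
    ∫ p, (ν p.1 * posPow e (p.1 - x)) * (ν p.2 * posPow e (p.2 - x))
      ∂(volume.restrict (Ico 0 t)).prod (volume.restrict (Ico 0 t)) := by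
  rw [integral_prod_mul (fun s => ν s * posPow e (s - x)) (fun s => ν s * posPow e (s - x)), sq,
    fracInt]

lemma memLp_fracInt (hν : Continuous ν) (he : -1 < e) (he0 : e < -(1 / 2)) (t : ℝ) :
    MemLp (fracInt e ν t) 2 volume := by
  rw [memLp_two_iff_integrable_sq (measurable_fracInt hν t).aestronglyMeasurable]
  simp_rw [fracInt_sq]
  exact (integrable_triple_kernel hν he he0 t (by linarith)).integral_prod_right

/-- The kernel |s - r|^{2e+1} is symmetric, so the halves r < s and s < r contribute equally.
Keeping only r < s makes the inner integral depend on the past of s alone. -/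
lemma integral_fracInt_sq (hν : Continuous ν) (he : -1 < e) (he0 : e < -(1 / 2)) (t : ℝ) :
    ∫ x, fracInt e ν t x ^ 2 = 2 * posPowCorr e *
      ∫ s in Ico 0 t, ν s * ∫ r in Ico 0 t, ν r * posPow (2 * e + 1) (s - r) := by
  simp_rw [fracInt_sq]
  rw [← integral_integral_swap (integrable_triple_kernel hν he he0 t (by linarith))]
  have hE := integrable_prod_posPow_sub (e := 2 * e + 1) (by linarith) (by linarith) t
  obtain ⟨M, hM0, hM⟩ := exists_forall_abs_le hν 0 t
  have hmem : ∀ᵐ p : ℝ × ℝ ∂(volume.restrict (Ico 0 t)).prod (volume.restrict (Ico 0 t)),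
      p ∈ Ico 0 t ×ˢ Ico 0 t := by
    rw [Measure.prod_restrict]
    exact ae_restrict_mem (measurableSet_Ico.prod measurableSet_Ico)
  have hF : Integrable (fun p : ℝ × ℝ => (ν p.1 * ν p.2) * posPow (2 * e + 1) (p.1 - p.2))
      ((volume.restrict (Ico 0 t)).prod (volume.restrict (Ico 0 t))) := by
    refine hE.bdd_mul (c := M * M) (by fun_prop) ?_
    filter_upwards [hmem] with p hp
    rw [norm_mul]
    exact mul_le_mul (hM _ (Ico_subset_Icc_self hp.1)) (hM _ (Ico_subset_Icc_self hp.2))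
      (norm_nonneg _) hM0
  have h1 : ∫ p, ∫ x, (ν p.1 * posPow e (p.1 - x)) * (ν p.2 * posPow e (p.2 - x))
      ∂volume ∂(volume.restrict (Ico 0 t)).prod (volume.restrict (Ico 0 t)) =
      ∫ p, posPowCorr e * ((ν p.1 * ν p.2) * posPow (2 * e + 1) (p.1 - p.2) +
        (ν p.2 * ν p.1) * posPow (2 * e + 1) (p.2 - p.1))
        ∂(volume.restrict (Ico 0 t)).prod (volume.restrict (Ico 0 t)) := by
    refine integral_congr_ae ?_
    filter_upwards [ae_prod_restrict_ne (Ico (0 : ℝ) t)] with p hp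
    have h2 : ∀ x : ℝ, (ν p.1 * posPow e (p.1 - x)) * (ν p.2 * posPow e (p.2 - x)) =
        (ν p.1 * ν p.2) * (posPow e (p.1 - x) * posPow e (p.2 - x)) := fun x => by ring
    simp_rw [h2]
    rw [integral_const_mul, (integrable_posPow_sub_mul_posPow_sub he he0 hp).2]
    ring
  have h3 := integral_prod_swap (μ := volume.restrict (Ico 0 t)) (ν := volume.restrict (Ico 0 t))
    fun p : ℝ × ℝ => (ν p.1 * ν p.2) * posPow (2 * e + 1) (p.1 - p.2)
  simp only [Prod.fst_swap, Prod.snd_swap] at h3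
  have hF' : Integrable (fun p : ℝ × ℝ => (ν p.2 * ν p.1) * posPow (2 * e + 1) (p.2 - p.1))
      ((volume.restrict (Ico 0 t)).prod (volume.restrict (Ico 0 t))) := hF.swap
  rw [h1, integral_const_mul, integral_add hF hF', h3, integral_prod _ hF]
  simp_rw [mul_assoc, integral_const_mul]
  ring

end kernel

end RSFBM

namespace RSFBM

lemma hurstConst_pos {H : ℝ} (hH : 0 < H) : 0 < hurstConst H := by
  refine mul_pos (Real.Gamma_pos_of_pos (by linarith)) (Real.rpow_pos_of_pos ?_ _)
  have : 0 ≤ ∫ s in Ioi (0 : ℝ), ((1 + s) ^ (H - 1 / 2) - s ^ (H - 1 / 2)) ^ 2 :=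
    integral_nonneg fun _ => sq_nonneg _
  positivity

/-! ### Fractional integrals for H > 1/2 and the zeros of their norm -/

section weyl

variable {H : ℝ} {ν : ℝ → ℝ}

lemma MMinus_of_gt (hH : 1 / 2 < H) (hH1 : H < 1) {t : ℝ} (ht : 0 ≤ t) (x : ℝ) :
    MMinus H (fun s => ν s * signedIndicator 0 t s) x =
      hurstConst H / Real.Gamma (H - 1 / 2) * fracInt (H - 3 / 2) ν t x := by
  rw [MMinus, if_pos hH, fracInt, ← integral_indicator measurableSet_Ioi,
    ← integral_indicator measurableSet_Ico]
  congr 1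
  refine integral_congr_ae (ae_of_all _ fun s => ?_)
  by_cases hs : s ∈ Ico 0 t
  · by_cases hx : x < s
    · rw [indicator_of_mem (mem_Ioi.2 hx), indicator_of_mem hs, posPow_of_pos (sub_pos.2 hx),
        signedIndicator_of_nonneg ht, indicator_of_mem hs, mul_one]
    · rw [indicator_of_notMem (by simpa using hx), indicator_of_mem hs,
        posPow_of_nonpos (by linarith) (by linarith), mul_zero]
  · simp only [indicator, signedIndicator_of_nonneg ht, hs, if_false, mul_zero, zero_mul, ite_self]

lemma MPlus_schwartz_of_gt (hH : 1 / 2 < H) (hH1 : H < 1) (η : 𝓢(ℝ, ℝ)) (s : ℝ) :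
    MPlus H η s = hurstConst H / Real.Gamma (H - 1 / 2) *
      ∫ x, posPow (H - 3 / 2) (s - x) * η x := by
  rw [MPlus, if_pos hH, ← integral_indicator measurableSet_Iio]
  congr 1
  refine integral_congr_ae (ae_of_all _ fun x => ?_)
  beta_reduce
  by_cases hx : x < s
  · rw [indicator_of_mem (mem_Iio.2 hx), posPow_of_pos (sub_pos.2 hx), mul_comm]
  · rw [indicator_of_notMem (by simpa using hx), posPow_of_nonpos (by linarith) (by linarith),
      zero_mul]

lemma integrable_prod_posPow_sub_mul_schwartz (hν : Continuous ν) {e : ℝ} (he : -1 < e)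
    (he0 : e < 0) (t : ℝ) (η : 𝓢(ℝ, ℝ)) :
    Integrable (fun p : ℝ × ℝ => ν p.1 * (posPow e (p.1 - p.2) * η p.2))
      ((volume.restrict (Ico 0 t)).prod volume) := by
  have hm : Measurable fun p : ℝ × ℝ => ν p.1 * (posPow e (p.1 - p.2) * η p.2) := by
    have := hν.measurable
    have := η.continuous.measurable
    fun_prop
  obtain ⟨M, hM0, hM⟩ := exists_forall_abs_le hν 0 t
  rw [integrable_prod_iff hm.aestronglyMeasurable]
  refine ⟨ae_of_all _ fun s => (integrable_posPow_mul_schwartz η he he0 s).const_mul (ν s), ?_⟩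
  refine ((integrable_prod_schwartz_mul_rpow η he he0 t).norm.integral_prod_left.const_mul M).mono'
    hm.norm.stronglyMeasurable.integral_prod_right'.aestronglyMeasurable ?_
  filter_upwards [ae_restrict_mem measurableSet_Ico] with s hs
  rw [Real.norm_of_nonneg (integral_nonneg fun _ => norm_nonneg _)]
  simp_rw [norm_mul (ν s)]
  rw [integral_const_mul]
  have h1 : (fun x => ‖posPow e (s - x) * η x‖) =
      fun x => (Ioi 0).indicator (fun r => ‖η (s - r) * r ^ e‖) (s - x) := by
    ext x
    rw [congrFun (posPow_mul_schwartz_eq_indicator η he0 s) x, norm_indicator_eq_indicator_norm]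
  rw [h1, integral_sub_left_eq_self ((Ioi 0).indicator fun r => ‖η (s - r) * r ^ e‖),
    integral_indicator measurableSet_Ioi]
  exact mul_le_mul_of_nonneg_right (hM s (Ico_subset_Icc_self hs))
    (integral_nonneg fun _ => norm_nonneg _)

lemma setIntegral_MPlus_of_gt (hH : 1 / 2 < H) (hH1 : H < 1) (hν : Continuous ν) {t : ℝ}
    (ht : 0 ≤ t) (η : 𝓢(ℝ, ℝ)) :
    ∫ s in Ico 0 t, ν s * MPlus H η s =
      ∫ x, MMinus H (fun s => ν s * signedIndicator 0 t s) x * η x := by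
  set C := hurstConst H / Real.Gamma (H - 1 / 2) with hC
  have h1 : ∀ s, ν s * MPlus H η s =
      C * ∫ x, ν s * (posPow (H - 3 / 2) (s - x) * η x) := fun s => by
    rw [MPlus_schwartz_of_gt hH hH1, integral_const_mul]
    ring
  have h2 : ∀ x, MMinus H (fun s => ν s * signedIndicator 0 t s) x * η x =
      C * ∫ s in Ico 0 t, ν s * (posPow (H - 3 / 2) (s - x) * η x) := fun x => by
    rw [MMinus_of_gt hH hH1 ht, mul_assoc, fracInt, ← integral_mul_const]
    simp_rw [mul_assoc]
    rfl
  simp_rw [h1, h2]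
  rw [integral_const_mul, integral_const_mul, integral_integral_swap
    (integrable_prod_posPow_sub_mul_schwartz hν (by linarith) (by linarith) t η)]

lemma memLp_MMinus_of_gt (hH : 1 / 2 < H) (hH1 : H < 1) (hν : Continuous ν) {t : ℝ}
    (ht : 0 ≤ t) : MemLp (MMinus H fun s => ν s * signedIndicator 0 t s) 2 volume := by
  rw [funext fun x => MMinus_of_gt (ν := ν) hH hH1 ht x]
  exact (memLp_fracInt hν (by linarith) (by linarith) t).const_mul _

/-- The fractional integral `∫_0^s ν(r) (s - r) ^ e dr`, in a form that is continuous in `s`. -/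
noncomputable def convPow (e : ℝ) (ν : ℝ → ℝ) (s : ℝ) : ℝ :=
  s ^ (e + 1) * ∫ ρ in (0 : ℝ)..1, ν (s - s * ρ) * ρ ^ e

lemma continuous_convPow (hν : Continuous ν) {e : ℝ} (he : -1 < e) : Continuous (convPow e ν) := by
  refine (Real.continuous_rpow_const (by linarith)).mul ?_
  simp_rw [intervalIntegral.integral_of_le zero_le_one]
  refine continuous_iff_continuousAt.2 fun s₀ => ?_
  obtain ⟨M, hM0, hM⟩ := exists_forall_abs_le hν (-(|s₀| + 1)) (|s₀| + 1)
  refine continuousAt_of_dominated (bound := fun ρ => M * ρ ^ e) (Eventually.of_forall fun s => ?_)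
    ?_ ((integrableOn_rpow_Ioc he 1).const_mul M) (ae_of_all _ fun ρ => ?_)
  · exact ((hν.comp (by fun_prop : Continuous fun ρ => s - s * ρ)).measurable.mul
      (by fun_prop)).aestronglyMeasurable
  · filter_upwards [Metric.ball_mem_nhds s₀ one_pos] with s hs
    filter_upwards [ae_restrict_mem measurableSet_Ioc] with ρ hρ
    have h0 := Real.rpow_nonneg hρ.1.le e
    rw [norm_mul, Real.norm_of_nonneg h0]
    refine mul_le_mul_of_nonneg_right (hM _ ?_) h0
    rw [mem_Icc, ← abs_le]
    have h1 : s - s * ρ = s * (1 - ρ) := by ring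
    have h2 : |s| ≤ |s₀| + 1 := by
      rw [Metric.mem_ball, Real.dist_eq] at hs
      linarith [abs_sub_abs_le_abs_sub s s₀]
    rw [h1, abs_mul, abs_of_nonneg (by linarith [hρ.2] : (0 : ℝ) ≤ 1 - ρ)]
    nlinarith [abs_nonneg s, hρ.1, hρ.2]
  · exact ((hν.comp (by fun_prop : Continuous fun s => s - s * ρ)).mul
      continuous_const).continuousAt

lemma convPow_eq_setIntegral {e : ℝ} (he0 : e + 1 ≠ 0) {s : ℝ} (hs : 0 ≤ s) :
    convPow e ν s = ∫ y in Ioc 0 s, ν (s - y) * y ^ e := by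
  rcases hs.eq_or_lt with rfl | hs0
  · simp [convPow, Real.zero_rpow he0]
  · have h1 := intervalIntegral.integral_comp_mul_left (a := 0) (b := 1)
      (fun y => ν (s - y) * y ^ e) hs0.ne'
    have h2 : ∫ ρ in (0 : ℝ)..1, ν (s - s * ρ) * (s * ρ) ^ e =
        s ^ e * ∫ ρ in (0 : ℝ)..1, ν (s - s * ρ) * ρ ^ e := by
      rw [← intervalIntegral.integral_const_mul]
      refine intervalIntegral.integral_congr fun ρ hρ => ?_
      rw [uIcc_of_le zero_le_one] at hρ
      rw [Real.mul_rpow hs hρ.1]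
      ring
    rw [h2, mul_zero, mul_one, intervalIntegral.integral_of_le hs, smul_eq_mul] at h1
    rw [convPow, Real.rpow_add hs0, Real.rpow_one, mul_comm (s ^ e), mul_assoc, h1]
    field_simp

/-- The positive part sees only r < s, so the upper limit t disappears. This turns the squared norm
into a primitive of a function independent of t. -/
lemma setIntegral_mul_posPow_sub {e : ℝ} (he0 : e ≠ 0) (he1 : e + 1 ≠ 0) {t s : ℝ}
    (hs : s ∈ Ico 0 t) : ∫ r in Ico 0 t, ν r * posPow e (s - r) = convPow e ν s := by
  rw [convPow_eq_setIntegral he1 hs.1, ← integral_indicator measurableSet_Ico,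
    ← integral_indicator measurableSet_Ioc, ← integral_sub_left_eq_self _ _ s]
  refine integral_congr_ae (ae_of_all _ fun y => ?_)
  beta_reduce
  simp only [indicator, mem_Ico, mem_Ioc, sub_sub_cancel]
  by_cases hy : 0 < y
  · have : (0 ≤ s - y ∧ s - y < t) ↔ (0 < y ∧ y ≤ s) :=
      ⟨fun h => ⟨hy, by linarith [h.1]⟩, fun h => ⟨by linarith [h.2], by linarith [hs.2]⟩⟩
    simp only [this, posPow_of_pos hy]
  · simp [hy, posPow_of_nonpos he0 (not_lt.1 hy)]

/-- The density of the squared norm of `M_-^H (ν 1_{(0,t)})` as a function of `t`. -/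
noncomputable def normSqDensity (H : ℝ) (ν : ℝ → ℝ) (s : ℝ) : ℝ :=
  (hurstConst H / Real.Gamma (H - 1 / 2)) ^ 2 * (2 * posPowCorr (H - 3 / 2)) *
    (ν s * convPow (2 * H - 2) ν s)

lemma continuous_normSqDensity (hH : 1 / 2 < H) (hν : Continuous ν) :
    Continuous (normSqDensity H ν) :=
  continuous_const.mul (hν.mul (continuous_convPow hν (by linarith)))

lemma integral_sq_MMinus_of_gt (hH : 1 / 2 < H) (hH1 : H < 1) (hν : Continuous ν) {t : ℝ}
    (ht : 0 ≤ t) : ∫ x, MMinus H (fun s => ν s * signedIndicator 0 t s) x ^ 2 =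
      ∫ s in (0 : ℝ)..t, normSqDensity H ν s := by
  simp_rw [MMinus_of_gt hH hH1 ht, mul_pow, normSqDensity]
  rw [integral_const_mul, integral_fracInt_sq hν (by linarith) (by linarith),
    intervalIntegral.integral_const_mul, intervalIntegral.integral_of_le ht,
    ← setIntegral_congr_set (Ico_ae_eq_Ioc (a := (0 : ℝ)) (b := t)), ← mul_assoc]
  congr 1
  refine setIntegral_congr_fun measurableSet_Ico fun s hs => ?_
  rw [show 2 * (H - 3 / 2) + 1 = 2 * H - 2 by ring,
    setIntegral_mul_posPow_sub (by linarith) (by linarith) hs]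

lemma integrableOn_mul_posPow_sub (hν : Continuous ν) {e : ℝ} (he : -1 < e) (he0 : e < 0) (a b x : ℝ) :
    IntegrableOn (fun r => ν r * posPow e (r - x)) (Ico a b) := by
  obtain ⟨M, hM0, hM⟩ := exists_forall_abs_le hν a b
  have h1 : IntegrableOn (fun r => posPow e (r - x)) (Ico a b) := by
    have i1 : Integrable ((Ioc 0 (b - x)).indicator fun r : ℝ => r ^ e) :=
      (integrable_indicator_iff measurableSet_Ioc).2 (integrableOn_rpow_Ioc he _)
    refine (i1.comp_sub_right x).integrableOn.congr_fun (fun r hr => ?_) measurableSet_Ico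
    beta_reduce
    rcases le_or_gt (r - x) 0 with h | h
    · rw [posPow_of_nonpos he0.ne h, indicator_of_notMem fun h' => h'.1.not_ge h]
    · rw [posPow_of_pos h, indicator_of_mem]
      exact ⟨h, by linarith [hr.2]⟩
  refine h1.bdd_mul (c := M) hν.aestronglyMeasurable ?_
  filter_upwards [ae_restrict_mem measurableSet_Ico] with r hr
  exact hM r (Ico_subset_Icc_self hr)

/-- If the norm vanishes on an interval, so does the integrand. -/
lemma eq_zero_of_integral_sq_MMinus_eq_zero (hH : 1 / 2 < H) (hH1 : H < 1) (hν : Continuous ν)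
    {t : ℝ} (hV : ∀ s ∈ Icc 0 t,
      ∫ x, MMinus H (fun r => ν r * signedIndicator 0 s r) x ^ 2 = 0) {s : ℝ} (hs : s ∈ Ioo 0 t) :
    ν s = 0 := by
  by_contra hne
  have hc : hurstConst H / Real.Gamma (H - 1 / 2) ≠ 0 :=
    (div_pos (hurstConst_pos (by linarith)) (Real.Gamma_pos_of_pos (by linarith))).ne'
  have h0 : ∀ r ∈ Icc 0 t, ∀ᵐ x, fracInt (H - 3 / 2) ν r x = 0 := by
    intro r hr
    have h1 := hV r hr
    rw [integral_eq_zero_iff_of_nonneg (fun _ => sq_nonneg _)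
      (memLp_MMinus_of_gt hH hH1 hν hr.1).integrable_sq] at h1
    filter_upwards [h1] with x hx
    have h2 : MMinus H (fun s => ν s * signedIndicator 0 r s) x = 0 := by simpa using hx
    rw [MMinus_of_gt hH hH1 hr.1] at h2
    exact (mul_eq_zero.1 h2).resolve_left hc
  have hev : ∀ᶠ r in 𝓝 s, 0 < ν s * ν r :=
    (continuous_const.mul hν).continuousAt.eventually_const_lt (mul_self_pos.2 hne)
  obtain ⟨a, b, hab, hsub⟩ : ∃ a b, s ∈ Ioo a b ∧ Ioo a b ⊆ {r | 0 < ν s * ν r} ∩ Ioo 0 t :=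
    (mem_nhds_iff_exists_Ioo_subset.1 (inter_mem hev (Ioo_mem_nhds hs.1 hs.2)))
  obtain ⟨a', ha', ha's⟩ := exists_between hab.1
  have hpos : ∀ r ∈ Icc a' s, 0 < ν s * ν r := fun r hr =>
    (hsub ⟨ha'.trans_le hr.1, hr.2.trans_lt hab.2⟩).1
  have ha'I : a' ∈ Icc 0 t := Ioo_subset_Icc_self (hsub ⟨ha', ha's.trans hab.2⟩).2
  -- At such a point x, to the left of a', the fractional integrals up to a' and up to s both
  -- vanish. Their difference is an integral over [a', s) of ν, which has constant sign there,
  -- against a positive kernel: a contradiction.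
  obtain ⟨x, hx1, hx2, hx⟩ : ∃ x, fracInt (H - 3 / 2) ν a' x = 0 ∧
      fracInt (H - 3 / 2) ν s x = 0 ∧ x < a' := by
    have h1 := (h0 a' ha'I).and (h0 s (Ioo_subset_Icc_self hs))
    have h2 : ∃ᶠ x in ae volume, x < a' := by
      rw [frequently_ae_iff]
      change volume (Iio a') ≠ 0
      simp
    obtain ⟨x, hxa, hx1, hx2⟩ := (h2.and_eventually h1).exists
    exact ⟨x, hx1, hx2, hxa⟩
  have hcont : ContinuousOn (fun r => ν r * posPow (H - 3 / 2) (r - x)) (Icc a' s) := by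
    refine hν.continuousOn.mul (ContinuousOn.congr (f := fun r => (r - x) ^ (H - 3 / 2)) ?_ ?_)
    · exact ContinuousOn.rpow_const (by fun_prop)
        fun r hr => Or.inl (by linarith [hr.1] : 0 < r - x).ne'
    · exact fun r hr => posPow_of_pos (by linarith [hr.1])
  have hint : IntervalIntegrable (fun r => ν r * posPow (H - 3 / 2) (r - x)) volume a' s :=
    ContinuousOn.intervalIntegrable (by rwa [uIcc_of_le ha's.le])
  have h3 : 0 < ∫ r in a'..s, ν s * (ν r * posPow (H - 3 / 2) (r - x)) := by
    refine intervalIntegral.intervalIntegral_pos_of_pos_on (hint.const_mul _) (fun r hr => ?_) ha's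
    rw [← mul_assoc, posPow_of_pos (by linarith [hr.1])]
    exact mul_pos (hpos r (Ioo_subset_Icc_self hr)) (Real.rpow_pos_of_pos (by linarith [hr.1]) _)
  have h4 := setIntegral_union (Ico_disjoint_Ico_same (a := 0) (b := a') (c := s))
    measurableSet_Ico (integrableOn_mul_posPow_sub hν (by linarith) (by linarith) 0 a' x)
    (integrableOn_mul_posPow_sub hν (e := H - 3 / 2) (by linarith) (by linarith) a' s x)
  rw [Ico_union_Ico_eq_Ico ha'I.1 ha's.le] at h4
  rw [fracInt] at hx1 hx2
  rw [hx1, hx2, zero_add, setIntegral_congr_set Ico_ae_eq_Ioc,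
    ← intervalIntegral.integral_of_le ha's.le] at h4
  rw [intervalIntegral.integral_const_mul, ← h4, mul_zero] at h3
  exact lt_irrefl _ h3

/-- Only y ≤ s - t contributes, since ν(s - y) = 0 for larger y. -/
lemma abs_convPow_le {e : ℝ} (he : -1 < e) {t s ε : ℝ} (ht : 0 ≤ t) (hts : t ≤ s)
    (hν0 : ∀ r ∈ Icc 0 t, ν r = 0) (hε : ∀ r ∈ Icc t s, |ν r| ≤ ε) :
    |convPow e ν s| ≤ ε * ((s - t) ^ (e + 1) / (e + 1)) := by
  have hst : 0 ≤ s - t := sub_nonneg.2 hts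
  rw [convPow_eq_setIntegral (by linarith) (ht.trans hts), ← Real.norm_eq_abs]
  have hb : Integrable ((Ioc 0 (s - t)).indicator fun y : ℝ => ε * y ^ e) :=
    (integrable_indicator_iff measurableSet_Ioc).2 ((integrableOn_rpow_Ioc he _).const_mul ε)
  have h1 : ∫ y in Ioc 0 s, (Ioc 0 (s - t)).indicator (fun y : ℝ => ε * y ^ e) y =
      ε * ((s - t) ^ (e + 1) / (e + 1)) := by
    rw [setIntegral_indicator measurableSet_Ioc,
      inter_eq_right.2 (Ioc_subset_Ioc_right (by linarith)), integral_const_mul,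
      ← intervalIntegral.integral_of_le hst, integral_rpow (Or.inl he),
      Real.zero_rpow (by linarith), sub_zero]
  rw [← h1]
  refine norm_integral_le_of_norm_le hb.integrableOn ?_
  filter_upwards [ae_restrict_mem measurableSet_Ioc] with y hy
  by_cases hyt : y ≤ s - t
  · rw [indicator_of_mem (mem_Ioc.2 ⟨hy.1, hyt⟩), norm_mul,
      Real.norm_of_nonneg (Real.rpow_nonneg hy.1.le e)]
    exact mul_le_mul_of_nonneg_right (hε _ ⟨by linarith, by linarith [hy.1]⟩)
      (Real.rpow_nonneg hy.1.le e)
  · rw [indicator_of_notMem fun h => hyt h.2, hν0 _ ⟨by linarith [hy.2], by linarith⟩]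
    simp

/-- The exponent 1/(2H) is below 1, so the chain rule fails where the base vanishes. Instead, |ν| ≤
ε just after t bounds the density by a constant times ε²(s - t)^{2H-1}. The integral is then O(ε²(s
- t)^{2H}), and its power is o(s - t). -/
lemma hasDerivAt_rpow_integral_normSqDensity (hH : 1 / 2 < H) (hH1 : H < 1) (hν : Continuous ν)
    {t : ℝ} (ht : 0 < t) (hν0 : ∀ r ∈ Icc 0 t, ν r = 0) :
    HasDerivAt (fun s => (∫ r in (0 : ℝ)..s, normSqDensity H ν r) ^ (1 / (2 * H))) 0 t := by
  set D := (hurstConst H / Real.Gamma (H - 1 / 2)) ^ 2 * (2 * posPowCorr (H - 3 / 2)) with hD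
  have hD0 : 0 ≤ D := mul_nonneg (sq_nonneg _) (mul_nonneg two_pos.le (posPowCorr_nonneg _))
  have hp : 1 / (2 * H) ≠ 0 := by positivity
  have hE : (0 : ℝ) < 2 * H - 1 := by linarith
  have hzero : ∀ s ∈ Icc 0 t, ∫ r in (0 : ℝ)..s, normSqDensity H ν r = 0 := by
    intro s hs
    refine (intervalIntegral.integral_congr fun r hr => ?_).trans intervalIntegral.integral_zero
    rw [uIcc_of_le hs.1] at hr
    simp [normSqDensity, hν0 r ⟨hr.1, hr.2.trans hs.2⟩]
  rw [hasDerivAt_iff_isLittleO, Asymptotics.isLittleO_iff]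
  intro c hc
  simp only [smul_zero, sub_zero, hzero t ⟨ht.le, le_rfl⟩, Real.zero_rpow hp]
  -- Chosen so that D ε²/(2H - 1) ≤ c^{2H}; the summand 1 makes positivity of D unnecessary.
  set ε := √(c ^ (2 * H) / (D / (2 * H - 1) + 1)) with hε
  have hcp : 0 < c ^ (2 * H) := Real.rpow_pos_of_pos hc _
  have hD1 : 0 ≤ D / (2 * H - 1) := div_nonneg hD0 hE.le
  have hε0 : 0 < ε := Real.sqrt_pos.2 (by positivity)
  have hεD : D / (2 * H - 1) * ε ^ 2 ≤ c ^ (2 * H) := by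
    rw [hε, Real.sq_sqrt (by positivity), mul_div_assoc', div_le_iff₀ (by positivity)]
    nlinarith
  have hsmall : ∀ᶠ r in 𝓝 t, |ν r| < ε := by
    refine hν.abs.continuousAt.eventually_lt_const ?_
    beta_reduce
    rw [hν0 t ⟨ht.le, le_rfl⟩, abs_zero]
    exact hε0
  obtain ⟨d, hd, hball⟩ := Metric.eventually_nhds_iff.1 hsmall
  filter_upwards [Metric.ball_mem_nhds t hd, Ioi_mem_nhds ht] with s hs hs0
  rcases le_or_gt s t with hst | hst
  · rw [hzero s ⟨le_of_lt hs0, hst⟩, Real.zero_rpow hp, norm_zero]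
    positivity
  have hst0 : 0 < s - t := sub_pos.2 hst
  have hνε : ∀ r ∈ Icc t s, |ν r| ≤ ε := by
    intro r hr
    refine (hball ?_).le
    rw [Metric.mem_ball, Real.dist_eq, abs_of_pos hst0] at hs
    rw [Real.dist_eq, abs_of_nonneg (by linarith [hr.1])]
    linarith [hr.2]
  have hV0 : 0 ≤ ∫ r in (0 : ℝ)..s, normSqDensity H ν r := by
    rw [← integral_sq_MMinus_of_gt hH hH1 hν (le_of_lt hs0)]
    exact integral_nonneg fun _ => sq_nonneg _
  have hψ : ∀ r ∈ uIoc t s, ‖normSqDensity H ν r‖ ≤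
      D * (ε * (ε * ((s - t) ^ (2 * H - 1) / (2 * H - 1)))) := by
    intro r hr
    rw [uIoc_of_le hst.le] at hr
    have h1 := abs_convPow_le (e := 2 * H - 2) (by linarith) ht.le hr.1.le hν0
      fun q hq => hνε q ⟨hq.1, hq.2.trans hr.2⟩
    rw [show 2 * H - 2 + 1 = 2 * H - 1 by ring] at h1
    rw [normSqDensity, norm_mul, Real.norm_of_nonneg hD0, norm_mul, Real.norm_eq_abs,
      Real.norm_eq_abs]
    refine mul_le_mul_of_nonneg_left (mul_le_mul (hνε r ⟨hr.1.le, hr.2⟩) (h1.trans ?_)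
      (abs_nonneg _) hε0.le) hD0
    have : (r - t) ^ (2 * H - 1) ≤ (s - t) ^ (2 * H - 1) :=
      Real.rpow_le_rpow (by linarith [hr.1]) (by linarith [hr.2]) hE.le
    gcongr
  have hV : ∫ r in (0 : ℝ)..s, normSqDensity H ν r ≤ (c * (s - t)) ^ (2 * H) := by
    have hcont := continuous_normSqDensity hH hν
    have h2 := intervalIntegral.norm_integral_le_of_norm_le_const hψ
    rw [← intervalIntegral.integral_add_adjacent_intervals (hcont.intervalIntegrable 0 t)
      (hcont.intervalIntegrable t s), hzero t ⟨ht.le, le_rfl⟩, zero_add]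
    refine (le_abs_self _).trans (h2.trans ?_)
    rw [abs_of_pos hst0, Real.mul_rpow hc.le hst0.le]
    have h3 : (s - t) ^ (2 * H) = (s - t) ^ (2 * H - 1) * (s - t) := by
      nth_rw 3 [← Real.rpow_one (s - t)]
      rw [← Real.rpow_add hst0, sub_add_cancel]
    rw [h3]
    calc D * (ε * (ε * ((s - t) ^ (2 * H - 1) / (2 * H - 1)))) * (s - t)
        = (D / (2 * H - 1) * ε ^ 2) * ((s - t) ^ (2 * H - 1) * (s - t)) := by ring
      _ ≤ c ^ (2 * H) * ((s - t) ^ (2 * H - 1) * (s - t)) := by gcongr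
  rw [Real.norm_of_nonneg (Real.rpow_nonneg hV0 _), Real.norm_of_nonneg hst0.le]
  calc (∫ r in (0 : ℝ)..s, normSqDensity H ν r) ^ (1 / (2 * H))
      ≤ ((c * (s - t)) ^ (2 * H)) ^ (1 / (2 * H)) := by gcongr
    _ = c * (s - t) := by
      rw [← Real.rpow_mul (by positivity), mul_one_div_cancel (by positivity), Real.rpow_one]

end weyl

end RSFBM

namespace RSFBM

/-! ### The squared norm of `M_-^H (ν 1_{(0,t)})` and the time change -/

section timeChange

variable {H : ℝ} {ν : ℝ → ℝ}

/-- The squared norm of `M_-^H (ν 1_{(0,t)})` in `L²(ℝ)`. -/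
noncomputable def normSq (H : ℝ) (ν : ℝ → ℝ) (t : ℝ) : ℝ :=
  ∫ x, MMinus H (fun s => ν s * signedIndicator 0 t s) x ^ 2

lemma normSq_nonneg (t : ℝ) : 0 ≤ normSq H ν t := integral_nonneg fun _ => sq_nonneg _

lemma mul_signedIndicator_apply (ν : ℝ → ℝ) {t : ℝ} (ht : 0 ≤ t) (s : ℝ) :
    ν s * signedIndicator 0 t s = (Ico 0 t).indicator ν s := by
  rw [signedIndicator_of_nonneg ht]
  by_cases hs : s ∈ Ico 0 t
  · rw [indicator_of_mem hs, indicator_of_mem hs, mul_one]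
  · rw [indicator_of_notMem hs, indicator_of_notMem hs, mul_zero]

lemma mul_signedIndicator_eq_indicator {t : ℝ} (ht : 0 ≤ t) :
    (fun s => ν s * signedIndicator 0 t s) = (Ico 0 t).indicator ν :=
  funext (mul_signedIndicator_apply ν ht)

/-- As ν is continuous on [0,∞) only, it is replaced by its constant continuation to the left, which
is continuous on ℝ. -/
lemma mul_signedIndicator_max {t : ℝ} (ht : 0 ≤ t) :
    (fun s => ν s * signedIndicator 0 t s) = fun s => ν (max s 0) * signedIndicator 0 t s := by
  rw [mul_signedIndicator_eq_indicator ht,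
    mul_signedIndicator_eq_indicator (ν := fun s => ν (max s 0)) ht]
  refine indicator_congr fun s hs => ?_
  rw [max_eq_left hs.1]

lemma continuous_comp_max (hν : ContinuousOn ν (Ici 0)) : Continuous fun s => ν (max s 0) :=
  hν.comp_continuous (continuous_id.max continuous_const) fun s => mem_Ici.2 (le_max_right s 0)

lemma MMinus_half (f : ℝ → ℝ) : MMinus (1 / 2) f = f := by
  ext x
  rw [MMinus, if_neg (lt_irrefl _), if_pos rfl]

lemma MPlus_half (f : ℝ → ℝ) : MPlus (1 / 2) f = f := by
  ext x
  rw [MPlus, if_neg (lt_irrefl _), if_pos rfl]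

lemma memLp_MMinus (hH : H ∈ Ioo (0 : ℝ) 1) (hν : ContinuousOn ν (Ici 0))
    (hconst : H < 1 / 2 → ∃ c : ℝ, ∀ s, 0 ≤ s → ν s = c) {t : ℝ} (ht : 0 ≤ t) :
    MemLp (MMinus H fun s => ν s * signedIndicator 0 t s) 2 volume := by
  rcases lt_trichotomy H (1 / 2) with h | h | h
  · obtain ⟨κ, hκ⟩ := hconst h
    exact memLp_MMinus_of_lt hH.1 h hκ ht
  · rw [h, MMinus_half, mul_signedIndicator_max ht, mul_signedIndicator_eq_indicator
      (ν := fun s => ν (max s 0)) ht, memLp_indicator_iff_restrict measurableSet_Ico]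
    have hc := continuous_comp_max hν
    obtain ⟨M, -, hM⟩ := exists_forall_abs_le hc 0 t
    refine MemLp.of_bound hc.aestronglyMeasurable M ?_
    filter_upwards [ae_restrict_mem measurableSet_Ico] with s hs
    exact hM s (Ico_subset_Icc_self hs)
  · rw [mul_signedIndicator_max ht]
    exact memLp_MMinus_of_gt h hH.2 (continuous_comp_max hν) ht

lemma setIntegral_MPlus (hH : H ∈ Ioo (0 : ℝ) 1) (hν : ContinuousOn ν (Ici 0))
    (hconst : H < 1 / 2 → ∃ c : ℝ, ∀ s, 0 ≤ s → ν s = c) {t : ℝ} (ht : 0 ≤ t) (η : 𝓢(ℝ, ℝ)) :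
    ∫ s in Ico 0 t, ν s * MPlus H η s =
      ∫ x, MMinus H (fun s => ν s * signedIndicator 0 t s) x * η x := by
  rcases lt_trichotomy H (1 / 2) with h | h | h
  · obtain ⟨κ, hκ⟩ := hconst h
    exact setIntegral_MPlus_of_lt hH.1 h hκ ht η
  · rw [h, MMinus_half, MPlus_half, ← integral_indicator measurableSet_Ico]
    refine integral_congr_ae (ae_of_all _ fun s => ?_)
    simp only [mul_signedIndicator_apply ν ht, indicator]
    split_ifs <;> simp
  · rw [mul_signedIndicator_max ht, ← setIntegral_MPlus_of_gt h hH.2 (continuous_comp_max hν) ht]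
    refine setIntegral_congr_fun measurableSet_Ico fun s hs => ?_
    rw [max_eq_left hs.1]

lemma normSq_zero : normSq H ν 0 = 0 := by
  have h1 : (fun s => ν s * signedIndicator 0 0 s) = fun _ => (0 : ℝ) := by
    rw [mul_signedIndicator_eq_indicator le_rfl, Ico_self, indicator_empty]
  have h2 : MMinus H (fun _ => (0 : ℝ)) = fun _ => 0 := by
    ext x
    simp only [MMinus, zero_mul, integral_zero, mul_zero, sub_self, zero_div]
    rw [tendsto_const_nhds.limUnder_eq]
    simp
  rw [normSq, h1, h2]
  simp

lemma exists_normSq_eq_integral (hH1 : H < 1) (h : 1 / 2 ≤ H) (hν : ContinuousOn ν (Ici 0)) :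
    ∃ ψ : ℝ → ℝ, Continuous ψ ∧ ∀ t, 0 ≤ t → normSq H ν t = ∫ s in (0 : ℝ)..t, ψ s := by
  have hc := continuous_comp_max hν
  rcases h.eq_or_lt with rfl | h
  · refine ⟨fun s => ν (max s 0) ^ 2, hc.pow 2, fun t ht => ?_⟩
    rw [normSq, MMinus_half, intervalIntegral.integral_of_le ht,
      ← setIntegral_congr_set (Ico_ae_eq_Ioc (a := (0 : ℝ)) (b := t)),
      ← integral_indicator measurableSet_Ico]
    refine integral_congr_ae (ae_of_all _ fun s => ?_)
    simp only [mul_signedIndicator_apply ν ht, indicator, mem_Ico]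
    split_ifs with hs
    · rw [max_eq_left hs.1]
    · simp
  · refine ⟨_, continuous_normSqDensity h hc, fun t ht => ?_⟩
    rw [normSq, mul_signedIndicator_max ht]
    exact integral_sq_MMinus_of_gt h hH1 hc ht

lemma normSq_eq_of_lt (hH0 : 0 < H) (h : H < 1 / 2)
    (hconst : H < 1 / 2 → ∃ c : ℝ, ∀ s, 0 ≤ s → ν s = c) {t : ℝ} (ht : 0 ≤ t) :
    normSq H ν t = t ^ (2 * H) * normSq H ν 1 := by
  obtain ⟨κ, hκ⟩ := hconst h
  exact integral_sq_MMinus_of_lt hH0 h hκ ht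

lemma continuousOn_normSq (hH : H ∈ Ioo (0 : ℝ) 1) (hν : ContinuousOn ν (Ici 0))
    (hconst : H < 1 / 2 → ∃ c : ℝ, ∀ s, 0 ≤ s → ν s = c) :
    ContinuousOn (normSq H ν) (Ici 0) := by
  rcases lt_or_ge H (1 / 2) with h | h
  · refine ContinuousOn.congr (Continuous.continuousOn ?_) fun t ht =>
      normSq_eq_of_lt hH.1 h hconst ht
    exact (Real.continuous_rpow_const (by linarith [hH.1])).mul continuous_const
  · obtain ⟨ψ, hψ, heq⟩ := exists_normSq_eq_integral hH.2 h hν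
    exact (intervalIntegral.continuous_primitive (fun a b => hψ.intervalIntegrable a b)
      0).continuousOn.congr fun t ht => heq t ht

lemma timeChange_eq (hH : H ∈ Ioo (0 : ℝ) 1) (hν : ContinuousOn ν (Ici 0))
    (hconst : H < 1 / 2 → ∃ c : ℝ, ∀ s, 0 ≤ s → ν s = c) {t : ℝ} (ht : 0 ≤ t) :
    timeChange H ν t = normSq H ν t ^ (1 / (2 * H)) := by
  have h0 : 0 ≤ normSq H ν t := normSq_nonneg t
  rw [timeChange, eLpNorm_two_eq (memLp_MMinus hH hν hconst ht),
    ENNReal.toReal_ofReal (Real.sqrt_nonneg _), Real.sqrt_eq_rpow]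
  change (normSq H ν t ^ (1 / 2 : ℝ)) ^ (1 / H) = _
  rw [← Real.rpow_mul h0]
  congr 1
  have := hH.1.ne'
  field_simp

lemma timeChange_rpow (hH : H ∈ Ioo (0 : ℝ) 1) (hν : ContinuousOn ν (Ici 0))
    (hconst : H < 1 / 2 → ∃ c : ℝ, ∀ s, 0 ≤ s → ν s = c) {t : ℝ} (ht : 0 ≤ t) :
    timeChange H ν t ^ (2 * H) = normSq H ν t := by
  have := hH.1
  rw [timeChange_eq hH hν hconst ht, ← Real.rpow_mul (normSq_nonneg t),
    one_div_mul_cancel (by positivity), Real.rpow_one]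

/-- For H < 1/2 self-similarity makes the time change linear, and for H = 1/2 it equals the squared
norm itself. For H > 1/2 the chain rule settles the points where the squared norm is positive. -/
lemma differentiableAt_timeChange (hH : H ∈ Ioo (0 : ℝ) 1) (hν : ContinuousOn ν (Ici 0))
    (hconst : H < 1 / 2 → ∃ c : ℝ, ∀ s, 0 ≤ s → ν s = c)
    (hmono : MonotoneOn (normSq H ν) (Ici 0)) {t : ℝ} (ht : 0 < t) :
    DifferentiableAt ℝ (timeChange H ν) t := by
  have hH0 := hH.1
  have hev : timeChange H ν =ᶠ[𝓝 t] fun s => normSq H ν s ^ (1 / (2 * H)) := by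
    filter_upwards [Ioi_mem_nhds ht] with s hs using timeChange_eq hH hν hconst (le_of_lt hs)
  rw [hev.differentiableAt_iff]
  rcases lt_or_ge H (1 / 2) with h | h
  · have h1 : (fun s => normSq H ν s ^ (1 / (2 * H))) =ᶠ[𝓝 t]
        fun s => s * normSq H ν 1 ^ (1 / (2 * H)) := by
      filter_upwards [Ioi_mem_nhds ht] with s hs
      have hs0 : (0 : ℝ) < s := hs
      rw [normSq_eq_of_lt hH0 h hconst hs0.le,
        Real.mul_rpow (Real.rpow_nonneg hs0.le _) (normSq_nonneg _), ← Real.rpow_mul hs0.le,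
        mul_one_div_cancel (by positivity), Real.rpow_one]
    rw [h1.differentiableAt_iff]
    fun_prop
  · obtain ⟨ψ, hψ, heq⟩ := exists_normSq_eq_integral hH.2 h hν
    have h2 : normSq H ν =ᶠ[𝓝 t] fun s => ∫ r in (0 : ℝ)..s, ψ r := by
      filter_upwards [Ioi_mem_nhds ht] with s hs using heq s (le_of_lt hs)
    have h3 : DifferentiableAt ℝ (normSq H ν) t := by
      rw [h2.differentiableAt_iff]
      exact (hψ.integral_hasStrictDerivAt 0 t).hasDerivAt.differentiableAt
    rcases h.eq_or_lt with rfl | h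
    · norm_num
      exact h3
    -- At a zero, monotonicity makes the norm vanish on [0,t], so ν vanishes on (0,t) and by
    -- continuity up to the end points.
    rcases (normSq_nonneg (H := H) (ν := ν) t).eq_or_lt with h0 | h0
    · have hc := continuous_comp_max hν
      have hz : ∀ s ∈ Icc 0 t, normSq H ν s = 0 := fun s hs =>
        le_antisymm ((hmono hs.1 ht.le hs.2).trans h0.symm.le) (normSq_nonneg s)
      have hz' : ∀ s ∈ Icc 0 t, ∫ x, MMinus H
          (fun r => (fun r => ν (max r 0)) r * signedIndicator 0 s r) x ^ 2 = 0 := by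
        intro s hs
        rw [← mul_signedIndicator_max hs.1]
        exact hz s hs
      have hν0 : ∀ r ∈ Icc 0 t, ν (max r 0) = 0 := by
        have hcl : IsClosed {r | ν (max r 0) = 0} := isClosed_eq hc continuous_const
        have hsub : Ioo 0 t ⊆ {r | ν (max r 0) = 0} := fun r hr =>
          eq_zero_of_integral_sq_MMinus_eq_zero h hH.2 hc hz' hr
        have := hcl.closure_subset_iff.2 hsub
        rwa [closure_Ioo ht.ne] at this
      have h4 := hasDerivAt_rpow_integral_normSqDensity h hH.2 hc ht hν0
      have h5 : (fun s => normSq H ν s ^ (1 / (2 * H))) =ᶠ[𝓝 t] fun s =>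
          (∫ r in (0 : ℝ)..s, normSqDensity H (fun r => ν (max r 0)) r) ^ (1 / (2 * H)) := by
        filter_upwards [Ioi_mem_nhds ht] with s hs
        rw [← integral_sq_MMinus_of_gt h hH.2 hc (le_of_lt hs), normSq,
          mul_signedIndicator_max (le_of_lt hs)]
      rw [h5.differentiableAt_iff]
      exact h4.differentiableAt
    · exact h3.rpow_const (Or.inl h0.ne')

end timeChange

end RSFBM

namespace RSFBM

/-! ### The law of the fractional integral of a deterministic integrand -/

section law

variable {Ω : Type*} [MeasurableSpace Ω] {P : Measure Ω} [IsProbabilityMeasure P]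

/-- Given A = a, the characteristic function is exp(-v a ξ²/2); averaging over a is the Laplace
transform at vξ²/2. -/
lemma charFun_map_sqrt_mul {A Y : Ω → ℝ} {v : ℝ≥0} (hA : Measurable A)
    (hpos : ∀ᵐ ω ∂P, 0 < A ω) (hY : HasLaw Y (gaussianReal 0 v) P) (hAY : IndepFun A Y P)
    (ξ : ℝ) :
    charFun (P.map fun ω => √(A ω) * Y ω) ξ = (laplace (P.map A) (v * (ξ ^ 2 / 2)) : ℂ) := by
  have hYm := hY.aemeasurable
  have := Measure.isProbabilityMeasure_map (μ := P) hA.aemeasurable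
  have hposA : ∀ᵐ a ∂P.map A, 0 < a := (ae_map_iff hA.aemeasurable measurableSet_Ioi).2 hpos
  have hint : Integrable (fun p : ℝ × ℝ => Complex.exp (ξ * ((√p.1 * p.2 : ℝ) : ℂ) * Complex.I))
      ((P.map A).prod (gaussianReal 0 v)) := by
    refine Integrable.of_bound (by fun_prop) 1 (ae_of_all _ fun p => ?_)
    rw [← Complex.ofReal_mul, Complex.norm_exp_ofReal_mul_I]
  have h1 : P.map (fun ω => √(A ω) * Y ω) =
      ((P.map A).prod (gaussianReal 0 v)).map fun p => √p.1 * p.2 := by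
    rw [← HasLaw.map_prodMk_eq hA hY hAY, AEMeasurable.map_map_of_aemeasurable (by fun_prop)
      (by fun_prop)]
    rfl
  rw [charFun_apply_real, h1, integral_map (by fun_prop) (by fun_prop), integral_prod _ hint,
    laplace, ← integral_complex_ofReal]
  refine integral_congr_ae ?_
  filter_upwards [hposA] with a ha
  have h2 := charFun_gaussianReal (μ := 0) (v := v) (ξ * √a)
  rw [charFun_apply_real] at h2
  have h3 : ∀ y : ℝ, Complex.exp (ξ * ((√a * y : ℝ) : ℂ) * Complex.I) =
      Complex.exp (((ξ * √a : ℝ) : ℂ) * y * Complex.I) := fun y => by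
    push_cast
    congr 1
    ring
  simp_rw [h3]
  rw [h2, Complex.ofReal_exp]
  congr 1
  have h4 : ((√a : ℝ) : ℂ) ^ 2 = a := by rw [← Complex.ofReal_pow, Real.sq_sqrt ha.le]
  push_cast
  rw [mul_pow, h4]
  ring

lemma continuousOn_laplace {μ : Measure ℝ} [IsProbabilityMeasure μ] (hμ : ∀ᵐ x ∂μ, 0 < x) :
    ContinuousOn (laplace μ) (Ici 0) := by
  intro t _
  refine continuousWithinAt_of_dominated (bound := fun _ => 1)
    (Eventually.of_forall fun s => by fun_prop) ?_ (integrable_const _)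
    (ae_of_all _ fun x => (by fun_prop : Continuous fun s : ℝ =>
      Real.exp (-(s * x))).continuousWithinAt)
  filter_upwards [self_mem_nhdsWithin] with s hs
  filter_upwards [hμ] with x hx
  rw [Real.norm_of_nonneg (Real.exp_pos _).le]
  exact Real.exp_le_one_iff.2 (neg_nonpos.2 (mul_nonneg hs hx.le))

/-- The characteristic function and the variance of the fractional integral of `ν` over `[0,t)`. -/
lemma IsFracItoIntegral.charFun_and_variance {H : ℝ} (hH : H ∈ Ioo (0 : ℝ) 1) {B : ℝ → Ω → ℝ}
    (hB : IsTwoSidedBrownianMotion B P) {A : Ω → ℝ} (hA : Measurable A)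
    (hA_pos : ∀ᵐ ω ∂P, 0 < A ω) (hAB : IndepFun A (fun ω t => B t ω) P)
    (hR : 0 < holomorphyRadius (laplace (P.map A))) {c : ℝ} (hc : 0 < c)
    (hcA : Integrable (fun ω => Real.exp (c * A ω)) P) {ν : ℝ → ℝ} (hν : ContinuousOn ν (Ici 0))
    (hconst : H < 1 / 2 → ∃ c : ℝ, ∀ s, 0 ≤ s → ν s = c) {t : ℝ} (ht : 0 ≤ t) {Z : Ω → ℝ}
    (hZ : IsFracItoIntegral H B A P (Ico 0 t) (fun s _ => ν s) Z) :
    (∀ ξ, charFun (P.map Z) ξ = (laplace (P.map A) (normSq H ν t * (ξ ^ 2 / 2)) : ℂ)) ∧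
      variance Z P = (∫ ω, A ω ∂P) * normSq H ν t := by
  have hg := memLp_MMinus hH hν hconst ht
  have hG := hB.isWienerIntegral hg
  have hZe := hZ.ae_eq hB hA hA_pos hAB hR hc hcA hg (setIntegral_MPlus hH hν hconst ht) hG
  have hlaw := hG.hasLaw hB hg
  have hAG := hG.indepFun hB hAB
  have hGm := hlaw.aemeasurable
  have hv : (((∫ x, MMinus H (fun s => ν s * signedIndicator 0 t s) x ^ 2).toNNReal : ℝ≥0) : ℝ) =
      normSq H ν t := Real.coe_toNNReal _ (normSq_nonneg t)
  constructor
  · intro ξ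
    rw [Measure.map_congr hZe, charFun_map_sqrt_mul hA hA_pos hlaw hAG, hv]
  · rw [variance_congr hZe, variance_of_integral_eq_zero (by fun_prop)
      (integral_sqrt_mul_eq_zero hA hlaw hAG)]
    have := integral_sq_sqrt_mul hA_pos hA hlaw hAG
    rw [hv] at this
    exact this

lemma monotoneOn_normSq_of_variance {H : ℝ} {ν : ℝ → ℝ} {A : Ω → ℝ} (hA1 : Integrable A P)
    (hA_pos : ∀ᵐ ω ∂P, 0 < A ω) {Z : ℝ → Ω → ℝ}
    (hvar : ∀ t, 0 ≤ t → variance (Z t) P = (∫ ω, A ω ∂P) * normSq H ν t)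
    (hmono : MonotoneOn (fun t => variance (Z t) P) (Ici 0)) : MonotoneOn (normSq H ν) (Ici 0) := by
  have hpos : 0 < ∫ ω, A ω ∂P := by
    rw [integral_pos_iff_support_of_nonneg_ae (hA_pos.mono fun ω h => h.le) hA1]
    have : Function.support A =ᵐ[P] univ := by
      rw [ae_eq_univ]
      exact measure_mono_null (fun ω h => by simpa using fun h' : 0 < A ω => h h'.ne') hA_pos
    rw [measure_congr this]
    simp
  intro s hs t ht hst
  have h := hmono hs ht hst
  simp only [hvar s hs, hvar t ht] at h
  exact le_of_mul_le_mul_left h hpos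

lemma aestronglyMeasurable_kernel {K : ℝ → ℝ → ℝ → ℝ}
    (hK : Measurable fun p : Ioi (0 : ℝ) × Ioi (0 : ℝ) × ℝ => K p.1 p.2.1 p.2.2) {T : ℝ}
    (hT : 0 < T) :
    AEStronglyMeasurable (fun p : ℝ × ℝ => K T p.1 (p.2 ^ 2 / 2))
      ((volume.restrict (Ioo 0 T)).prod volume) := by
  -- Measurability of K is known for positive times only; the value 1 is a filler off the domain of
  -- integration.
  have hι : Measurable fun r : ℝ => (⟨if 0 < r then r else 1, by
      rw [mem_Ioi]; split_ifs with h <;> [exact h; exact one_pos]⟩ : Ioi (0 : ℝ)) :=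
    (Measurable.ite measurableSet_Ioi measurable_id measurable_const).subtype_mk
  have hm : Measurable fun p : ℝ × ℝ => K T (if 0 < p.1 then p.1 else 1) (p.2 ^ 2 / 2) :=
    hK.comp ((measurable_const (a := (⟨T, hT⟩ : Ioi (0 : ℝ)))).prodMk
      ((hι.comp measurable_fst).prodMk (by fun_prop : Measurable fun p : ℝ × ℝ => p.2 ^ 2 / 2)))
  have hmem : ∀ᵐ p ∂((volume.restrict (Ioo 0 T)).prod (volume : Measure ℝ)), p.1 ∈ Ioo 0 T :=
    Measure.quasiMeasurePreserving_fst.ae (ae_restrict_mem measurableSet_Ioo)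
  refine hm.aestronglyMeasurable.congr ?_
  filter_upwards [hmem] with p hp
  rw [if_pos hp.1]

end law

end RSFBM

/-! ### Assembly of the evolution equation -/

theorem mainTheorem3 {Ω : Type*} [MeasurableSpace Ω] (P : Measure Ω) [IsProbabilityMeasure P]
    (H : ℝ) (hH : H ∈ Ioo (0 : ℝ) 1)
    -- the two-sided Brownian motion and the independent positive random variable
    (B : ℝ → Ω → ℝ) (hB : RSFBM.IsTwoSidedBrownianMotion B P)
    (A : Ω → ℝ) (hA : Measurable A) (hA_pos : ∀ᵐ ω ∂P, 0 < A ω)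
    (hAB : IndepFun A (fun ω t => B t ω) P)
    (hR : 0 < RSFBM.holomorphyRadius (RSFBM.laplace (P.map A)))
    -- the process `Z_t = ∫_0^t ν(s) dX_s` with increasing variance
    (ν : ℝ → ℝ) (hν : ContinuousOn ν (Ici 0))
    (hν_const : H < 1 / 2 → ∃ c : ℝ, ∀ s, 0 ≤ s → ν s = c)
    (Z : ℝ → Ω → ℝ)
    (hZ : ∀ t, 0 ≤ t → RSFBM.IsFracItoIntegral H B A P (Ico 0 t) (fun s _ => ν s) (Z t))
    (hZ_var : MonotoneOn (fun t => variance (Z t) P) (Ici 0))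
    -- the kernel
    (K : ℝ → ℝ → ℝ → ℝ)
    (hK : Measurable fun p : Ioi (0 : ℝ) × Ioi (0 : ℝ) × ℝ => K p.1 p.2.1 p.2.2)
    (hK_laplace : ∀ t ξ : ℝ, 0 < t → 0 < ξ →
      RSFBM.laplace (P.map A) (t ^ (2 * H) * ξ) =
        1 + ∫ s in (0 : ℝ)..t, K t s ξ * RSFBM.laplace (P.map A) (s ^ (2 * H) * ξ))
    (hK_temp : ∀ t s : ℝ, 0 < s → s ≤ t → RSFBM.IsTemperedFunction fun ξ => |K t s (ξ ^ 2 / 2)|)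
    (hK_int : ∀ t : ℝ, 0 < t → ∀ f : 𝓢(ℝ, ℝ),
      IntegrableOn (fun s => ∫ ξ : ℝ, |K t s (ξ ^ 2 / 2)| * f ξ) (Ioo 0 t))
    -- the initial value
    (u₀ : 𝓢(ℝ, ℝ)) :
    let σ : ℝ → ℝ := RSFBM.timeChange H ν
    let u : ℝ → ℝ → ℝ := fun t x => ∫ ω, u₀ (x + Z t ω) ∂P
    -- all terms of the evolution equation are well defined
    (∀ s, 0 < s → DifferentiableAt ℝ σ s) ∧
    (∀ s t, 0 < s → s ≤ t → 0 < σ s →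
      RSFBM.PsiDODefined (fun ξ => K (σ t) (σ s) (ξ ^ 2 / 2)) (u s)) ∧
    (∀ t x, 0 < t → IntervalIntegrable
      (fun s => ((deriv σ s : ℝ) : ℂ) * RSFBM.psiDO (fun ξ => K (σ t) (σ s) (ξ ^ 2 / 2)) (u s) x)
      volume 0 t) ∧
    -- the evolution equation
    (∀ t x, 0 < t →
      (u t x : ℂ) = (u₀ x : ℂ) + ∫ s in (0 : ℝ)..t,
        ((deriv σ s : ℝ) : ℂ) * RSFBM.psiDO (fun ξ => K (σ t) (σ s) (ξ ^ 2 / 2)) (u s) x) ∧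
    -- regularity of the solution
    (∀ x, ContinuousOn (fun t => u t x) (Ici 0)) ∧
    (∀ t, 0 ≤ t → ContDiff ℝ (⊤ : ℕ∞) (u t)) := by
  have hAm := hA.aemeasurable (μ := P)
  have hprobA := Measure.isProbabilityMeasure_map hAm
  have hposA : ∀ᵐ a ∂P.map A, 0 < a := (ae_map_iff hAm measurableSet_Ioi).2 hA_pos
  obtain ⟨c, hc, hcA'⟩ := RSFBM.exists_integrable_exp_of_holomorphyRadius_pos hposA hR
  have hcA : Integrable (fun ω => Real.exp (c * A ω)) P :=
    (integrable_map_measure (g := fun x => Real.exp (c * x)) (by fun_prop) hAm).1 hcA'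
  have hA1 : Integrable A P :=
    (RSFBM.memLp_two_of_integrable_exp hA hA_pos hc hcA).integrable one_le_two
  have hlaw := fun t (ht : 0 ≤ t) =>
    (hZ t ht).charFun_and_variance hH hB hA hA_pos hAB hR hc hcA hν hν_const ht
  have hmono : MonotoneOn (RSFBM.normSq H ν) (Ici 0) :=
    RSFBM.monotoneOn_normSq_of_variance hA1 hA_pos (fun t ht => (hlaw t ht).2) hZ_var
  have hZm : ∀ t, 0 ≤ t → AEMeasurable (Z t) P := fun t ht => (hZ t ht).mem.2.aemeasurable
  intro σ u
  set L := RSFBM.laplace (P.map A) with hL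
  have hH0 := hH.1
  have hV0 : ∀ t, 0 ≤ RSFBM.normSq H ν t := fun t => RSFBM.normSq_nonneg t
  have hσ_eq : ∀ t, 0 ≤ t → σ t = RSFBM.normSq H ν t ^ (1 / (2 * H)) := fun t ht =>
    RSFBM.timeChange_eq hH hν hν_const ht
  have hσ_rpow : ∀ t, 0 ≤ t → σ t ^ (2 * H) = RSFBM.normSq H ν t := fun t ht =>
    RSFBM.timeChange_rpow hH hν hν_const ht
  have hσ0 : ∀ t, 0 ≤ t → 0 ≤ σ t := fun t ht => by
    rw [hσ_eq t ht]
    exact Real.rpow_nonneg (hV0 t) _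
  have hσ_zero : σ 0 = 0 := by
    rw [hσ_eq 0 le_rfl, RSFBM.normSq_zero, Real.zero_rpow (by positivity)]
  have hσ_diff : ∀ s, 0 < s → DifferentiableAt ℝ σ s := fun s hs =>
    RSFBM.differentiableAt_timeChange hH hν hν_const hmono hs
  have hV_cont := RSFBM.continuousOn_normSq hH hν hν_const
  have hσ_cont : ContinuousOn σ (Ici 0) :=
    (hV_cont.rpow_const fun t _ => Or.inr (by positivity)).congr fun t ht => hσ_eq t ht
  have hσ_mono : MonotoneOn σ (Ici 0) := by
    intro s hs t ht hst
    rw [hσ_eq s hs, hσ_eq t ht]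
    exact Real.rpow_le_rpow (hV0 s) (hmono hs ht hst) (by positivity)
  have hcf : ∀ t, 0 ≤ t → ∀ ξ, charFun (P.map (Z t)) ξ = (L (σ t ^ (2 * H) * (ξ ^ 2 / 2)) : ℂ) :=
    fun t ht ξ => by rw [hσ_rpow t ht, (hlaw t ht).1]
  have hu : ∀ t, 0 ≤ t → u t = fun x => ∫ z, u₀ (x + z) ∂P.map (Z t) := fun t ht => by
    ext x
    exact (integral_map (hZm t ht) (u₀.continuous.comp
      (continuous_const.add continuous_id)).aestronglyMeasurable).symm
  have hprob : ∀ t, 0 ≤ t → IsProbabilityMeasure (P.map (Z t)) := fun t ht =>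
    Measure.isProbabilityMeasure_map (hZm t ht)
  obtain ⟨U, hU, hUinv⟩ := RSFBM.exists_schwartz_fourier u₀
  have hu_eq : ∀ t, 0 ≤ t → ∀ x, (u t x : ℂ) = 1 / (2 * Real.pi) *
      ∫ ξ : ℝ, Complex.exp (Complex.I * (x * ξ)) *
        ((L (σ t ^ (2 * H) * (ξ ^ 2 / 2)) : ℂ) * U ξ) := by
    intro t ht x
    have := hprob t ht
    rw [hu t ht, RSFBM.ofReal_integral_add_eq u₀ hUinv]
    simp_rw [hcf t ht]
  have hpsi : ∀ s, 0 ≤ s → ∀ (m : ℝ → ℝ) x, RSFBM.psiDO m (u s) x = 1 / (2 * Real.pi) *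
      ∫ ξ : ℝ, Complex.exp (Complex.I * (x * ξ)) *
        ((m ξ : ℂ) * ((L (σ s ^ (2 * H) * (ξ ^ 2 / 2)) : ℂ) * U ξ)) := by
    intro s hs m x
    have := hprob s hs
    rw [hu s hs, RSFBM.psiDO_integral_add u₀ hU]
    simp_rw [hcf s hs]
  have hL_meas : Measurable fun p : ℝ × ℝ => L (p.1 ^ (2 * H) * (p.2 ^ 2 / 2)) :=
    RSFBM.measurable_laplace.comp (by fun_prop)
  have hL_le : ∀ r ξ : ℝ, 0 ≤ r → |L (r ^ (2 * H) * (ξ ^ 2 / 2))| ≤ 1 := fun r ξ hr => by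
    rw [abs_of_nonneg (RSFBM.laplace_nonneg _)]
    exact RSFBM.laplace_le_one hposA (mul_nonneg (Real.rpow_nonneg hr _) (by positivity))
  -- the evolution equation in the time variable `σ t`
  have hkernel : ∀ T x : ℝ, 0 < T → _ := fun T x hT =>
    RSFBM.kernel_evolution (k := fun r ξ => K T r (ξ ^ 2 / 2))
      (φ := fun r ξ => L (r ^ (2 * H) * (ξ ^ 2 / 2))) hT
      (RSFBM.aestronglyMeasurable_kernel hK hT) (fun r hr => hK_temp T r hr.1 hr.2.le)
      (hK_int T hT) hL_meas (fun r ξ hr => hL_le r ξ hr.le)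
      (fun ξ hξ => by
        have := hK_laplace T (ξ ^ 2 / 2) hT (by positivity)
        rwa [intervalIntegral.integral_of_le hT.le,
          setIntegral_congr_set (Ioo_ae_eq_Ioc (a := (0 : ℝ)) (b := T)).symm] at this) U x
  let Ψ : ℝ → ℝ → ℝ → ℂ := fun T x r => 1 / (2 * Real.pi) *
    ∫ ξ : ℝ, Complex.exp (Complex.I * (x * ξ)) *
      ((K T r (ξ ^ 2 / 2) : ℂ) * ((L (r ^ (2 * H) * (ξ ^ 2 / 2)) : ℂ) * U ξ))
  have hΨ : ∀ t x, 0 ≤ t → IntegrableOn (Ψ (σ t) x) (Ioo 0 (σ t)) ∧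
      ∫ r in Ioo 0 (σ t), Ψ (σ t) x r = (u t x : ℂ) - (u₀ x : ℂ) := by
    intro t x ht
    rw [hu_eq t ht, hUinv x]
    -- If σ t = 0, the integration interval is empty and u(t,·) = u₀, since L[A](0) = 1. Nothing is
    -- needed of K at time 0.
    rcases (hσ0 t ht).eq_or_lt with h | h
    · rw [← h, Ioo_self]
      simp [Real.zero_rpow (by positivity : 2 * H ≠ 0), hL, RSFBM.laplace]
    · exact hkernel (σ t) x h
  have hchange : ∀ t x, 0 < t → IntegrableOn (fun s => deriv σ s • Ψ (σ t) x (σ s)) (Ioo 0 t) ∧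
      ∫ s in Ioo 0 t, deriv σ s • Ψ (σ t) x (σ s) = ∫ r in Ioo 0 (σ t), Ψ (σ t) x r :=
    fun t x ht => RSFBM.integral_deriv_smul_comp_of_monotoneOn ht hσ_zero
      (hσ_mono.mono Icc_subset_Ici_self) (hσ_cont.mono Icc_subset_Ici_self)
      (fun s hs => hσ_diff s hs.1) (hΨ t x ht.le).1
  -- Where σ s = 0 with s > 0, the nonnegative function σ has an interior minimum, so its derivative
  -- vanishes and the arbitrary value of K at time 0 is multiplied by 0.
  have hintegrand : ∀ t x, ∀ s ∈ Ioo 0 t, deriv σ s • Ψ (σ t) x (σ s) =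
      ((deriv σ s : ℝ) : ℂ) * RSFBM.psiDO (fun ξ => K (σ t) (σ s) (ξ ^ 2 / 2)) (u s) x :=
    fun t x s hs => by rw [hpsi s hs.1.le, Complex.real_smul]
  refine ⟨hσ_diff, fun s t hs hst hσs => ?_, fun t x ht => ?_, fun t x ht => ?_, fun x => ?_,
    fun t ht => ?_⟩
  · have := hprob s hs.le
    rw [hu s hs.le]
    refine RSFBM.psiDODefined_integral_add u₀ hU ?_
    have hσt : 0 < σ t := hσs.trans_le (hσ_mono hs.le (hs.le.trans hst) hst)
    have hKm : Measurable fun ξ : ℝ => K (σ t) (σ s) (ξ ^ 2 / 2) :=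
      hK.comp ((measurable_const (a := (⟨σ t, hσt⟩ : Ioi (0 : ℝ)))).prodMk
        ((measurable_const (a := (⟨σ s, hσs⟩ : Ioi (0 : ℝ)))).prodMk
          (by fun_prop : Measurable fun ξ : ℝ => ξ ^ 2 / 2)))
    refine ((hK_temp _ _ hσs (hσ_mono hs.le (hs.le.trans hst) hst)).integrable_mul U).mono
      ((Complex.measurable_ofReal.comp hKm).mul U.continuous.measurable).aestronglyMeasurable
      (ae_of_all _ fun ξ => ?_)
    simp
  · rw [intervalIntegrable_iff_integrableOn_Ioo_of_le ht.le]
    exact (hchange t x ht).1.congr_fun (hintegrand t x) measurableSet_Ioo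
  · rw [intervalIntegral.integral_of_le ht.le,
      setIntegral_congr_set (Ioo_ae_eq_Ioc (a := (0 : ℝ)) (b := t)).symm,
      ← setIntegral_congr_fun measurableSet_Ioo (hintegrand t x), (hchange t x ht).2,
      (hΨ t x ht.le).2, add_sub_cancel]
  -- Continuity in t is read off the Fourier representation by dominated convergence, with bound
  -- |U|.
  · have h1 : ContinuousOn (fun t => (1 / (2 * Real.pi) : ℂ) *
        ∫ ξ : ℝ, Complex.exp (Complex.I * (x * ξ)) *
          ((L (σ t ^ (2 * H) * (ξ ^ 2 / 2)) : ℂ) * U ξ)) (Ici 0) := by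
      refine continuousOn_const.mul fun t ht => ?_
      refine continuousWithinAt_of_dominated (bound := fun ξ => ‖U ξ‖)
        (Eventually.of_forall fun s => ?_) ?_ U.integrable.norm (ae_of_all _ fun ξ => ?_)
      · have hLξ : Measurable fun ξ : ℝ => L (σ s ^ (2 * H) * (ξ ^ 2 / 2)) :=
          hL_meas.comp ((measurable_const (a := σ s)).prodMk measurable_id)
        have hUm := U.continuous.measurable
        exact ((by fun_prop : Measurable fun ξ : ℝ => Complex.exp (Complex.I * (x * ξ))).mul
          ((Complex.measurable_ofReal.comp hLξ).mul hUm)).aestronglyMeasurable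
      · filter_upwards [self_mem_nhdsWithin] with s hs
        refine ae_of_all _ fun ξ => ?_
        rw [norm_mul, RSFBM.norm_cexp_I_mul_ofReal_mul, one_mul, norm_mul, Complex.norm_real]
        exact mul_le_of_le_one_left (norm_nonneg _) (hL_le _ ξ (hσ0 s hs))
      · have h2 : ContinuousOn (fun t => L (σ t ^ (2 * H) * (ξ ^ 2 / 2))) (Ici 0) :=
          (RSFBM.continuousOn_laplace hposA).comp
            ((hσ_cont.rpow_const fun _ _ => Or.inr (by positivity)).mul_const _)
            fun s hs => mul_nonneg (Real.rpow_nonneg (hσ0 s hs) _) (by positivity)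
        exact continuousWithinAt_const.mul
          ((Complex.continuous_ofReal.continuousAt.comp_continuousWithinAt (h2 t ht)).mul_const _)
    refine (Complex.continuous_re.comp_continuousOn h1).congr fun t ht => ?_
    rw [Function.comp_apply, ← hu_eq t ht x, Complex.ofReal_re]
  · have := hprob t ht
    rw [hu t ht]
    exact RSFBM.contDiff_integral_add u₀
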